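/- Let $G$ be a finite simple undirected graph of order $n(G)$, with vertex degrees $d_G(u)$, and let $\tau:V(G)\to\mathbb{N}_0$ be a threshold function with $\tau(u)\le d_G(u)$ for every vertex $u$. For a set $X\subseteq V(G)$, let $X_0=X$ and $X_t=\{u\in V(G):|N_G(u)\cap X_{t-1}|\ge\tau(u)\}$ for every integer $t\geq 1$; the set $X$ is a *non-monotone target set* for $(G,\tau)$ if there is some $t_0$ with $X_t=V(G)$ for every $t\ge t_0$. A *tree decomposition* of $G$ is a pair $(T,(X_t)_{t\in V(T)})$, where $T$ is a tree, $X_t\subseteq V(G)$ for every node $t$ of $T$, the set $\{t\in V(T):u\in X_t\}$ induces a non-empty subtree of $T$ for every vertex $u$ of $G$, and for every edge $uv$ of $G$ there is a node $t$ with $u,v\in X_t$. Its *width* is $\max\{|X_t|:t\in V(T)\}-1$. It is *nice* if $T$ is a rooted binary tree and every node $t$ of $T$ either is a leaf with $X_t=\emptyset$, or has exactly two children $t',t''$ and $X_t=X_{t'}=X_{t''}$, or has exactly one child $t'$ and either $|X_t\setminus X_{t'}|=1$ and $X_{t'}\subseteq X_t$, or $|X_{t'}\setminus X_t|=1$ and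 $X_t\subseteq X_{t'}$. **Theorem.** There are a polynomial ${\rm poly}$ and an algorithm with the following property. Given - a pair $(G,\tau)$ as above with $\tau(u)\in\{0,1,d_G(u)\}$ for every vertex $u$ of $G$, and - a nice tree decomposition $(T,(X_t)_{t\in V(T)})$ of $G$ of width $w$, where $T$ has order $n(T)$, the algorithm determines the minimum order of a non-monotone target set for $(G,\tau)$ in time at most $$2^{5w}\cdot n(T)\cdot{\rm poly}(n(G)).$$ Here, time is the number of steps on a word RAM with words of $O(w+1+\log(n(G)+n(T)))$ bits, whose steps are the usual arithmetic, memory-access, and branching operations. The graph is given by its adjacency matrix, $T$ by its root and the parent of each node, and the sets $X_t$ by their $0/1$ incidence vectors. -/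

import Mathlib

/-! ### Non-monotone activation processes -/

namespace NonMonotone

variable {V : Type*} [Fintype V] [DecidableEq V]

/-- The non-monotone activation process on `(G, τ)` starting with `X`. -/
def activation (G : SimpleGraph V) [DecidableRel G.Adj] (τ : V → ℕ) (X : Finset V) :
    ℕ → Finset V
  | 0 => X
  | t + 1 => Finset.univ.filter fun u =>
      τ u ≤ (G.neighborFinset u ∩ activation G τ X t).card

/-- `X` is a non-monotone target set for `(G, τ)`. -/
def IsTargetSet (G : SimpleGraph V) [DecidableRel G.Adj] (τ : V → ℕ) (X : Finset V) : Prop :=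
  ∃ t₀ : ℕ, ∀ t ≥ t₀, activation G τ X t = Finset.univ

end NonMonotone

/-! ### Nice tree decompositions -/

/-- A rooted tree with node set `N`, given by its root and its parent function: the root is its own
parent, and iterating the parent function leads from every node to the root. -/
structure ParentTree (N : Type*) where
  root : N
  parent : N → N
  parent_root : parent root = root
  reaches_root : ∀ t, ∃ k : ℕ, parent^[k] t = root

namespace ParentTree

variable {N : Type*}

/-- The underlying undirected tree: every node other than the root is joined to its parent. -/
def graph (T : ParentTree N) : SimpleGraph N :=
  SimpleGraph.fromRel fun s t => T.parent s = t

/-- The children of the node `t`. -/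
def children [Fintype N] [DecidableEq N] (T : ParentTree N) (t : N) : Finset N :=
  Finset.univ.filter fun s => s ≠ T.root ∧ T.parent s = t

variable {V : Type*}

/-- `(T, X)` is a tree decomposition of `G`. (`Connected` includes being non-empty.) -/
structure IsTreeDecomposition (T : ParentTree N) (G : SimpleGraph V) (X : N → Finset V) :
    Prop where
  subtree : ∀ u : V, (T.graph.induce {t | u ∈ X t}).Connected
  edge : ∀ u v : V, G.Adj u v → ∃ t, u ∈ X t ∧ v ∈ X t

variable [Fintype N] [DecidableEq N] [DecidableEq V]

/-- Every node is a leaf node, a join node, an introduce node or a forget node. In particular, every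
node has at most two children. -/
def IsNice (T : ParentTree N) (X : N → Finset V) : Prop :=
  ∀ t, (T.children t = ∅ ∧ X t = ∅) ∨
    (∃ t' t'', t' ≠ t'' ∧ T.children t = {t', t''} ∧ X t = X t' ∧ X t = X t'') ∨
    (∃ t', T.children t = {t'} ∧ (X t \ X t').card = 1 ∧ (X t' \ X t).card = 0) ∨
    (∃ t', T.children t = {t'} ∧ (X t' \ X t).card = 1 ∧ (X t \ X t').card = 0)

end ParentTree

/-- The width of a tree decomposition with bags `X` (it is `-1` if all bags are empty). -/
def bagWidth {N V : Type*} [Fintype N] (X : N → Finset V) : ℤ :=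
  ((Finset.univ.sup fun t => (X t).card : ℕ) : ℤ) - 1

/-! ### A word RAM

A program is a structured (while) program. It uses finitely many registers and finitely many arrays,
selected by fixed numbers in the program text; array cells are addressed by computed words. All
registers and cells hold words, that is, natural numbers below `2 ^ ℓ`, where `ℓ` is the word length.
Every arithmetic operation, constant, register access, memory access, and branch takes one step. A
program whose execution would produce a number that is not a word gets stuck. -/

namespace WordRAM

/-- The contents of the registers and of the arrays: `mem a i` is the cell `i` of the array `a`. -/
structure State where
  reg : ℕ → ℕ
  mem : ℕ → ℕ → ℕ

/-- Change the content of one register. -/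
def State.setReg (s : State) (x v : ℕ) : State :=
  { s with reg := Function.update s.reg x v }

/-- Change the content of one array cell. -/
def State.setMem (s : State) (a i v : ℕ) : State :=
  { s with mem := Function.update s.mem a (Function.update (s.mem a) i v) }

/-- Expressions; `load a i` reads the cell of the array `a` whose index is the value of `i`. -/
inductive Expr where
  | lit (c : ℕ)
  | reg (x : ℕ)
  | load (a : ℕ) (i : Expr)
  | add (e f : Expr)
  | sub (e f : Expr)
  | mul (e f : Expr)
  | div (e f : Expr)

namespace Expr

/-- The value of an expression; subtraction is truncated, division rounds down. -/
def eval (s : State) : Expr → ℕ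
  | lit c => c
  | reg x => s.reg x
  | load a i => s.mem a (i.eval s)
  | add e f => e.eval s + f.eval s
  | sub e f => e.eval s - f.eval s
  | mul e f => e.eval s * f.eval s
  | div e f => e.eval s / f.eval s

/-- The number of steps for evaluating an expression, which is its number of nodes. -/
def cost : Expr → ℕ
  | lit _ => 1
  | reg _ => 1
  | load _ i => i.cost + 1
  | add e f => e.cost + f.cost + 1
  | sub e f => e.cost + f.cost + 1
  | mul e f => e.cost + f.cost + 1
  | div e f => e.cost + f.cost + 1

/-- All values that occur in the evaluation of an expression are words of length `ℓ`. -/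
def Fits (ℓ : ℕ) (s : State) : Expr → Prop
  | lit c => c < 2 ^ ℓ
  | reg x => s.reg x < 2 ^ ℓ
  | load a i => i.Fits ℓ s ∧ s.mem a (i.eval s) < 2 ^ ℓ
  | add e f => e.Fits ℓ s ∧ f.Fits ℓ s ∧ e.eval s + f.eval s < 2 ^ ℓ
  | sub e f => e.Fits ℓ s ∧ f.Fits ℓ s
  | mul e f => e.Fits ℓ s ∧ f.Fits ℓ s ∧ e.eval s * f.eval s < 2 ^ ℓ
  | div e f => e.Fits ℓ s ∧ f.Fits ℓ s

end Expr

/-- Programs; in `ite` and `loop` (a while loop), a condition holds if its value is not `0`. -/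
inductive Prog where
  | skip
  | assign (x : ℕ) (e : Expr)
  | store (a : ℕ) (i e : Expr)
  | seq (p q : Prog)
  | ite (c : Expr) (p q : Prog)
  | loop (c : Expr) (p : Prog)

/-- `Exec ℓ p s t s'`: with words of length `ℓ`, the program `p`, started in the state `s`, halts
after exactly `t` steps in the state `s'`. -/
inductive Exec (ℓ : ℕ) : Prog → State → ℕ → State → Prop
  | skip (s : State) : Exec ℓ .skip s 1 s
  | assign (s : State) (x : ℕ) (e : Expr) (he : e.Fits ℓ s) :
      Exec ℓ (.assign x e) s (e.cost + 1) (s.setReg x (e.eval s))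
  | store (s : State) (a : ℕ) (i e : Expr) (hi : i.Fits ℓ s) (he : e.Fits ℓ s) :
      Exec ℓ (.store a i e) s (i.cost + e.cost + 1) (s.setMem a (i.eval s) (e.eval s))
  | seq {p q : Prog} {s s' s'' : State} {t t' : ℕ} (hp : Exec ℓ p s t s')
      (hq : Exec ℓ q s' t' s'') : Exec ℓ (.seq p q) s (t + t') s''
  | ite_true {c : Expr} {p q : Prog} {s s' : State} {t : ℕ} (hf : c.Fits ℓ s)
      (hc : c.eval s ≠ 0) (hp : Exec ℓ p s t s') : Exec ℓ (.ite c p q) s (c.cost + 1 + t) s'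
  | ite_false {c : Expr} {p q : Prog} {s s' : State} {t : ℕ} (hf : c.Fits ℓ s)
      (hc : c.eval s = 0) (hq : Exec ℓ q s t s') : Exec ℓ (.ite c p q) s (c.cost + 1 + t) s'
  | loop_true {c : Expr} {p : Prog} {s s' s'' : State} {t t' : ℕ} (hf : c.Fits ℓ s)
      (hc : c.eval s ≠ 0) (hp : Exec ℓ p s t s') (hl : Exec ℓ (.loop c p) s' t' s'') :
      Exec ℓ (.loop c p) s (c.cost + 1 + t + t') s''
  | loop_false {c : Expr} {p : Prog} {s : State} (hf : c.Fits ℓ s) (hc : c.eval s = 0) :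
      Exec ℓ (.loop c p) s (c.cost + 1) s

/-- Programs are deterministic: the number of steps and the final state are determined. -/
theorem Exec.deterministic {ℓ : ℕ} {p : Prog} {s s₁ s₂ : State} {t₁ t₂ : ℕ}
    (h₁ : Exec ℓ p s t₁ s₁) (h₂ : Exec ℓ p s t₂ s₂) : t₁ = t₂ ∧ s₁ = s₂ := by
  induction h₁ generalizing t₂ s₂ with
  | skip s => cases h₂; exact ⟨rfl, rfl⟩
  | assign s x e he => cases h₂; exact ⟨rfl, rfl⟩
  | store s a i e hi he => cases h₂; exact ⟨rfl, rfl⟩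
  | seq hp hq ihp ihq =>
    cases h₂ with
    | seq hp' hq' =>
      obtain ⟨rfl, rfl⟩ := ihp hp'
      obtain ⟨rfl, rfl⟩ := ihq hq'
      exact ⟨rfl, rfl⟩
  | ite_true hf hc hp ih =>
    cases h₂ with
    | ite_true hf' hc' hp' =>
      obtain ⟨rfl, rfl⟩ := ih hp'
      exact ⟨rfl, rfl⟩
    | ite_false hf' hc' hp' => exact absurd hc' hc
  | ite_false hf hc hp ih =>
    cases h₂ with
    | ite_true hf' hc' hp' => exact absurd hc hc'
    | ite_false hf' hc' hp' =>
      obtain ⟨rfl, rfl⟩ := ih hp'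
      exact ⟨rfl, rfl⟩
  | loop_true hf hc hp hl ihp ihl =>
    cases h₂ with
    | loop_true hf' hc' hp' hl' =>
      obtain ⟨rfl, rfl⟩ := ihp hp'
      obtain ⟨rfl, rfl⟩ := ihl hl'
      exact ⟨rfl, rfl⟩
    | loop_false hf' hc' => exact absurd hc' hc
  | loop_false hf hc =>
    cases h₂ with
    | loop_true hf' hc' hp' hl' => exact absurd hc hc'
    | loop_false hf' hc' => exact ⟨rfl, rfl⟩

/-- The array that lists the values of `f`, followed by zeros. -/
def vecArray {k : ℕ} (f : Fin k → ℕ) (i : ℕ) : ℕ :=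
  if h : i < k then f ⟨i, h⟩ else 0

/-- The array that lists the entries of a 0/1-matrix with `r` rows and `c` columns row by row: the
entry in row `i` and column `j` is in the cell `i * c + j`. Zeros follow. -/
def matArray {r c : ℕ} (R : Fin r → Fin c → Prop) [∀ i j, Decidable (R i j)] (i : ℕ) : ℕ :=
  if h : i / c < r ∧ i % c < c then (if R ⟨i / c, h.1⟩ ⟨i % c, h.2⟩ then 1 else 0) else 0

/-- The initial state for the input `(G, τ)`, `(T, X)`. The registers `0`, `1`, `2` hold the order of
`G`, the order of `T`, and the root of `T`. The arrays `0`, `1`, `2`, `3` hold the adjacency matrix of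
`G`, the thresholds, the parents of the nodes of `T`, and the node-vertex incidence matrix of the
bags. Everything else is `0`. -/
def input {n m : ℕ} (G : SimpleGraph (Fin n)) [DecidableRel G.Adj] (τ : Fin n → ℕ)
    (T : ParentTree (Fin m)) (X : Fin m → Finset (Fin n)) : State where
  reg
    | 0 => n
    | 1 => m
    | 2 => T.root
    | _ => 0
  mem
    | 0 => matArray fun u v => G.Adj u v
    | 1 => vecArray τ
    | 2 => vecArray fun t => (T.parent t : ℕ)
    | 3 => matArray fun t u => u ∈ X t
    | _ => fun _ => 0

end WordRAM

/-! Call a vertex full if its threshold is at least 2, so that it equals the degree. Target sets are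
first described without reference to time. Vertices of threshold 0 are active from time 1 on. A
vertex of threshold 1 becomes active one step after any of its neighbors, so activity among these
vertices spreads along the edges of their bipartite double cover, whose element `2 * u + j` stands
for `u` at times of parity `j`. Once a component of this cover is reached, its activity recurs every
second step and finally fills the whole component.

Hence a set is a target set iff two conditions hold. First, if two full vertices are adjacent, all
their neighbors belong to the set; otherwise the two block each other alternately forever. Second,
every component that has no neighbor of threshold 0 gets a start: an odd element has a neighbor in
the set (activity at time 1), or an even element has a full neighbor whose whole neighborhood lies
in the set (activity at time 2). Necessity is `exists_witness_of_target` and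
`neighbor_mem_of_target`, sufficiency is `target_of_witness`.

With `x` for the set and `g` for "all neighbors are in the set", these conditions can be checked bag
by bag. A bag vertex needs three bits: membership in `x`, and either the value of `g` (threshold
different from 1) or, for each of its two elements of the cover, whether the component has already
been started. The components are global and computed beforehand, so the state need not record
connectivity. The dynamic program treats one tree edge at a time, absorbing a finished node `s` into
its parent `p`. Both labels share the bit for `x`, so a joint label has five bits per vertex. In a
nice decomposition one of the two bags contains the other, so at most `w + 1` vertices are involved,
which gives `32 ^ (w + 1)` joint labels, times `(n + 1) ^ 2` pairs of counts. The factor 32 goes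
into the polynomial. `PartialSol.merge` glues solutions and `IsSol.merge` restricts a global one;
both rest on the separation property of tree edges, `separates_desc`. The bit for a started
component is only a promise in `PartialSol` but exact in `solLabel`, so tables need not contain
every partial solution, only the traces of global ones.

On the machine side, every test of the dynamic program is a single term with bounded sums. Terms
compile to programs with a polynomial time bound (`Tm.exec_compile`), and `Runs` is a calculus of
preconditions with step counts. The nodes are processed from the leaves to the root by a queue; an
additional node with empty bag above the root collects the final table. All contents stay below a
number `M`, and all intermediate values below a fixed power of `M`, which determines the word
length. -/

namespace WordRAM

/-! ### Terms with bounded sums -/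

/-- Terms: expressions extended by sums whose length is the content of a register. -/
inductive Tm where
  | lit (c : ℕ)
  | reg (x : ℕ)
  | load (a : ℕ) (i : Tm)
  | add (e f : Tm)
  | sub (e f : Tm)
  | mul (e f : Tm)
  | div (e f : Tm)
  | sum (x y : ℕ) (e : Tm)

namespace Tm

/-- The value of a term; `sum x y e` adds up `e` over all values of the register `x` that are smaller
than the content of the register `y`. -/
def eval (s : State) : Tm → ℕ
  | lit c => c
  | reg x => s.reg x
  | load a i => s.mem a (i.eval s)
  | add e f => e.eval s + f.eval s
  | sub e f => e.eval s - f.eval s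
  | mul e f => e.eval s * f.eval s
  | div e f => e.eval s / f.eval s
  | sum x y e => ∑ i ∈ Finset.range (s.reg y), e.eval (s.setReg x i)

/-- The weight of a term: its values are less than `M ^ weight` if all registers and cells hold
numbers less than `M`. -/
def weight : Tm → ℕ
  | lit _ => 1
  | reg _ => 1
  | load _ i => i.weight
  | add e f => e.weight + f.weight
  | sub e f => e.weight + f.weight
  | mul e f => e.weight + f.weight
  | div e f => e.weight + f.weight
  | sum _ _ e => e.weight + 1

/-- The constants are small, only registers below `K` are used, the lengths of sums are contents of the
registers `0`, `1`, `2`, and the summation variables are other registers. -/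
def Ok (K : ℕ) : Tm → Prop
  | lit c => c < 64
  | reg x => x < K
  | load _ i => i.Ok K
  | add e f => e.Ok K ∧ f.Ok K
  | sub e f => e.Ok K ∧ f.Ok K
  | mul e f => e.Ok K ∧ f.Ok K
  | div e f => e.Ok K ∧ f.Ok K
  | sum x y e => (3 ≤ x ∧ x < K ∧ y < 3 ∧ y < K) ∧ e.Ok K

instance decidableOk (K : ℕ) : (e : Tm) → Decidable (e.Ok K)
  | lit c => inferInstanceAs (Decidable (c < 64))
  | reg x => inferInstanceAs (Decidable (x < K))
  | load _ i => decidableOk K i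
  | add e f => @instDecidableAnd _ _ (decidableOk K e) (decidableOk K f)
  | sub e f => @instDecidableAnd _ _ (decidableOk K e) (decidableOk K f)
  | mul e f => @instDecidableAnd _ _ (decidableOk K e) (decidableOk K f)
  | div e f => @instDecidableAnd _ _ (decidableOk K e) (decidableOk K f)
  | sum _ _ e => @instDecidableAnd _ _ inferInstance (decidableOk K e)

/-- A program that evaluates a term into the register `k`, with the registers above `k` as scratch. -/
def compile : Tm → ℕ → Prog
  | lit c, k => .assign k (.lit c)
  | reg x, k => .assign k (.reg x)
  | load a i, k => .seq (i.compile k) (.assign k (.load a (.reg k)))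
  | add e f, k => .seq (e.compile k) (.seq (f.compile (k + 1))
      (.assign k (.add (.reg k) (.reg (k + 1)))))
  | sub e f, k => .seq (e.compile k) (.seq (f.compile (k + 1))
      (.assign k (.sub (.reg k) (.reg (k + 1)))))
  | mul e f, k => .seq (e.compile k) (.seq (f.compile (k + 1))
      (.assign k (.mul (.reg k) (.reg (k + 1)))))
  | div e f, k => .seq (e.compile k) (.seq (f.compile (k + 1))
      (.assign k (.div (.reg k) (.reg (k + 1)))))
  | sum x y e, k =>
      .seq (.assign (k + 1) (.reg x)) <| .seq (.assign k (.lit 0)) <| .seq (.assign x (.lit 0)) <|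
      .seq (.loop (.sub (.reg y) (.reg x)) <| .seq (e.compile (k + 2)) <|
        .seq (.assign k (.add (.reg k) (.reg (k + 2)))) (.assign x (.add (.reg x) (.lit 1))))
      (.assign x (.reg (k + 1)))

/-- The running time of `compile`, as a polynomial in a bound for the lengths of the sums. -/
noncomputable def time : Tm → Polynomial ℕ
  | lit _ => 2
  | reg _ => 2
  | load _ i => i.time + 3
  | add e f => e.time + f.time + 4
  | sub e f => e.time + f.time + 4
  | mul e f => e.time + f.time + 4
  | div e f => e.time + f.time + 4
  | sum _ _ e => Polynomial.X * (e.time + 12) + 12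

theorem one_le_weight (e : Tm) : 1 ≤ e.weight := by
  induction e <;> simp only [weight] <;> omega

end Tm

/-! ### Agreement of states, size bounds, and correctness of compiled terms. -/

@[simp] theorem setReg_mem (s : State) (x v : ℕ) : (s.setReg x v).mem = s.mem := rfl

@[simp] theorem setReg_reg_self (s : State) (x v : ℕ) : (s.setReg x v).reg x = v := by
  simp [State.setReg]

theorem setReg_reg_of_ne (s : State) {x y : ℕ} (v : ℕ) (h : y ≠ x) :
    (s.setReg x v).reg y = s.reg y := by
  simp [State.setReg, h]

theorem setReg_reg (s : State) (x y v : ℕ) :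
    (s.setReg x v).reg y = if y = x then v else s.reg y := by
  simp [State.setReg, Function.update_apply]

@[simp] theorem setMem_mem_self (s : State) (a i v : ℕ) :
    (s.setMem a i v).mem a = Function.update (s.mem a) i v := by
  simp [State.setMem]

theorem setMem_mem_of_ne (s : State) {a b : ℕ} (i v : ℕ) (h : b ≠ a) :
    (s.setMem a i v).mem b = s.mem b := by
  simp [State.setMem, h]

/-- The states agree up to the contents of the registers from `K` on. -/
def Agree (K : ℕ) (s s' : State) : Prop :=
  s'.mem = s.mem ∧ ∀ x < K, s'.reg x = s.reg x

namespace Agree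

variable {K : ℕ} {s s' s'' : State}

theorem refl (K : ℕ) (s : State) : Agree K s s := ⟨rfl, fun _ _ => rfl⟩

theorem trans (h : Agree K s s') (h' : Agree K s' s'') : Agree K s s'' :=
  ⟨h'.1.trans h.1, fun x hx => (h'.2 x hx).trans (h.2 x hx)⟩

theorem mono {k : ℕ} (h : Agree k s s') (hk : K ≤ k) : Agree K s s' :=
  ⟨h.1, fun x hx => h.2 x (hx.trans_le hk)⟩

theorem setReg (h : Agree K s s') (x v : ℕ) : Agree K (s.setReg x v) (s'.setReg x v) := by
  refine ⟨h.1, fun y hy => ?_⟩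
  rw [setReg_reg, setReg_reg, h.2 y hy]

theorem setReg_of_ne {x : ℕ} (hm : s'.mem = s.mem) (hr : ∀ z < K, z ≠ x → s'.reg z = s.reg z)
    (v : ℕ) : Agree K (s.setReg x v) (s'.setReg x v) := by
  refine ⟨hm, fun z hz => ?_⟩
  by_cases h : z = x
  · rw [h, setReg_reg_self, setReg_reg_self]
  · rw [setReg_reg_of_ne _ _ h, setReg_reg_of_ne _ _ h, hr z hz h]

theorem setMem (h : Agree K s s') (a i v : ℕ) : Agree K (s.setMem a i v) (s'.setMem a i v) := by
  refine ⟨?_, fun y hy => h.2 y hy⟩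
  simp only [State.setMem, h.1]

theorem setReg_right (h : Agree K s s') {x : ℕ} (hx : K ≤ x) (v : ℕ) :
    Agree K s (s'.setReg x v) := by
  refine ⟨h.1, fun y hy => ?_⟩
  rw [setReg_reg_of_ne _ _ (by omega), h.2 y hy]

end Agree

theorem Tm.eval_congr {K : ℕ} (e : Tm) : e.Ok K → ∀ {s s' : State}, Agree K s s' →
    e.eval s' = e.eval s := by
  induction e with
  | lit c => intros; rfl
  | reg x => intro he s s' h; exact h.2 x he
  | load a i ih => intro he s s' h; simp only [eval, ih he h, h.1]
  | add e f ihe ihf => intro he s s' h; simp only [eval, ihe he.1 h, ihf he.2 h]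
  | sub e f ihe ihf => intro he s s' h; simp only [eval, ihe he.1 h, ihf he.2 h]
  | mul e f ihe ihf => intro he s s' h; simp only [eval, ihe he.1 h, ihf he.2 h]
  | div e f ihe ihf => intro he s s' h; simp only [eval, ihe he.1 h, ihf he.2 h]
  | sum x y e ih =>
    intro he s s' h
    simp only [eval, h.2 y he.1.2.2.2]
    exact Finset.sum_congr rfl fun i _ => ih he.2 (h.setReg x i)

/-- All relevant registers and all cells hold numbers below `M`, and the registers `0`, `1`, `2` hold
numbers of at most `N`. -/
structure Bdd (K M N : ℕ) (s : State) : Prop where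
  reg : ∀ x < K, s.reg x < M
  mem : ∀ a i, s.mem a i < M
  len : ∀ y < 3, s.reg y ≤ N

namespace Bdd

variable {K M N : ℕ} {s s' : State}

theorem congr (h : Bdd K M N s) (hK : 3 ≤ K) (hs : Agree K s s') : Bdd K M N s' :=
  ⟨fun x hx => (hs.2 x hx).trans_lt (h.reg x hx), fun a i => by rw [hs.1]; exact h.mem a i,
    fun y hy => (hs.2 y (hy.trans_le hK)).trans_le (h.len y hy)⟩

theorem setReg (h : Bdd K M N s) {x v : ℕ} (hx : 3 ≤ x) (hv : v < M) :
    Bdd K M N (s.setReg x v) := by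
  refine ⟨fun y hy => ?_, h.mem, fun y hy => ?_⟩
  · rw [setReg_reg]; split_ifs
    · exact hv
    · exact h.reg y hy
  · rw [setReg_reg_of_ne _ _ (by omega)]; exact h.len y hy

theorem setMem (h : Bdd K M N s) (a i : ℕ) {v : ℕ} (hv : v < M) :
    Bdd K M N (s.setMem a i v) := by
  refine ⟨h.reg, fun b j => ?_, h.len⟩
  simp only [State.setMem, Function.update_apply]
  split_ifs with h1
  · rw [Function.update_apply]; split_ifs
    · exact hv
    · exact h.mem _ _
  · exact h.mem _ _

end Bdd

/-- Weights add under binary operations because both powers of `M` are at least 64, so their product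
also dominates the sum; a bounded sum has fewer than `M` summands, which costs one more factor `M`.
-/
theorem Tm.eval_lt {K M N : ℕ} (hM : 64 ≤ M) (e : Tm) : e.Ok K → ∀ {s : State}, Bdd K M N s →
    e.eval s < M ^ e.weight := by
  have key : ∀ {a b : ℕ} (e f : Tm), a < M ^ e.weight → b < M ^ f.weight →
      a + b < M ^ (e.weight + f.weight) ∧ a * b < M ^ (e.weight + f.weight) ∧
      a < M ^ (e.weight + f.weight) := by
    intro a b e f ha hb
    have he : M ≤ M ^ e.weight := Nat.le_self_pow (by have := e.one_le_weight; omega) M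
    have hf : M ≤ M ^ f.weight := Nat.le_self_pow (by have := f.one_le_weight; omega) M
    rw [pow_add]
    refine ⟨?_, ?_, ?_⟩
    · nlinarith
    · exact Nat.mul_lt_mul_of_lt_of_le ha hb.le (by omega)
    · nlinarith
  induction e with
  | lit c => intro he s hs; exact (lt_of_lt_of_le he hM).trans_le (by simp [weight])
  | reg x => intro he s hs; simpa [weight, eval] using hs.reg x he
  | load a i ih =>
    intro he s hs
    exact (hs.mem a _).trans_le (Nat.le_self_pow (by have := i.one_le_weight; simp only [weight]; omega) M)
  | add e f ihe ihf => intro he s hs; exact (key e f (ihe he.1 hs) (ihf he.2 hs)).1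
  | sub e f ihe ihf =>
    intro he s hs
    exact (Nat.sub_le _ _).trans_lt (key e f (ihe he.1 hs) (ihf he.2 hs)).2.2
  | mul e f ihe ihf => intro he s hs; exact (key e f (ihe he.1 hs) (ihf he.2 hs)).2.1
  | div e f ihe ihf =>
    intro he s hs
    exact (Nat.div_le_self _ _).trans_lt (key e f (ihe he.1 hs) (ihf he.2 hs)).2.2
  | sum x y e ih =>
    intro he s hs
    have hy := hs.reg y he.1.2.2.2
    have h1 : ∑ i ∈ Finset.range (s.reg y), e.eval (s.setReg x i)
        ≤ s.reg y * M ^ e.weight := by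
      refine (Finset.sum_le_card_nsmul _ _ (M ^ e.weight) fun i hi => ?_).trans (by simp)
      exact (ih he.2 (hs.setReg he.1.1 ((Finset.mem_range.1 hi).trans hy))).le
    have h2 : 0 < M ^ e.weight := by positivity
    simp only [eval, weight, pow_succ]
    nlinarith

/-- The loop that adds up the values of `e`. -/
theorem exec_sum_loop {K M N ℓ k x y T : ℕ} {e : Tm} (hk : K ≤ k) (hK : 3 ≤ K)
    (hx : 3 ≤ x) (hxK : x < K) (hy : y < 3) (hM : 64 ≤ M) (he : e.Ok K)
    (hfit : M ^ (e.weight + 1) ≤ 2 ^ ℓ)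
    (ih : ∀ {s : State}, Bdd K M N s → ∃ t s', Exec ℓ (e.compile (k + 2)) s t s' ∧ t ≤ T ∧
      s'.reg (k + 2) = e.eval s ∧ Agree (k + 2) s s') (d : ℕ) :
    ∀ {s : State}, Bdd K M N s → s.reg x + d = s.reg y →
      s.reg k ≤ s.reg x * M ^ e.weight →
      ∃ t s', Exec ℓ (.loop (.sub (.reg y) (.reg x)) <| .seq (e.compile (k + 2)) <|
        .seq (.assign k (.add (.reg k) (.reg (k + 2)))) (.assign x (.add (.reg x) (.lit 1)))) s t s' ∧
        t ≤ d * (T + 12) + 4 ∧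
        s'.reg k = s.reg k + ∑ i ∈ Finset.Ico (s.reg x) (s.reg y), e.eval (s.setReg x i) ∧
        s'.reg (k + 1) = s.reg (k + 1) ∧ s'.mem = s.mem ∧
        ∀ z < k, z ≠ x → s'.reg z = s.reg z := by
  have hpow : 0 < M ^ e.weight := by positivity
  have hMl : M ≤ 2 ^ ℓ := (Nat.le_self_pow (by omega) M).trans hfit
  induction d with
  | zero =>
    intro s hs hd hacc
    refine ⟨_, s, .loop_false ⟨(hs.reg y (by omega)).trans_le hMl, (hs.reg x hxK).trans_le hMl⟩ ?_,
      ?_, ?_, rfl, rfl, fun _ _ _ => rfl⟩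
    · simp only [Expr.eval]; omega
    · simp [Expr.cost]
    · rw [show s.reg x = s.reg y by omega]; simp
  | succ d ihd =>
    intro s hs hd hacc
    obtain ⟨t, s₁, h₁, ht, hv, ha⟩ := ih hs
    have hyM := hs.reg y (by omega)
    have hev := Tm.eval_lt hM e he hs
    -- The accumulator stays below (number of finished rounds) times `M ^ e.weight`, and there are
    -- fewer than `M` rounds, so every partial sum is a word.
    have hxy : (s.reg x + 1) * M ^ e.weight ≤ 2 ^ ℓ := by
      refine le_trans ?_ hfit
      rw [pow_succ, mul_comm]
      exact Nat.mul_le_mul_left _ (by omega)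
    have h1k : s₁.reg k = s.reg k := ha.2 k (by omega)
    have h1x : s₁.reg x = s.reg x := ha.2 x (by omega)
    have hsum : s.reg k + e.eval s < (s.reg x + 1) * M ^ e.weight := by
      rw [add_mul]; omega
    set s₂ := s₁.setReg k (s₁.reg k + s₁.reg (k + 2)) with hs₂
    set s₃ := s₂.setReg x (s₂.reg x + 1) with hs₃
    have h2x : s₂.reg x = s.reg x := by rw [hs₂, setReg_reg_of_ne _ _ (by omega), h1x]
    have h3x : s₃.reg x = s.reg x + 1 := by simp [hs₃, h2x]
    have h3k : s₃.reg k = s.reg k + e.eval s := by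
      rw [hs₃, setReg_reg_of_ne _ _ (by omega), hs₂, setReg_reg_self, h1k, hv]
    have h3 : ∀ z < k + 2, z ≠ x → z ≠ k → s₃.reg z = s.reg z := by
      intro z hz hzx hzk
      rw [hs₃, setReg_reg_of_ne _ _ hzx, hs₂, setReg_reg_of_ne _ _ hzk, ha.2 z hz]
    have h3y : s₃.reg y = s.reg y := h3 y (by omega) (by omega) (by omega)
    have hmem : s₃.mem = s.mem := by simp [hs₃, hs₂, ha.1]
    have hag : Agree K (s.setReg x (s.reg x + 1)) s₃ := by
      refine ⟨hmem, fun z hz => ?_⟩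
      by_cases hzx : z = x
      · rw [hzx, h3x, setReg_reg_self]
      · rw [h3 z (by omega) hzx (by omega), setReg_reg_of_ne _ _ hzx]
    have hb₃ : Bdd K M N s₃ := (hs.setReg hx (by omega)).congr hK hag
    obtain ⟨t', s', h', ht', hk', hk1', hm', hr'⟩ := ihd hb₃ (by omega) (by
      rw [h3k, h3x]; exact hsum.le)
    refine ⟨_, s', .loop_true ⟨hyM.trans_le hMl, (hs.reg x hxK).trans_le hMl⟩ ?_
      (.seq h₁ (.seq (.assign _ _ _ ⟨?_, ?_, ?_⟩) (.assign _ _ _ ⟨?_, ?_, ?_⟩))) h', ?_, ?_, ?_, ?_, ?_⟩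
    · simp only [Expr.eval]; omega
    · simp only [Expr.Fits, h1k]; omega
    · simp only [Expr.Fits, hv]; omega
    · simp only [Expr.eval, h1k, hv]; omega
    · change s₂.reg x < _; omega
    · simp only [Expr.Fits]; omega
    · change s₂.reg x + 1 < _; omega
    -- The 12 steps per round are the test, the accumulation and the increment, 4 each; the
    -- remaining 4 are the final test.
    · simp only [Expr.cost]; rw [add_mul]; omega
    · rw [hk', h3k, h3x, h3y, Finset.sum_eq_sum_Ico_succ_bot (show s.reg x < s.reg y by omega),
        add_assoc]
      congr 2
      · refine (e.eval_congr he ?_)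
        refine ⟨rfl, fun z hz => ?_⟩
        rw [setReg_reg]; split_ifs with h
        · rw [h]
        · rfl
      · refine Finset.sum_congr rfl fun i _ => e.eval_congr he ?_
        exact .setReg_of_ne hmem (fun z hz h => h3 z (by omega) h (by omega)) i
    · rw [hk1']; exact h3 _ (by omega) (by omega) (by omega)
    · rw [hm', hmem]
    · intro z hz hzx; rw [hr' z hz hzx]; exact h3 z (by omega) hzx (by omega)

/-- Executing two compiled terms and combining the results by a binary operation. -/
theorem exec_binary {ℓ k T T' : ℕ} {e f : Tm} {op : Expr → Expr → Expr} {g : ℕ → ℕ → ℕ} {s : State}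
    (heval : ∀ (s : State) a b, (op (.reg a) (.reg b)).eval s = g (s.reg a) (s.reg b))
    (hcost : ∀ a b, (op (.reg a) (.reg b)).cost = 3)
    (he : ∃ t s', Exec ℓ (e.compile k) s t s' ∧ t ≤ T ∧ s'.reg k = e.eval s ∧ Agree k s s')
    (hf : ∀ s₁, Agree k s s₁ → ∃ t s', Exec ℓ (f.compile (k + 1)) s₁ t s' ∧ t ≤ T' ∧
      s'.reg (k + 1) = f.eval s ∧ Agree (k + 1) s₁ s')
    (hop : ∀ s' : State, s'.reg k = e.eval s → s'.reg (k + 1) = f.eval s →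
      (op (.reg k) (.reg (k + 1))).Fits ℓ s') :
    ∃ t s', Exec ℓ (.seq (e.compile k) (.seq (f.compile (k + 1))
      (.assign k (op (.reg k) (.reg (k + 1)))))) s t s' ∧ t ≤ T + T' + 4 ∧
      s'.reg k = g (e.eval s) (f.eval s) ∧ Agree k s s' := by
  obtain ⟨t, s₁, h₁, ht, hv, ha⟩ := he
  obtain ⟨t', s₂, h₂, ht', hv', ha'⟩ := hf s₁ ha
  have hk : s₂.reg k = e.eval s := (ha'.2 k (by omega)).trans hv
  refine ⟨_, _, .seq h₁ (.seq h₂ (.assign _ _ _ (hop s₂ hk hv'))), ?_, ?_, ?_⟩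
  · rw [hcost]; omega
  · rw [setReg_reg_self, heval, hk, hv']
  · exact (ha.trans (ha'.mono (by omega))).setReg_right le_rfl _

/-- The result goes to `k` and scratch work stays above it, so everything below `k` survives while a
second operand is evaluated. This includes the summation variables, which are saved and restored. -/
theorem Tm.exec_compile {K M N ℓ : ℕ} (hK : 3 ≤ K) (hM : 64 ≤ M) (e : Tm) : e.Ok K →
    M ^ e.weight ≤ 2 ^ ℓ → ∀ {k : ℕ}, K ≤ k → ∀ {s : State}, Bdd K M N s →
    ∃ t s', Exec ℓ (e.compile k) s t s' ∧ t ≤ e.time.eval N ∧ s'.reg k = e.eval s ∧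
      Agree k s s' := by
  have hle : ∀ {w w' : ℕ}, w ≤ w' → M ^ w' ≤ 2 ^ ℓ → M ^ w ≤ 2 ^ ℓ := fun h h' =>
    (Nat.pow_le_pow_right (by omega) h).trans h'
  induction e with
  | lit c =>
    intro he hw k hk s hs
    refine ⟨_, _, .assign _ _ _ ?_, ?_, setReg_reg_self _ _ _, (Agree.refl k s).setReg_right le_rfl _⟩
    · exact (lt_of_lt_of_le he hM).trans_le (by simpa [weight] using hw)
    · simp [Expr.cost, time]
  | reg x =>
    intro he hw k hk s hs
    refine ⟨_, _, .assign _ _ _ ?_, ?_, setReg_reg_self _ _ _, (Agree.refl k s).setReg_right le_rfl _⟩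
    · exact (hs.reg x he).trans_le (by simpa [weight] using hw)
    · simp [Expr.cost, time]
  | load a i ih =>
    intro he hw k hk s hs
    obtain ⟨t, s₁, h₁, ht, hv, ha⟩ := ih he hw hk hs
    have hlt := i.eval_lt hM he hs
    refine ⟨_, _, .seq h₁ (.assign _ _ _ ⟨?_, ?_⟩), ?_, ?_, ha.setReg_right le_rfl _⟩
    · simp only [Expr.Fits, hv]; exact hlt.trans_le hw
    · simp only [ha.1]
      exact (hs.mem _ _).trans_le (hle (w := 1) i.one_le_weight hw |>.trans' (by simp))
    · simp [Expr.cost, time]; omega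
    · simp [Expr.eval, hv, ha.1, eval]
  | add e f ihe ihf =>
    intro he hw k hk s hs
    have hlt := Tm.eval_lt hM (add e f) he hs
    have he' := (e.eval_lt hM he.1 hs).trans_le (hle (Nat.le_add_right _ f.weight) hw)
    have hf' := (f.eval_lt hM he.2 hs).trans_le (hle (Nat.le_add_left _ e.weight) hw)
    have := exec_binary (op := .add) (g := (· + ·)) (fun _ _ _ => rfl) (fun _ _ => rfl)
      (ihe he.1 (hle (Nat.le_add_right _ _) hw) hk hs)
      (fun s₁ h₁ => by
        have := ihf he.2 (hle (Nat.le_add_left _ _) hw) (show K ≤ k + 1 by omega)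
          (hs.congr hK (h₁.mono hk))
        rwa [f.eval_congr he.2 (h₁.mono hk)] at this)
      (fun s' h h' => ⟨by simpa only [Expr.Fits, h], by simpa only [Expr.Fits, h'], by
        simp only [Expr.eval, h, h']; exact hlt.trans_le hw⟩)
    simpa [time, eval, compile] using this
  | sub e f ihe ihf =>
    intro he hw k hk s hs
    have he' := (e.eval_lt hM he.1 hs).trans_le (hle (Nat.le_add_right _ f.weight) hw)
    have hf' := (f.eval_lt hM he.2 hs).trans_le (hle (Nat.le_add_left _ e.weight) hw)
    have := exec_binary (op := .sub) (g := (· - ·)) (fun _ _ _ => rfl) (fun _ _ => rfl)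
      (ihe he.1 (hle (Nat.le_add_right _ _) hw) hk hs)
      (fun s₁ h₁ => by
        have := ihf he.2 (hle (Nat.le_add_left _ _) hw) (show K ≤ k + 1 by omega)
          (hs.congr hK (h₁.mono hk))
        rwa [f.eval_congr he.2 (h₁.mono hk)] at this)
      (fun s' h h' => ⟨by simpa only [Expr.Fits, h], by simpa only [Expr.Fits, h']⟩)
    simpa [time, eval, compile] using this
  | mul e f ihe ihf =>
    intro he hw k hk s hs
    have hlt := Tm.eval_lt hM (mul e f) he hs
    have he' := (e.eval_lt hM he.1 hs).trans_le (hle (Nat.le_add_right _ f.weight) hw)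
    have hf' := (f.eval_lt hM he.2 hs).trans_le (hle (Nat.le_add_left _ e.weight) hw)
    have := exec_binary (op := .mul) (g := (· * ·)) (fun _ _ _ => rfl) (fun _ _ => rfl)
      (ihe he.1 (hle (Nat.le_add_right _ _) hw) hk hs)
      (fun s₁ h₁ => by
        have := ihf he.2 (hle (Nat.le_add_left _ _) hw) (show K ≤ k + 1 by omega)
          (hs.congr hK (h₁.mono hk))
        rwa [f.eval_congr he.2 (h₁.mono hk)] at this)
      (fun s' h h' => ⟨by simpa only [Expr.Fits, h], by simpa only [Expr.Fits, h'], by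
        simp only [Expr.eval, h, h']; exact hlt.trans_le hw⟩)
    simpa [time, eval, compile] using this
  | div e f ihe ihf =>
    intro he hw k hk s hs
    have he' := (e.eval_lt hM he.1 hs).trans_le (hle (Nat.le_add_right _ f.weight) hw)
    have hf' := (f.eval_lt hM he.2 hs).trans_le (hle (Nat.le_add_left _ e.weight) hw)
    have := exec_binary (op := .div) (g := (· / ·)) (fun _ _ _ => rfl) (fun _ _ => rfl)
      (ihe he.1 (hle (Nat.le_add_right _ _) hw) hk hs)
      (fun s₁ h₁ => by
        have := ihf he.2 (hle (Nat.le_add_left _ _) hw) (show K ≤ k + 1 by omega)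
          (hs.congr hK (h₁.mono hk))
        rwa [f.eval_congr he.2 (h₁.mono hk)] at this)
      (fun s' h h' => ⟨by simpa only [Expr.Fits, h], by simpa only [Expr.Fits, h']⟩)
    simpa [time, eval, compile] using this
  | sum x y e ih =>
    intro he hw k hk s hs
    obtain ⟨⟨hx, hxK, hy, -⟩, heo⟩ := he
    have hMl : M ≤ 2 ^ ℓ := (Nat.le_self_pow (by simp [weight]) M).trans hw
    -- For a sum, `k + 1` saves the old content of `x`, `k` is the accumulator, and the summand is
    -- evaluated into `k + 2`.
    set s₁ := ((s.setReg (k + 1) (s.reg x)).setReg k 0).setReg x 0 with hs₁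
    have hag : Agree K (s.setReg x 0) s₁ :=
      (((Agree.refl K s).setReg_right (by omega) _).setReg_right hk _).setReg x 0
    have hb : Bdd K M N s₁ := (hs.setReg hx (by omega)).congr hK hag
    have h1x : s₁.reg x = 0 := by simp [hs₁]
    have h1k : s₁.reg k = 0 := by
      rw [hs₁, setReg_reg_of_ne _ _ (by omega), setReg_reg_self]
    have h1k1 : s₁.reg (k + 1) = s.reg x := by
      rw [hs₁, setReg_reg_of_ne _ _ (by omega), setReg_reg_of_ne _ _ (by omega), setReg_reg_self]
    have h1 : ∀ z < k, z ≠ x → s₁.reg z = s.reg z := by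
      intro z hz hzx
      rw [hs₁, setReg_reg_of_ne _ _ hzx, setReg_reg_of_ne _ _ (by omega),
        setReg_reg_of_ne _ _ (by omega)]
    obtain ⟨t, s₂, h₂, ht, hv, hk1, hm, hr⟩ := exec_sum_loop (ℓ := ℓ) hk hK hx hxK hy hM heo hw
      (fun {s} hs => ih heo (hle (Nat.le_succ _) hw) (show K ≤ k + 2 by omega) hs) (s₁.reg y) hb
      (by omega) (by omega)
    have hsx := hs.reg x hxK
    refine ⟨_, _, .seq (.assign _ _ _ ?_) (.seq (.assign _ _ _ ?_) (.seq (.assign _ _ _ ?_)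
      (.seq h₂ (.assign _ _ _ ?_)))), ?_, ?_, ?_, ?_⟩
    · exact hsx.trans_le hMl
    · simp only [Expr.Fits]; omega
    · simp only [Expr.Fits]; omega
    · simp only [Expr.Fits, hk1, h1k1]; omega
    · have hyN : s₁.reg y ≤ N := hb.len y hy
      have := Nat.mul_le_mul_right (e.time.eval N + 12) hyN
      simp only [Expr.cost, time, Polynomial.eval_add, Polynomial.eval_mul, Polynomial.eval_X,
        Polynomial.eval_ofNat]
      omega
    · rw [setReg_reg_of_ne _ _ (by omega), hv, h1k, h1x, h1 y (by omega) (by omega)]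
      simp only [eval, zero_add, Nat.Ico_zero_eq_range]
      refine Finset.sum_congr rfl fun i _ => e.eval_congr heo ?_
      exact .setReg_of_ne (by simp [hs₁]) (fun z hz h => h1 z (by omega) h) i
    · rw [setReg_mem, hm]; simp [hs₁]
    · intro z hz
      rw [setReg_reg]; split_ifs with h
      · simp only [Expr.eval, hk1, h1k1, h]
      · rw [hr z hz h, h1 z hz h]

end WordRAM

namespace WordRAM

/-! ### A calculus of preconditions -/

/-- The number of registers that are not scratch registers. -/
abbrev numReg : ℕ := 40

/-- An upper bound for the weights of the terms in programs. -/
def maxWeight : ℕ := 3000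

/-- A term that is admissible in programs. -/
def Tm.Adm (e : Tm) : Prop := e.Ok numReg ∧ e.weight ≤ maxWeight

instance (e : Tm) : Decidable e.Adm := inferInstanceAs (Decidable (_ ∧ _))

/-- Assign the value of a term to a register. -/
def set (x : ℕ) (e : Tm) : Prog := .seq (e.compile numReg) (.assign x (.reg numReg))

/-- Store the value of a term in an array. -/
def put (a : ℕ) (i e : Tm) : Prog :=
  .seq (i.compile numReg) (.seq (e.compile (numReg + 1)) (.store a (.reg numReg) (.reg (numReg + 1))))

/-- Branch according to whether the value of a term is not `0`. -/
def cond (c : Tm) (p q : Prog) : Prog := .seq (c.compile numReg) (.ite (.reg numReg) p q)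

/-- Execute `p` for all values of the register `x` below the content of the register `y`. -/
def forLoop (x y : ℕ) (p : Prog) : Prog :=
  .seq (.assign x (.lit 0)) (.loop (.sub (.reg y) (.reg x)) (.seq p
    (.assign x (.add (.reg x) (.lit 1)))))

/-- Parameters of an execution: the word length, a bound for the contents of registers and cells,
and a bound for the lengths of sums. -/
structure Params where
  ℓ : ℕ
  M : ℕ
  N : ℕ
  le_M : 64 ≤ M
  fits : M ^ maxWeight ≤ 2 ^ ℓ

/-- Started in a state that agrees with `a`, the program `p` halts after at most `T` steps in a state
that agrees with some state that satisfies `Q`. -/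
def Runs (π : Params) (p : Prog) (a : State) (T : ℕ) (Q : State → Prop) : Prop :=
  Bdd numReg π.M π.N a → ∀ s, Agree numReg a s → ∃ t s' a', Exec π.ℓ p s t s' ∧ t ≤ T ∧
    Agree numReg a' s' ∧ Bdd numReg π.M π.N a' ∧ Q a'

namespace Runs

variable {π : Params} {p q : Prog} {a : State} {T T' : ℕ} {Q Q' : State → Prop}

theorem mono (h : Runs π p a T Q) (hT : T ≤ T') (hQ : ∀ a', Bdd numReg π.M π.N a' → Q a' → Q' a') :
    Runs π p a T' Q' := by
  intro hb s hs
  obtain ⟨t, s', a', h1, h2, h3, h4, h5⟩ := h hb s hs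
  exact ⟨t, s', a', h1, h2.trans hT, h3, h4, hQ a' h4 h5⟩

/-- The size bounds are an assumption inside `Runs`, so they may be used to establish it. -/
theorem of_bdd (h : Bdd numReg π.M π.N a → Runs π p a T Q) : Runs π p a T Q :=
  fun hb => h hb hb

theorem skip (h : Q a) : Runs π .skip a 1 Q := fun hb s hs =>
  ⟨1, s, a, .skip s, le_rfl, hs, hb, h⟩

/-- The postcondition of `p` is itself a `Runs` statement for `q`, so long programs are verified by
stepping through them with the current state in the goal. -/
theorem seq (h : Runs π p a T fun a' => Runs π q a' T' Q) : Runs π (.seq p q) a (T + T') Q := by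
  intro hb s hs
  obtain ⟨t, s', a', h1, h2, h3, h4, h5⟩ := h hb s hs
  obtain ⟨t', s'', a'', h1', h2', h3', h4', h5'⟩ := h5 h4 s' h3
  exact ⟨_, s'', a'', .seq h1 h1', Nat.add_le_add h2 h2', h3', h4', h5'⟩

theorem exec_term {e : Tm} (he : e.Adm) {k : ℕ} (hk : numReg ≤ k) (hb : Bdd numReg π.M π.N a)
    {s : State} (hs : Agree numReg a s) :
    ∃ t s', Exec π.ℓ (e.compile k) s t s' ∧ t ≤ e.time.eval π.N ∧ s'.reg k = e.eval a ∧
      Agree k s s' ∧ e.eval a < 2 ^ π.ℓ := by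
  have hM := π.le_M
  have hw : π.M ^ e.weight ≤ 2 ^ π.ℓ :=
    (Nat.pow_le_pow_right (by omega) he.2).trans π.fits
  obtain ⟨t, s', h1, h2, h3, h4⟩ := e.exec_compile (by decide) hM he.1 hw hk (hb.congr (by decide) hs)
  rw [e.eval_congr he.1 hs] at h3
  exact ⟨t, s', h1, h2, h3, h4, (e.eval_lt hM he.1 hb).trans_le hw⟩

theorem set {x : ℕ} {e : Tm} (he : e.Adm) (hx : 3 ≤ x) (hv : e.eval a < π.M)
    (h : Q (a.setReg x (e.eval a))) : Runs π (set x e) a (e.time.eval π.N + 2) Q := by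
  intro hb s hs
  obtain ⟨t, s', h1, h2, h3, h4, h5⟩ := exec_term he le_rfl hb hs
  refine ⟨_, _, _, .seq h1 (.assign _ _ _ ?_), ?_, ?_, hb.setReg hx hv, h⟩
  · simpa only [Expr.Fits, h3]
  · simp only [Expr.cost]; omega
  · simp only [Expr.eval, h3]; exact (hs.trans h4).setReg _ _

theorem put {b : ℕ} {i e : Tm} (hi : i.Adm) (he : e.Adm) (hv : e.eval a < π.M)
    (h : Q (a.setMem b (i.eval a) (e.eval a))) :
    Runs π (put b i e) a (i.time.eval π.N + e.time.eval π.N + 3) Q := by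
  intro hb s hs
  obtain ⟨t, s', h1, h2, h3, h4, h5⟩ := exec_term hi le_rfl hb hs
  obtain ⟨t', s'', h1', h2', h3', h4', h5'⟩ :=
    exec_term he (Nat.le_succ numReg) hb (hs.trans h4)
  have h3'' : s''.reg numReg = i.eval a := (h4'.2 _ (Nat.lt_succ_self _)).trans h3
  refine ⟨_, _, _, .seq h1 (.seq h1' (.store _ _ _ _ ?_ ?_)), ?_, ?_, hb.setMem _ _ hv, h⟩
  · simpa only [Expr.Fits, h3'']
  · simpa only [Expr.Fits, h3']
  · simp only [Expr.cost]; omega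
  · simp only [Expr.eval, h3', h3'']
    exact (hs.trans (h4.trans (h4'.mono (Nat.le_succ _)))).setMem _ _ _

theorem cond {c : Tm} (hc : c.Adm) (h1 : c.eval a ≠ 0 → Runs π p a T Q)
    (h2 : c.eval a = 0 → Runs π q a T Q) : Runs π (cond c p q) a (c.time.eval π.N + 2 + T) Q := by
  intro hb s hs
  obtain ⟨t, s', e1, e2, e3, e4, e5⟩ := exec_term hc le_rfl hb hs
  have hfit : (Expr.reg numReg).Fits π.ℓ s' := by simpa only [Expr.Fits, e3]
  by_cases h : c.eval a = 0
  · obtain ⟨t', s'', a'', f1, f2, f3, f4, f5⟩ := h2 h hb s' (hs.trans e4)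
    refine ⟨_, s'', a'', .seq e1 (.ite_false hfit ?_ f1), ?_, f3, f4, f5⟩
    · simpa only [Expr.eval, e3]
    · simp only [Expr.cost]; omega
  · obtain ⟨t', s'', a'', f1, f2, f3, f4, f5⟩ := h1 h hb s' (hs.trans e4)
    refine ⟨_, s'', a'', .seq e1 (.ite_true hfit ?_ f1), ?_, f3, f4, f5⟩
    · simpa only [Expr.eval, e3]
    · simp only [Expr.cost]; omega

/-- A for-loop with the invariant `I`. -/
theorem forLoop {x y b : ℕ} (hx : 3 ≤ x) (hxK : x < numReg) (hy : y < numReg)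
    (hb : a.reg y = b) (hxy : y ≠ x) (I : ℕ → State → Prop) (h0 : I 0 (a.setReg x 0))
    (hstep : ∀ i < b, ∀ a', Bdd numReg π.M π.N a' → a'.reg x = i → a'.reg y = b → I i a' →
      Runs π p a' T fun a'' => a''.reg x = i ∧ a''.reg y = b ∧ I (i + 1) (a''.setReg x (i + 1)))
    (hQ : ∀ a', a'.reg x = b → I b a' → Q a') :
    Runs π (forLoop x y p) a (b * (T + 8) + 6) Q := by
  have hM := π.le_M
  have hMl : π.M ≤ 2 ^ π.ℓ := (Nat.le_self_pow (by decide) _).trans π.fits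
  -- Induction on the number `d` of rounds still to be executed.
  have key : ∀ d i, i + d = b → ∀ a', Bdd numReg π.M π.N a' → a'.reg x = i → a'.reg y = b →
      I i a' → ∀ s, Agree numReg a' s → ∃ t s' a'', Exec π.ℓ (.loop (.sub (.reg y) (.reg x))
        (.seq p (.assign x (.add (.reg x) (.lit 1))))) s t s' ∧ t ≤ d * (T + 8) + 4 ∧
        Agree numReg a'' s' ∧ Bdd numReg π.M π.N a'' ∧ Q a'' := by
    intro d
    induction d with
    | zero =>
      intro i hi a' hba hax hay hI s hs
      have hsx := hs.2 x hxK
      have hsy := hs.2 y hy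
      have h1 := hba.reg x hxK
      have h2 := hba.reg y hy
      obtain rfl : i = b := by omega
      refine ⟨_, s, a', .loop_false ⟨?_, ?_⟩ ?_, ?_, hs, hba, hQ a' hax hI⟩
      · simp only [Expr.Fits]; omega
      · simp only [Expr.Fits]; omega
      · simp only [Expr.eval]; omega
      · simp [Expr.cost]
    | succ d ih =>
      intro i hi a' hba hax hay hI s hs
      have hsx := hs.2 x hxK
      have hsy := hs.2 y hy
      have h1 := hba.reg x hxK
      have h2 := hba.reg y hy
      obtain ⟨t, s', a'', e1, e2, e3, e4, e5x, e5y, e5⟩ := hstep i (by omega) a' hba hax hay hI hba s hs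
      have e3x := e3.2 x hxK
      have e4y := e4.reg y hy
      obtain ⟨t', s'', a₃, f1, f2, f3, f4, f5⟩ := ih (i + 1) (by omega) (a''.setReg x (i + 1))
        (e4.setReg hx (by omega)) (setReg_reg_self _ _ _)
        (by rw [setReg_reg_of_ne _ _ hxy, e5y]) e5 _ (e3.setReg x (i + 1))
      have hev : i + 1 = Expr.eval s' (.add (.reg x) (.lit 1)) := by
        simp only [Expr.eval, e3x, e5x]
      rw [hev] at f1
      refine ⟨_, s'', a₃, .loop_true ⟨?_, ?_⟩ ?_ (.seq e1 (.assign _ _ _ ⟨?_, ?_, ?_⟩)) f1, ?_,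
        f3, f4, f5⟩
      · simp only [Expr.Fits]; omega
      · simp only [Expr.Fits]; omega
      · simp only [Expr.eval]; omega
      · simp only [Expr.Fits]; omega
      · simp only [Expr.Fits]; omega
      · simp only [Expr.eval]; omega
      -- Each round costs 8 extra steps: 4 for the test and 4 for the increment. The final 6 are the
      -- initialization (2) and the failing test (4).
      · simp only [Expr.cost]; rw [add_mul]; omega
  intro hba s hs
  obtain ⟨t, s', a'', e1, e2, e3, e4, e5⟩ := key b 0 (by omega) (a.setReg x 0)
    (hba.setReg hx (by omega)) (setReg_reg_self _ _ _) (by rw [setReg_reg_of_ne _ _ hxy, hb]) h0 _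
    (hs.setReg x 0)
  refine ⟨_, s', a'', .seq (.assign _ _ _ ?_) e1, ?_, e3, e4, e5⟩
  · simp only [Expr.Fits]; omega
  · simp only [Expr.cost]; omega

end Runs

end WordRAM

namespace NonMonotone

/-! ### A characterization of target sets

The vertices are natural numbers. The number `2 * u + j` with `j < 2` stands for the vertex `u` at the
points of time that are congruent to `j` modulo `2`. -/

section Defs

variable (Adj : ℕ → ℕ → Prop) (τ : ℕ → ℕ)

/-- An edge of the bipartite double cover of the graph induced by the vertices of threshold `1`. -/
def CoverAdj (a b : ℕ) : Prop :=
  Adj (a / 2) (b / 2) ∧ τ (a / 2) = 1 ∧ τ (b / 2) = 1 ∧ a % 2 ≠ b % 2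

/-- Being in the same component of the double cover. -/
def Linked : ℕ → ℕ → Prop := Relation.ReflTransGen (CoverAdj Adj τ)

/-- The component of `a` contains no vertex with a neighbor of threshold `0`. -/
def Required (a : ℕ) : Prop :=
  τ (a / 2) = 1 ∧ ∀ b, Linked Adj τ a b → ∀ w, Adj (b / 2) w → τ w ≠ 0

/-- The neighbor `w` of `b / 2` causes the activity of `b`, where `x` is the initial set, and `g` are
the vertices all of whose neighbors are in `x`. -/
def Witness (x g : ℕ → Prop) (b w : ℕ) : Prop :=
  Adj (b / 2) w ∧ if b % 2 = 1 then x w else τ w ≠ 1 ∧ g w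

/-- The activation rule for a vertex `u` with set `x` of active vertices if the thresholds are `0`,
`1`, or the degree. -/
def Rule (x : ℕ → Prop) (u : ℕ) : Prop :=
  τ u = 0 ∨ (τ u = 1 ∧ ∃ w, Adj u w ∧ x w) ∨ (2 ≤ τ u ∧ ∀ w, Adj u w → x w)

end Defs

variable {Adj : ℕ → ℕ → Prop} {τ : ℕ → ℕ}

theorem CoverAdj.symm (hs : ∀ u v, Adj u v → Adj v u) {a b : ℕ} (h : CoverAdj Adj τ a b) :
    CoverAdj Adj τ b a :=
  ⟨hs _ _ h.1, h.2.2.1, h.2.1, h.2.2.2.symm⟩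

theorem Linked.symm (hs : ∀ u v, Adj u v → Adj v u) {a b : ℕ} (h : Linked Adj τ a b) :
    Linked Adj τ b a := by
  induction h with
  | refl => exact .refl
  | tail _ h ih => exact .head (h.symm hs) ih

theorem Linked.trans {a b c : ℕ} (h : Linked Adj τ a b) (h' : Linked Adj τ b c) :
    Linked Adj τ a c := Relation.ReflTransGen.trans h h'

theorem Linked.tau {a b : ℕ} (h : Linked Adj τ a b) (ha : τ (a / 2) = 1) : τ (b / 2) = 1 := by
  induction h with
  | refl => exact ha
  | tail _ h _ => exact h.2.2.1

theorem Required.linked {a b : ℕ} (h : Required Adj τ a)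
    (hab : Linked Adj τ a b) : Required Adj τ b :=
  ⟨hab.tau h.1, fun c hc => h.2 c (hab.trans hc)⟩

/-! ### Necessity and sufficiency of the two conditions for the activation process. -/

section Activation

variable {n : ℕ} {act : ℕ → ℕ → Prop}

/-- Without a witness the component is never active at the times of matching parity: an activating
neighbor of threshold 1 would be a linked element one step earlier, threshold 0 is excluded by
`Required`, and a full activating neighbor needs the vertex itself two steps earlier, or at the
start provides a witness. -/
theorem exists_witness_of_target (hs : ∀ u v, Adj u v → Adj v u)
    (hact : ∀ t, ∀ u < n, act (t + 1) u ↔ Rule Adj τ (act t) u) (hτ : ∀ u, τ u ≠ 0 → u < n)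
    {a : ℕ} (ha : Required Adj τ a)
    (ht : ∃ t₀, ∀ t ≥ t₀, ∀ u < n, act t u) :
    ∃ b, Linked Adj τ a b ∧ ∃ w, Witness Adj τ (act 0) (fun w => ∀ v, Adj w v → act 0 v) b w := by
  by_contra hno
  push Not at hno
  have key : ∀ t, (∀ b, Linked Adj τ a b → b % 2 = (t + 1) % 2 → ¬ act (t + 1) (b / 2)) ∧
      (∀ b, Linked Adj τ a b → b % 2 = (t + 2) % 2 → ¬ act (t + 2) (b / 2)) := by
    -- Inactivity passes to time `t + 2` as soon as no full neighbor can interfere at time `t + 1`;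
    -- that second premise is shown differently for `t = 0` and later.
    have step : ∀ t, (∀ b, Linked Adj τ a b → b % 2 = (t + 1) % 2 → ¬ act (t + 1) (b / 2)) →
        (∀ b, Linked Adj τ a b → b % 2 = t % 2 → ∀ w, Adj (b / 2) w → 2 ≤ τ w →
          ¬ act (t + 1) w) →
        (∀ b, Linked Adj τ a b → b % 2 = (t + 2) % 2 → ¬ act (t + 2) (b / 2)) := by
      intro t h1 h2 b hb hpar hab
      have hb1 := hb.tau ha.1
      rcases (hact (t + 1) _ (hτ _ (by omega))).1 hab with h | ⟨-, w, hw, haw⟩ | h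
      · omega
      · have hw0 := ha.2 b hb w hw
        rcases Nat.lt_or_ge (τ w) 2 with hw2 | hw2
        · have hw1 : τ w = 1 := by omega
          have hc : CoverAdj Adj τ b (2 * w + (t + 1) % 2) := by
            have e1 : (2 * w + (t + 1) % 2) / 2 = w := by omega
            refine ⟨by rwa [e1], hb1, by rwa [e1], by omega⟩
          refine h1 _ (.tail hb hc) (by omega) ?_
          rwa [show (2 * w + (t + 1) % 2) / 2 = w by omega]
        · exact h2 b hb (by omega) w hw hw2 haw
      · omega
    intro t
    induction t with
    | zero =>
      -- An activity at time 1 would give an odd witness; in the case of time 2 a full neighbor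
      -- active at time 1 would give an even witness.
      have h1 : ∀ b, Linked Adj τ a b → b % 2 = (0 + 1) % 2 → ¬ act (0 + 1) (b / 2) := by
        intro b hb hpar hab
        have hb1 := hb.tau ha.1
        rcases (hact 0 _ (hτ _ (by omega))).1 hab with h | ⟨-, w, hw, haw⟩ | h
        · omega
        · exact hno b hb w ⟨hw, by rw [if_pos (by omega)]; exact haw⟩
        · omega
      refine ⟨h1, step 0 h1 fun b hb hpar w hw hw2 haw => ?_⟩
      rcases (hact 0 _ (hτ _ (by omega))).1 haw with h | ⟨h, -⟩ | h
      · omega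
      · omega
      · exact hno b hb w ⟨hw, by rw [if_neg (by omega)]; exact ⟨by omega, h.2⟩⟩
    | succ t ih =>
      refine ⟨ih.2, step (t + 1) ih.2 fun b hb hpar w hw hw2 haw => ?_⟩
      rcases (hact (t + 1) _ (hτ _ (by omega))).1 haw with h | ⟨h, -⟩ | h
      · omega
      · omega
      · exact ih.1 b hb hpar (h.2 _ (hs _ _ hw))
  obtain ⟨t₀, ht₀⟩ := ht
  have han : a / 2 < n := hτ _ (by have := ha.1; omega)
  rcases Nat.mod_two_eq_zero_or_one a with h | h
  · exact (key (2 * t₀)).2 a .refl (by omega) (ht₀ _ (by omega) _ han)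
  · exact (key (2 * t₀)).1 a .refl (by omega) (ht₀ _ (by omega) _ han)

/-- If a neighbor of `u` is missing at time 0, then `u` is inactive at time 1, hence its full
neighbor `v` at time 2, hence `u` at time 3, and so on: `u` is inactive at all odd times. -/
theorem neighbor_mem_of_target (hs : ∀ u v, Adj u v → Adj v u) (hn : ∀ u v, Adj u v → u < n)
    (hact : ∀ t, ∀ u < n, act (t + 1) u ↔ Rule Adj τ (act t) u)
    (ht : ∃ t₀, ∀ t ≥ t₀, ∀ u < n, act t u) {u v w : ℕ} (huv : Adj u v) (hu : 2 ≤ τ u)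
    (hv : 2 ≤ τ v) (hw : Adj u w) : act 0 w := by
  by_contra hw0
  have hu' : ∀ t y z, Adj y z → 2 ≤ τ y → ¬ act t z → ¬ act (t + 1) y := by
    intro t y z hyz hy hz h
    rcases (hact t y (hn _ _ hyz)).1 h with h | ⟨h, -⟩ | h
    · omega
    · omega
    · exact hz (h.2 z hyz)
  have key : ∀ t, ¬ act (2 * t + 1) u := by
    intro t
    induction t with
    | zero => exact hu' 0 u w hw hu hw0
    | succ t ih => exact hu' _ u v huv hu (hu' _ v u (hs _ _ huv) hv ih)
  obtain ⟨t₀, ht₀⟩ := ht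
  exact key t₀ (ht₀ _ (by omega) _ (hn _ _ huv))

/-- Adjacent full vertices are always active by the first condition, so they never hinder anything.
Hence any activity next to a vertex of threshold 1 recurs with period two, spreads through the
component, and reaches both parities of every such vertex. The remaining full vertices follow one
step later. -/
theorem target_of_witness (hs : ∀ u v, Adj u v → Adj v u) (hn : ∀ u v, Adj u v → u < n)
    (hact : ∀ t, ∀ u < n, act (t + 1) u ↔ Rule Adj τ (act t) u)
    (hA : ∀ u v w, Adj u v → 2 ≤ τ u → 2 ≤ τ v → Adj u w → act 0 w)
    (hB : ∀ a, Required Adj τ a → ∃ b, Linked Adj τ a b ∧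
      ∃ w, Witness Adj τ (act 0) (fun w => ∀ v, Adj w v → act 0 v) b w) :
    ∃ t₀, ∀ t ≥ t₀, ∀ u < n, act t u := by
  have hzero : ∀ t, ∀ u < n, τ u = 0 → act (t + 1) u := fun t u hu h => (hact t u hu).2 (.inl h)
  have hone : ∀ t u w, Adj u w → τ u = 1 → act t w → act (t + 1) u := fun t u w hw h ha =>
    (hact t u (hn _ _ hw)).2 (.inr (.inl ⟨h, w, hw, ha⟩))
  have hall : ∀ t, ∀ u < n, 2 ≤ τ u → (∀ w, Adj u w → act t w) → act (t + 1) u :=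
    fun t u hu h ha => (hact t u hu).2 (.inr (.inr ⟨h, ha⟩))
  -- The neighborhoods of adjacent full vertices stay active by induction: a neighbor of threshold 1
  -- is kept by the full vertex itself, and a full neighbor is again part of such a pair.
  have hpair : ∀ t u v, Adj u v → 2 ≤ τ u → 2 ≤ τ v → act t u ∧ ∀ w, Adj u w → act t w := by
    intro t
    induction t with
    | zero =>
      exact fun u v huv hu hv => ⟨hA v u u (hs _ _ huv) hv hu (hs _ _ huv), fun w => hA u v w huv hu hv⟩
    | succ t ih =>
      intro u v huv hu hv
      refine ⟨hall t u (hn _ _ huv) hu (ih u v huv hu hv).2, fun w hw => ?_⟩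
      rcases Nat.lt_or_ge (τ w) 2 with h | h
      · rcases Nat.lt_or_ge (τ w) 1 with h' | h'
        · exact hzero t w (hn _ _ (hs _ _ hw)) (by omega)
        · exact hone t w u (hs _ _ hw) (by omega) (ih u v huv hu hv).1
      · exact hall t w (hn _ _ (hs _ _ hw)) h (ih w u (hs _ _ hw) h hu).2
  have hnext : ∀ t w, 2 ≤ τ w → act t w → ∀ v, Adj w v → act (t + 1) v := by
    intro t w hw ha v hv
    rcases Nat.lt_or_ge (τ v) 2 with h | h
    · rcases Nat.lt_or_ge (τ v) 1 with h' | h'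
      · exact hzero t v (hn _ _ (hs _ _ hv)) (by omega)
      · exact hone t v w (hs _ _ hv) (by omega) ha
    · exact (hpair (t + 1) v w (hs _ _ hv) h hw).1
  -- The neighbor `y` of threshold 1 bounces the activity back if `w` also has threshold 1; a full
  -- `w` has by then activated its whole neighborhood.
  have htwo : ∀ t w y, Adj y w → τ y = 1 → act t w → act (t + 2) w := by
    intro t w y hyw hy ha
    rcases Nat.lt_or_ge (τ w) 2 with h | h
    · rcases Nat.lt_or_ge (τ w) 1 with h' | h'
      · exact hzero _ w (hn _ _ (hs _ _ hyw)) (by omega)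
      · exact hone _ w y (hs _ _ hyw) (by omega) (hone t y w hyw hy ha)
    · exact hall _ w (hn _ _ (hs _ _ hyw)) h (hnext t w h ha)
  have hper : ∀ t w y, Adj y w → τ y = 1 → act t w → ∀ k, act (t + 1 + 2 * k) y := by
    intro t w y hyw hy ha k
    have : act (t + 2 * k) w := by
      induction k with
      | zero => exact ha
      | succ k ih => exact htwo _ w y hyw hy ih
    have := hone _ y w hyw hy this
    rwa [show t + 1 + 2 * k = t + 2 * k + 1 by omega]
  -- `Ev a`: the vertex of `a` is active at all late times of the parity of `a`.
  let Ev : ℕ → Prop := fun a => ∃ t₀, ∀ t ≥ t₀, t % 2 = a % 2 → act t (a / 2)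
  have hEv : ∀ a b, Linked Adj τ a b → Ev a → Ev b := by
    intro a b hab ha
    induction hab with
    | refl => exact ha
    | @tail b c _ hbc ih =>
      obtain ⟨t₀, ht₀⟩ := ih
      obtain ⟨h1, h2, h3, h4⟩ := hbc
      refine ⟨t₀ + 1, fun t ht hpar => ?_⟩
      obtain ⟨t, rfl⟩ : ∃ t', t = t' + 1 := ⟨t - 1, by omega⟩
      exact hone t _ _ (hs _ _ h1) h3 (ht₀ t (by omega) (by omega))
  have hEv_of : ∀ t w b, Adj (b / 2) w → τ (b / 2) = 1 → act t w → (t + 1) % 2 = b % 2 → Ev b := by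
    intro t w b hw hb ha hpar
    refine ⟨t + 1, fun t' ht' hpar' => ?_⟩
    have := hper t w (b / 2) hw hb ha ((t' - (t + 1)) / 2)
    rwa [show t + 1 + 2 * ((t' - (t + 1)) / 2) = t' by omega] at this
  have hEv_all : ∀ a, τ (a / 2) = 1 → Ev a := by
    intro a ha
    by_cases hreq : Required Adj τ a
    · obtain ⟨b, hab, w, hw, hwit⟩ := hB a hreq
      have hb := hab.tau ha
      refine hEv b a (hab.symm hs) ?_
      split_ifs at hwit with hpar
      · exact hEv_of 0 w b hw hb hwit (by omega)
      · obtain ⟨hw1, hg⟩ := hwit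
        have hw0 := hreq.2 b hab w hw
        exact hEv_of 1 w b hw hb (hall 0 w (hn _ _ (hs _ _ hw)) (by omega) hg) (by omega)
    · have : ∃ b, Linked Adj τ a b ∧ ∃ w, Adj (b / 2) w ∧ τ w = 0 := by
        by_contra hcon
        push Not at hcon
        exact hreq ⟨ha, hcon⟩
      obtain ⟨b, hab, w, hw, hw0⟩ := this
      refine hEv b a (hab.symm hs) ?_
      -- A neighbor of threshold 0 is active at every positive time, so a time of the required
      -- parity can be chosen.
      exact hEv_of (b % 2 + 1) w b hw (hab.tau ha) (hzero _ w (hn _ _ (hs _ _ hw)) hw0) (by omega)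
  have hsmall : ∀ u, u < n → τ u < 2 → ∃ t₀, ∀ t ≥ t₀, act t u := by
    intro u hu h2
    rcases Nat.lt_or_ge (τ u) 1 with h' | h'
    · refine ⟨1, fun t ht => ?_⟩
      obtain ⟨t, rfl⟩ : ∃ t', t = t' + 1 := ⟨t - 1, by omega⟩
      exact hzero t u hu (by omega)
    · obtain ⟨t₁, h₁⟩ := hEv_all (2 * u) (by rw [show 2 * u / 2 = u by omega]; omega)
      obtain ⟨t₂, h₂⟩ := hEv_all (2 * u + 1) (by rw [show (2 * u + 1) / 2 = u by omega]; omega)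
      rw [show 2 * u / 2 = u by omega] at h₁
      rw [show (2 * u + 1) / 2 = u by omega] at h₂
      refine ⟨t₁ + t₂, fun t ht => ?_⟩
      rcases Nat.mod_two_eq_zero_or_one t with h | h
      · exact h₁ t (by omega) (by omega)
      · exact h₂ t (by omega) (by omega)
  choose! f hf using hsmall
  -- The extra 1 is for full vertices without full neighbors, which need their neighborhood to be
  -- active one step before.
  refine ⟨(Finset.range n).sup f + 1, fun t ht u hu => ?_⟩
  have hle : ∀ v < n, f v ≤ (Finset.range n).sup f := fun v hv =>
    Finset.le_sup (Finset.mem_range.2 hv)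
  rcases Nat.lt_or_ge (τ u) 2 with h | h
  · exact hf u hu h t (by have := hle u hu; omega)
  · by_cases hv : ∃ v, Adj u v ∧ 2 ≤ τ v
    · obtain ⟨v, huv, hv⟩ := hv
      exact (hpair t u v huv h hv).1
    · push Not at hv
      obtain ⟨t, rfl⟩ : ∃ t', t = t' + 1 := ⟨t - 1, by omega⟩
      refine hall t u hu h fun w hw => ?_
      have hwn := hn _ _ (hs _ _ hw)
      exact hf w hwn (hv w hw) t (by have := hle w hwn; omega)

end Activation

end NonMonotone

/-! ### Mixed radix representations -/

namespace MixedRadix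

open Finset

/-- The value of the place `u` if the place `v` has base `b v`. -/
def place (b : ℕ → ℕ) (u : ℕ) : ℕ := ∏ v ∈ range u, b v

/-- The number with the digits `d u` for `u < n`. -/
def encode (n : ℕ) (b d : ℕ → ℕ) : ℕ := ∑ u ∈ range n, d u * place b u

/-- The digit of `z` at the place `u`. -/
def digit (b : ℕ → ℕ) (z u : ℕ) : ℕ := z / place b u % b u

variable {b d : ℕ → ℕ} {n : ℕ}

theorem place_succ (b : ℕ → ℕ) (u : ℕ) : place b (u + 1) = place b u * b u := by
  simp [place, prod_range_succ]

theorem encode_succ (n : ℕ) (b d : ℕ → ℕ) :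
    encode (n + 1) b d = encode n b d + d n * place b n := by
  simp [encode, sum_range_succ]

theorem encode_lt (hd : ∀ u < n, d u < b u) : encode n b d < place b n := by
  induction n with
  | zero => simp [encode, place]
  | succ n ih =>
    have h1 := ih fun u hu => hd u (by omega)
    have h2 := hd n (by omega)
    rw [encode_succ, place_succ]
    nlinarith

theorem place_pos (hd : ∀ u < n, d u < b u) : 0 < place b n :=
  (Nat.zero_le _).trans_lt (encode_lt hd)

theorem digit_encode (hd : ∀ u < n, d u < b u) {u : ℕ} (hu : u < n) :
    digit b (encode n b d) u = d u := by
  induction n with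
  | zero => omega
  | succ n ih =>
    have hd' : ∀ u < n, d u < b u := fun u hu => hd u (by omega)
    have hlt := encode_lt hd'
    have hpos := place_pos hd'
    rw [encode_succ]
    rcases Nat.lt_succ_iff_lt_or_eq.1 hu with h | rfl
    · have hdvd : place b (u + 1) ∣ place b n :=
        prod_dvd_prod_of_subset _ _ _ (range_subset_range.2 h)
      obtain ⟨k, hk⟩ := hdvd
      rw [← ih hd' h, hk, digit, digit, place_succ]
      have hu0 : 0 < place b u := by
        refine Nat.pos_of_ne_zero fun h0 => ?_
        rw [hk, place_succ, h0] at hpos; simp at hpos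
      rw [show d n * (place b u * b u * k) = place b u * (b u * (d n * k)) by ring,
        Nat.add_mul_div_left _ _ hu0, Nat.add_mul_mod_self_left]
    · rw [digit, Nat.add_mul_div_right _ _ hpos, Nat.div_eq_of_lt hlt, zero_add,
        Nat.mod_eq_of_lt (hd u (by omega))]

open Classical in
/-- The bases for digits below `q` at the places in `B`, and no digits elsewhere. -/
noncomputable def base (q : ℕ) (B : ℕ → Prop) (u : ℕ) : ℕ := if B u then q else 1

open Classical in
/-- The digits at the places in `B`. -/
noncomputable def mask (B : ℕ → Prop) (d : ℕ → ℕ) (u : ℕ) : ℕ := if B u then d u else 0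

/-- The code of the digits below `q` at the places in `B`. -/
noncomputable def code (n q : ℕ) (B : ℕ → Prop) (d : ℕ → ℕ) : ℕ := encode n (base q B) (mask B d)

variable {q : ℕ} {B : ℕ → Prop}

theorem mask_lt_base (hd : ∀ u, d u < q) (u : ℕ) : mask B d u < base q B u := by
  unfold mask base; split_ifs
  · exact hd u
  · exact one_pos

theorem digit_code (hd : ∀ u, d u < q) {u : ℕ} (hu : u < n) (hB : B u) :
    digit (base q B) (code n q B d) u = d u := by
  rw [code, digit_encode (fun u _ => mask_lt_base hd u) hu, mask, if_pos hB]

theorem code_lt (hd : ∀ u, d u < q) : code n q B d < place (base q B) n :=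
  encode_lt fun u _ => mask_lt_base hd u

theorem eq_of_code_eq {d' : ℕ → ℕ} (hd : ∀ u, d u < q) (hd' : ∀ u, d' u < q)
    (h : code n q B d = code n q B d') {u : ℕ} (hu : u < n) (hB : B u) : d u = d' u := by
  rw [← digit_code hd hu hB, h, digit_code hd' hu hB]

theorem code_congr {d' : ℕ → ℕ} (h : ∀ u, B u → d u = d' u) : code n q B d = code n q B d' := by
  unfold code encode
  refine sum_congr rfl fun u _ => ?_
  unfold mask; split_ifs with hB
  · rw [h u hB]
  · rfl

/-- Places outside `B` have base 1 and contribute nothing, so the number of codes is exponential in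
the size of `B` only, although places are addressed by vertices. -/
theorem place_base (q : ℕ) (B : ℕ → Prop) [DecidablePred B] (u : ℕ) :
    place (base q B) u = q ^ ((range u).filter B).card := by
  induction u with
  | zero => simp [place]
  | succ u ih =>
    rw [place_succ, ih, range_add_one, filter_insert, base]
    split_ifs with h
    · rw [card_insert_of_notMem (by simp), pow_succ]
    · rw [mul_one]

end MixedRadix

namespace NonMonotone

/-! ### Partial solutions and their combination -/

open Finset

/-- The bit number `i` of `d` is `1`. -/
def Bit (d i : ℕ) : Prop := d / 2 ^ i % 2 = 1

open Classical in
/-- The number with the given bits. -/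
noncomputable def threeBits (A B C : Prop) : ℕ :=
  (if A then 1 else 0) + 2 * (if B then 1 else 0) + 4 * (if C then 1 else 0)

section Bits

variable {A B C : Prop}

theorem threeBits_lt : threeBits A B C < 8 := by
  unfold threeBits; split_ifs <;> simp

theorem bit_threeBits_zero : Bit (threeBits A B C) 0 ↔ A := by
  unfold threeBits Bit; split_ifs <;> simp [*]

theorem bit_threeBits_one : Bit (threeBits A B C) 1 ↔ B := by
  unfold threeBits Bit; split_ifs <;> simp [*]

theorem bit_threeBits_two : Bit (threeBits A B C) 2 ↔ C := by
  unfold threeBits Bit; split_ifs <;> simp [*]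

end Bits

/-- The part of a joint label that belongs to the parent. -/
def parentPart (e : ℕ → ℕ) (u : ℕ) : ℕ := e u % 8

/-- The part of a joint label that belongs to the child. -/
def childPart (e : ℕ → ℕ) (u : ℕ) : ℕ := e u % 2 + 2 * (e u / 8)

/-- A joint label has five bits: bit 0 is shared, bits 1 and 2 belong to the parent, bits 3 and 4 to
the child. Sharing bit 0 makes the base 32 instead of 64. -/
theorem bit_childPart_zero (e : ℕ → ℕ) (u : ℕ) : Bit (childPart e u) 0 ↔ Bit (e u) 0 := by
  simp only [Bit, childPart]; omega

theorem bit_parentPart_zero (e : ℕ → ℕ) (u : ℕ) : Bit (parentPart e u) 0 ↔ Bit (e u) 0 := by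
  simp only [Bit, parentPart]; omega

section Defs

variable (Adj : ℕ → ℕ → Prop) (τ : ℕ → ℕ) (X : ℕ → ℕ → Prop) (n : ℕ)

/-- Some bag of a node in `W` contains `u`. -/
def Covers (W : Set ℕ) (u : ℕ) : Prop := ∃ t ∈ W, X t u

/-- The component of `a` has an activity within some bag of a node in `W`. -/
def Hit (W : Set ℕ) (x g : ℕ → Prop) (a : ℕ) : Prop :=
  ∃ b, Linked Adj τ a b ∧ ∃ t ∈ W, X t (b / 2) ∧ ∃ w, X t w ∧ Witness Adj τ x g b w

/-- The local conditions within the bag of `t`. -/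
def Valid (t : ℕ) (x g : ℕ → Prop) : Prop :=
  ∀ u v, X t u → X t v → Adj u v → (τ u ≠ 1 → g u → x v) ∧ (2 ≤ τ u → 2 ≤ τ v → g u)

open Classical in
/-- The number of elements of `x` that are covered by `W` and are not in the bag of `p`. -/
noncomputable def forgotten (W : Set ℕ) (p : ℕ) (x : ℕ → Prop) : ℕ :=
  ((range n).filter fun u => Covers X W u ∧ ¬ X p u ∧ x u).card

/-- There is a solution for the part of the graph covered by `W` that fits to the label `d` of the bag
of `p`, and has `c` elements outside of this bag. -/
def PartialSol (W : Set ℕ) (p : ℕ) (d : ℕ → ℕ) (c : ℕ) : Prop :=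
  ∃ x g : ℕ → Prop, (∀ t ∈ W, Valid Adj τ X t x g) ∧ (∀ u, X p u → (Bit (d u) 0 ↔ x u)) ∧
    (∀ u, X p u → τ u ≠ 1 → (Bit (d u) 1 ↔ g u)) ∧
    (∀ u, X p u → τ u = 1 → ∀ j < 2, Bit (d u) (1 + j) → Hit Adj τ X W x g (2 * u + j)) ∧
    (∀ a, Required Adj τ a → (∃ b, Linked Adj τ a b ∧ Covers X W (b / 2)) →
      (∀ b, Linked Adj τ a b → ¬ X p (b / 2)) → Hit Adj τ X W x g a) ∧
    c = forgotten X n W p x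

/-- According to the joint label `e`, the component of `a` has an activity. -/
def NewHit (s p : ℕ) (e : ℕ → ℕ) (a : ℕ) : Prop :=
  ∃ b, Linked Adj τ a b ∧ ((X p (b / 2) ∧ Bit (parentPart e (b / 2)) (1 + b % 2)) ∨
    (X s (b / 2) ∧ (Bit (childPart e (b / 2)) (1 + b % 2) ∨
      ∃ w, X s w ∧ Witness Adj τ (fun w => Bit (e w) 0) (fun w => Bit (childPart e w) 1) b w)))

/-- The joint label `e` is consistent. -/
structure MergeOk (s p : ℕ) (e : ℕ → ℕ) : Prop where
  valid : Valid Adj τ X s (fun w => Bit (e w) 0) (fun w => Bit (childPart e w) 1)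
  agree : ∀ u, X p u → X s u → τ u ≠ 1 → (Bit (parentPart e u) 1 ↔ Bit (childPart e u) 1)
  hit : ∀ a, X s (a / 2) → Required Adj τ a → NewHit Adj τ X s p e a ∨
    ∃ b, Linked Adj τ a b ∧ X p (b / 2)

/-- The label of the bag of `p` after the combination. -/
noncomputable def newLabel (s p : ℕ) (e : ℕ → ℕ) (u : ℕ) : ℕ :=
  threeBits (Bit (e u) 0)
    ((τ u = 1 ∧ NewHit Adj τ X s p e (2 * u)) ∨ (τ u ≠ 1 ∧ Bit (parentPart e u) 1))
    (τ u = 1 ∧ NewHit Adj τ X s p e (2 * u + 1))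

open Classical in
/-- The number of elements that are forgotten by the combination. -/
noncomputable def newForgotten (s p : ℕ) (e : ℕ → ℕ) : ℕ :=
  ((range n).filter fun u => X s u ∧ ¬ X p u ∧ Bit (e u) 0).card

/-- The label of a global solution with respect to the nodes in `W`. -/
noncomputable def solLabel (W : Set ℕ) (x g : ℕ → Prop) (u : ℕ) : ℕ :=
  threeBits (x u) ((τ u = 1 ∧ Hit Adj τ X W x g (2 * u)) ∨ (τ u ≠ 1 ∧ g u))
    (τ u = 1 ∧ Hit Adj τ X W x g (2 * u + 1))

/-- The node `s` with parent `p` and set `D` of descendants (including `s`) separates. -/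
structure Separates (D : Set ℕ) (s p : ℕ) : Prop where
  child_mem : s ∈ D
  parent_notMem : p ∉ D
  sep : ∀ u, Covers X D u → Covers X Dᶜ u → X s u ∧ X p u

end Defs

/-! ### Gluing and restricting solutions along a tree edge. -/

variable {Adj : ℕ → ℕ → Prop} {τ : ℕ → ℕ} {X : ℕ → ℕ → Prop} {n : ℕ}

theorem PartialSol.congr {W : Set ℕ} {p c : ℕ} {d d' : ℕ → ℕ} (h : PartialSol Adj τ X n W p d c)
    (hd : ∀ u, X p u → d u = d' u) : PartialSol Adj τ X n W p d' c := by
  obtain ⟨x, g, h1, h2, h3, h4, h5, h6⟩ := h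
  refine ⟨x, g, h1, fun u hu => ?_, fun u hu => ?_, fun u hu => ?_, h5, h6⟩
  · rw [← hd u hu]; exact h2 u hu
  · rw [← hd u hu]; exact h3 u hu
  · rw [← hd u hu]; exact h4 u hu

theorem Hit.linked (hs : ∀ u v, Adj u v → Adj v u) {W : Set ℕ} {x g : ℕ → Prop} {a b : ℕ}
    (h : Hit Adj τ X W x g a) (hab : Linked Adj τ a b) : Hit Adj τ X W x g b := by
  obtain ⟨c, hc, h⟩ := h
  exact ⟨c, (hab.symm hs).trans hc, h⟩

/-- At vertices of threshold 1 the label bit in the place of `g` has another meaning, so `g` may be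
compared at the other vertices only; `Witness` looks at `g` only there. -/
theorem Witness.congr {x g x' g' : ℕ → Prop} {b w : ℕ} (h : Witness Adj τ x g b w)
    (hx : x w → x' w) (hg : τ w ≠ 1 → g w → g' w) : Witness Adj τ x' g' b w := by
  refine ⟨h.1, ?_⟩
  have h2 := h.2
  split_ifs at h2 ⊢ with hb
  · exact hx h2
  · exact ⟨h2.1, hg h2.1 h2.2⟩

theorem Hit.congr {W W' : Set ℕ} {x g x' g' : ℕ → Prop} {a : ℕ} (h : Hit Adj τ X W x g a)
    (hW : W ⊆ W') (hx : ∀ t ∈ W, ∀ u, X t u → x u → x' u)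
    (hg : ∀ t ∈ W, ∀ u, X t u → τ u ≠ 1 → g u → g' u) : Hit Adj τ X W' x' g' a := by
  obtain ⟨b, hb, t, ht, hbt, w, hw, hwit⟩ := h
  exact ⟨b, hb, t, hW ht, hbt, w, hw, hwit.congr (hx t ht w hw) (hg t ht w hw)⟩

theorem Valid.congr {t : ℕ} {x g x' g' : ℕ → Prop} (h : Valid Adj τ X t x g)
    (hx : ∀ u, X t u → (x u ↔ x' u)) (hg : ∀ u, X t u → τ u ≠ 1 → (g u ↔ g' u)) :
    Valid Adj τ X t x' g' := by
  intro u v hu hv huv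
  obtain ⟨h1, h2⟩ := h u v hu hv huv
  refine ⟨fun ht hgu => (hx v hv).1 (h1 ht ((hg u hu ht).2 hgu)), fun h3 h4 => ?_⟩
  exact (hg u hu (by omega)).1 (h2 h3 h4)

/-- Each edge of the cover lies in some bag. Along a walk that starts below `s`, the first edge
whose bag is not below `s` begins at an element covered from both sides, which is therefore in both
bags; if there is no such edge, the last element is one. -/
theorem Separates.linked {D : Set ℕ} {s p : ℕ} (h : Separates X D s p)
    (hedge : ∀ u v, Adj u v → ∃ t, X t u ∧ X t v) {a b : ℕ} (hab : Linked Adj τ a b)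
    (ha : Covers X D (a / 2)) (hb : Covers X Dᶜ (b / 2)) :
    ∃ c, Linked Adj τ a c ∧ X s (c / 2) ∧ X p (c / 2) := by
  induction hab using Relation.ReflTransGen.head_induction_on with
  | refl => exact ⟨b, .refl, h.sep _ ha hb⟩
  | @head a c hac _ ih =>
    obtain ⟨t, hta, htc⟩ := hedge _ _ hac.1
    by_cases htD : t ∈ D
    · obtain ⟨e, he, h'⟩ := ih ⟨t, htD, htc⟩
      exact ⟨e, .head hac he, h'⟩
    · exact ⟨a, .refl, h.sep _ ha ⟨t, htD, hta⟩⟩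

/-- The newly uncovered vertices are exactly those in the bag of `s` but not of `p`. Separation
makes the three groups disjoint, so nothing is counted twice. -/
theorem forgotten_merge {Ws Wp : Set ℕ} {s p : ℕ} {x xs xp : ℕ → Prop} {e : ℕ → ℕ}
    (hsep : Separates X (insert s Ws) s p) (hWp : Wp ⊆ (insert s Ws)ᶜ)
    (hxs : ∀ u, Covers X Ws u → (x u ↔ xs u)) (hxp : ∀ u, Covers X Wp u → (x u ↔ xp u))
    (hxe : ∀ u, X s u → (x u ↔ Bit (e u) 0)) :
    forgotten X n (Wp ∪ insert s Ws) p x =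
      forgotten X n Wp p xp + forgotten X n Ws s xs + newForgotten X n s p e := by
  classical
  unfold forgotten newForgotten
  have hpD : ∀ u, X p u → Covers X (insert s Ws)ᶜ u := fun u hu => ⟨p, hsep.parent_notMem, hu⟩
  have hWpD : ∀ u, Covers X Wp u → Covers X (insert s Ws)ᶜ u := fun u ⟨t, ht, hu⟩ => ⟨t, hWp ht, hu⟩
  have hWsD : ∀ u, Covers X Ws u → Covers X (insert s Ws) u := fun u ⟨t, ht, hu⟩ => ⟨t, .inr ht, hu⟩
  have hsD : ∀ u, X s u → Covers X (insert s Ws) u := fun u hu => ⟨s, .inl rfl, hu⟩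
  rw [← card_union_of_disjoint, ← card_union_of_disjoint]
  · congr 1
    ext u
    simp only [mem_filter, mem_union, mem_range]
    constructor
    · rintro ⟨hu, ⟨t, ht, htu⟩, hup, hxu⟩
      rcases ht with ht | rfl | ht
      · exact .inl (.inl ⟨hu, ⟨t, ht, htu⟩, hup, (hxp u ⟨t, ht, htu⟩).1 hxu⟩)
      · exact .inr ⟨hu, htu, hup, (hxe u htu).1 hxu⟩
      · by_cases hus : X s u
        · exact .inr ⟨hu, hus, hup, (hxe u hus).1 hxu⟩
        · exact .inl (.inr ⟨hu, ⟨t, ht, htu⟩, hus, (hxs u ⟨t, ht, htu⟩).1 hxu⟩)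
    · rintro ((⟨hu, h, hup, hxu⟩ | ⟨hu, h, hus, hxu⟩) | ⟨hu, hus, hup, hxu⟩)
      · obtain ⟨t, ht, htu⟩ := h
        exact ⟨hu, ⟨t, .inl ht, htu⟩, hup, (hxp u ⟨t, ht, htu⟩).2 hxu⟩
      · refine ⟨hu, ?_, fun hup => hus (hsep.sep u (hWsD u h) (hpD u hup)).1, (hxs u h).2 hxu⟩
        obtain ⟨t, ht, htu⟩ := h
        exact ⟨t, .inr (.inr ht), htu⟩
      · exact ⟨hu, ⟨s, .inr (.inl rfl), hus⟩, hup, (hxe u hus).2 hxu⟩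
  · rw [disjoint_union_left]
    constructor <;> rw [disjoint_left] <;> simp only [mem_filter, mem_range]
    · rintro u ⟨hu, h, hup, -⟩ ⟨-, hus, -, -⟩
      exact hup (hsep.sep u (hsD u hus) (hWpD u h)).2
    · rintro u ⟨hu, h, hup, -⟩ ⟨-, hus, -, -⟩
      exact hup hus
  · rw [disjoint_left]; simp only [mem_filter, mem_range]
    rintro u ⟨hu, h, hup, -⟩ ⟨-, h', hus, -⟩
    exact hup (hsep.sep u (hWsD u h') (hWpD u h)).2

/-- The glued solution follows the child on everything covered below `s` and the parent elsewhere. A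
required component that loses contact with the bag of `p` either met the bag of `s`, where
`MergeOk.hit` applies, or was already settled on one side. -/
theorem PartialSol.merge (hs : ∀ u v, Adj u v → Adj v u)
    {Ws Wp : Set ℕ} {s p c₁ c₂ : ℕ} {e : ℕ → ℕ}
    (hsep : Separates X (insert s Ws) s p) (hWp : Wp ⊆ (insert s Ws)ᶜ)
    (h₁ : PartialSol Adj τ X n Wp p (parentPart e) c₁)
    (h₂ : PartialSol Adj τ X n Ws s (childPart e) c₂) (hok : MergeOk Adj τ X s p e) :
    PartialSol Adj τ X n (Wp ∪ insert s Ws) p (newLabel Adj τ X s p e)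
      (c₁ + c₂ + newForgotten X n s p e) := by
  classical
  obtain ⟨xp, gp, p1, p2, p3, p4, p5, p6⟩ := h₁
  obtain ⟨xs, gs, s1, s2, s3, s4, s5, s6⟩ := h₂
  set D := insert s Ws with hD
  set W := Wp ∪ D with hW
  have hpD : ∀ u, X p u → Covers X Dᶜ u := fun u hu => ⟨p, hsep.parent_notMem, hu⟩
  have hsD : ∀ u, X s u → Covers X D u := fun u hu => ⟨s, .inl rfl, hu⟩
  set x : ℕ → Prop := fun u => if Covers X D u then xs u else xp u with hx
  set g : ℕ → Prop := fun u => if Covers X D u then gs u else gp u with hg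
  have hxs : ∀ u, Covers X D u → (x u ↔ xs u) := fun u hu => by simp [hx, hu]
  have hgs : ∀ u, Covers X D u → (g u ↔ gs u) := fun u hu => by simp [hg, hu]
  -- A vertex covered from both sides lies in both bags, where the shared bit 0 identifies `xs` with
  -- `xp`; `MergeOk.agree` does the same for `g` below.
  have hxp : ∀ u, Covers X Dᶜ u → (x u ↔ xp u) := by
    intro u hu
    by_cases h : Covers X D u
    · obtain ⟨h1, h2⟩ := hsep.sep u h hu
      rw [hxs u h, ← s2 u h1, bit_childPart_zero, ← bit_parentPart_zero, p2 u h2]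
    · simp [hx, h]
  have hgp : ∀ u, Covers X Dᶜ u → τ u ≠ 1 → (g u ↔ gp u) := by
    intro u hu hτ
    by_cases h : Covers X D u
    · obtain ⟨h1, h2⟩ := hsep.sep u h hu
      rw [hgs u h, ← s3 u h1 hτ, ← hok.agree u h2 h1 hτ, p3 u h2 hτ]
    · simp [hg, h]
  have cD : ∀ t ∈ D, ∀ u, X t u → Covers X D u := fun t ht u hu => ⟨t, ht, hu⟩
  have cs : ∀ t ∈ Ws, ∀ u, X t u → Covers X D u := fun t ht u hu => ⟨t, .inr ht, hu⟩
  have cp : ∀ t ∈ Wp, ∀ u, X t u → Covers X Dᶜ u := fun t ht u hu => ⟨t, hWp ht, hu⟩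
  have hHp : ∀ a, Hit Adj τ X Wp xp gp a → Hit Adj τ X W x g a := fun a h =>
    h.congr Set.subset_union_left (fun t ht u hu => (hxp u (cp t ht u hu)).2)
      (fun t ht u hu hτ => (hgp u (cp t ht u hu) hτ).2)
  have hHs : ∀ a, Hit Adj τ X Ws xs gs a → Hit Adj τ X W x g a := fun a h =>
    h.congr (fun t ht => .inr (.inr ht)) (fun t ht u hu => (hxs u (cs t ht u hu)).2)
      (fun t ht u hu _ => (hgs u (cs t ht u hu)).2)
  have hxe : ∀ u, X s u → (x u ↔ Bit (e u) 0) := fun u hu => by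
    rw [hxs u (hsD u hu), ← s2 u hu, bit_childPart_zero]
  have hge : ∀ u, X s u → τ u ≠ 1 → (g u ↔ Bit (childPart e u) 1) := fun u hu hτ => by
    rw [hgs u (hsD u hu), ← s3 u hu hτ]
  have hnew : ∀ a, τ (a / 2) = 1 → NewHit Adj τ X s p e a → Hit Adj τ X W x g a := by
    rintro a ha ⟨b, hab, h⟩
    have hb := hab.tau ha
    refine Hit.linked hs ?_ (hab.symm hs)
    have h2 : 2 * (b / 2) + b % 2 = b := by omega
    rcases h with ⟨hbp, hbit⟩ | ⟨hbs, hbit | ⟨w, hw, hwit⟩⟩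
    · have := p4 _ hbp hb (b % 2) (by omega) hbit
      rw [h2] at this
      exact hHp _ this
    · have := s4 _ hbs hb (b % 2) (by omega) hbit
      rw [h2] at this
      exact hHs _ this
    · exact ⟨b, .refl, s, .inr (.inl rfl), hbs, w, hw, hwit.congr (hxe w hw).2
        fun hτ => (hge w hw hτ).2⟩
  refine ⟨x, g, ?_, ?_, ?_, ?_, ?_, ?_⟩
  · rintro t (ht | rfl | ht)
    · exact (p1 t ht).congr (fun u hu => (hxp u (cp t ht u hu)).symm)
        fun u hu hτ => (hgp u (cp t ht u hu) hτ).symm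
    · exact hok.valid.congr (fun u hu => (hxe u hu).symm) fun u hu hτ => (hge u hu hτ).symm
    · exact (s1 t ht).congr (fun u hu => (hxs u (cs t ht u hu)).symm)
        fun u hu _ => (hgs u (cs t ht u hu)).symm
  · intro u hu
    rw [newLabel, bit_threeBits_zero, hxp u (hpD u hu), ← p2 u hu, bit_parentPart_zero]
  · intro u hu hτ
    rw [newLabel, bit_threeBits_one, hgp u (hpD u hu) hτ, ← p3 u hu hτ]
    simp [hτ]
  · intro u hu hτ j hj hbit
    interval_cases j
    · rw [newLabel, bit_threeBits_one] at hbit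
      exact hnew _ (by rwa [show (2 * u + 0) / 2 = u by omega]) (by simpa [hτ] using hbit)
    · rw [newLabel, bit_threeBits_two] at hbit
      exact hnew _ (by rwa [show (2 * u + 1) / 2 = u by omega]) hbit.2
  · rintro a hreq ⟨b, hab, t, ht, htb⟩ hno
    -- Components that meet the bag of `s`: the alternative in `MergeOk.hit` that they meet the bag
    -- of `p` is excluded here.
    have hbs : ∀ b, Linked Adj τ a b → X s (b / 2) → Hit Adj τ X W x g a := by
      intro b hab hb
      rcases hok.hit b hb (hreq.linked hab) with h | ⟨c, hbc, hc⟩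
      · exact (hnew b (hab.tau hreq.1) h).linked hs (hab.symm hs)
      · exact absurd hc (hno c (hab.trans hbc))
    by_cases hts : ∃ b, Linked Adj τ a b ∧ X s (b / 2)
    · obtain ⟨b, hab, hb⟩ := hts
      exact hbs b hab hb
    · push Not at hts
      rcases ht with ht | rfl | ht
      · exact hHp _ (p5 a hreq ⟨b, hab, t, ht, htb⟩ hno)
      · exact absurd htb (hts b hab)
      · exact hHs _ (s5 a hreq ⟨b, hab, t, ht, htb⟩ hts)
  · rw [p6, s6]
    refine (forgotten_merge hsep hWp (fun u ⟨t, ht, hu⟩ => hxs u (cs t ht u hu))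
      (fun u ⟨t, ht, hu⟩ => hxp u (cp t ht u hu)) hxe).symm

/-- A global solution. -/
structure IsSol (Adj : ℕ → ℕ → Prop) (τ : ℕ → ℕ) (X : ℕ → ℕ → Prop) (x g : ℕ → Prop) : Prop where
  valid : ∀ t, Valid Adj τ X t x g
  hit : ∀ a, Required Adj τ a → Hit Adj τ X Set.univ x g a

/-- The exact labels of a global solution on the two sides combine to a consistent joint label, and
the new label is again exact: an activity below `s` can concern a component in the bag of `p` only
through elements lying in both bags. -/
theorem IsSol.merge (hs : ∀ u v, Adj u v → Adj v u) (hedge : ∀ u v, Adj u v → ∃ t, X t u ∧ X t v)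
    {x g : ℕ → Prop} (hsol : IsSol Adj τ X x g) {Ws Wp : Set ℕ} {s p : ℕ}
    (hsep : Separates X (insert s Ws) s p) (hWp : Wp ⊆ (insert s Ws)ᶜ) :
    ∃ e : ℕ → ℕ, (∀ u, e u < 32) ∧ MergeOk Adj τ X s p e ∧
      parentPart e = solLabel Adj τ X Wp x g ∧ childPart e = solLabel Adj τ X Ws x g ∧
      (∀ u, X p u → newLabel Adj τ X s p e u = solLabel Adj τ X (Wp ∪ insert s Ws) x g u) ∧
      forgotten X n (Wp ∪ insert s Ws) p x =
        forgotten X n Wp p x + forgotten X n Ws s x + newForgotten X n s p e := by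
  set D := insert s Ws with hD
  have hpD : ∀ u, X p u → Covers X Dᶜ u := fun u hu => ⟨p, hsep.parent_notMem, hu⟩
  have hsD : ∀ u, X s u → Covers X D u := fun u hu => ⟨s, .inl rfl, hu⟩
  set lp := solLabel Adj τ X Wp x g with hlp
  set ls := solLabel Adj τ X Ws x g with hls
  have lp8 : ∀ u, lp u < 8 := fun u => threeBits_lt
  have ls8 : ∀ u, ls u < 8 := fun u => threeBits_lt
  have b0 : ∀ u, Bit (lp u) 0 ↔ x u := fun u => bit_threeBits_zero
  have b0' : ∀ u, Bit (ls u) 0 ↔ x u := fun u => bit_threeBits_zero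
  have hpar : ∀ u, lp u % 2 = ls u % 2 := by
    intro u
    have h := (b0 u).trans (b0' u).symm
    simp only [Bit, pow_zero, Nat.div_one] at h
    omega
  -- Bit 0 is `x` in both labels, so it can be dropped from the child label without loss.
  set e : ℕ → ℕ := fun u => lp u + 8 * (ls u / 2) with he
  have hep : parentPart e = lp := by
    funext u; have := lp8 u; simp only [parentPart, he]; omega
  have hes : childPart e = ls := by
    funext u; have h1 := lp8 u; have h2 := hpar u; simp only [childPart, he]; omega
  have e0 : ∀ u, Bit (e u) 0 ↔ x u := fun u => by rw [← bit_parentPart_zero, hep, b0]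
  have bp : ∀ b, τ (b / 2) = 1 → (Bit (lp (b / 2)) (1 + b % 2) ↔ Hit Adj τ X Wp x g b) := by
    intro b hb
    rcases Nat.mod_two_eq_zero_or_one b with h | h <;> rw [h]
    · rw [hlp, solLabel, bit_threeBits_one, show 2 * (b / 2) = b by omega]; simp [hb]
    · rw [hlp, solLabel, bit_threeBits_two, show 2 * (b / 2) + 1 = b by omega]; simp [hb]
  have bs : ∀ b, τ (b / 2) = 1 → (Bit (ls (b / 2)) (1 + b % 2) ↔ Hit Adj τ X Ws x g b) := by
    intro b hb
    rcases Nat.mod_two_eq_zero_or_one b with h | h <;> rw [h]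
    · rw [hls, solLabel, bit_threeBits_one, show 2 * (b / 2) = b by omega]; simp [hb]
    · rw [hls, solLabel, bit_threeBits_two, show 2 * (b / 2) + 1 = b by omega]; simp [hb]
  have gs : ∀ u, τ u ≠ 1 → (Bit (ls u) 1 ↔ g u) := fun u hu => by
    rw [hls, solLabel, bit_threeBits_one]; simp [hu]
  have gp : ∀ u, τ u ≠ 1 → (Bit (lp u) 1 ↔ g u) := fun u hu => by
    rw [hlp, solLabel, bit_threeBits_one]; simp [hu]
  have hwit : ∀ b w, Witness Adj τ x g b w ↔
      Witness Adj τ (fun w => Bit (e w) 0) (fun w => Bit (ls w) 1) b w := fun b w =>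
    ⟨fun h => h.congr (e0 w).2 fun hτ => (gs w hτ).2, fun h => h.congr (e0 w).1 fun hτ => (gs w hτ).1⟩
  -- activities in the bag of the child or below
  have hchild : ∀ a b, τ (a / 2) = 1 → Linked Adj τ a b → X s (b / 2) → Hit Adj τ X D x g a →
      NewHit Adj τ X s p e a := by
    rintro a b ha hab hb ⟨c, hac, t, rfl | ht, htc, w, htw, hw⟩
    · exact ⟨c, hac, .inr ⟨htc, .inr ⟨w, htw, hes ▸ (hwit c w).1 hw⟩⟩⟩
    · refine ⟨b, hab, .inr ⟨hb, .inl ?_⟩⟩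
      rw [hes, bs b (hab.tau ha)]
      exact ⟨c, (hab.symm hs).trans hac, t, ht, htc, w, htw, hw⟩
  have hnew : ∀ a, τ (a / 2) = 1 → X p (a / 2) →
      (NewHit Adj τ X s p e a ↔ Hit Adj τ X (Wp ∪ D) x g a) := by
    intro a ha hap
    constructor
    · rintro ⟨b, hab, h⟩
      have hb := hab.tau ha
      refine Hit.linked hs ?_ (hab.symm hs)
      rcases h with ⟨-, h⟩ | ⟨hbs, h | ⟨w, hw, h⟩⟩
      · rw [hep, bp b hb] at h
        exact h.congr Set.subset_union_left (fun _ _ _ _ => id) fun _ _ _ _ _ => id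
      · rw [hes, bs b hb] at h
        exact h.congr (fun t ht => .inr (.inr ht)) (fun _ _ _ _ => id) fun _ _ _ _ _ => id
      · rw [hes, ← hwit] at h
        exact ⟨b, .refl, s, .inr (.inl rfl), hbs, w, hw, h⟩
    · rintro ⟨b, hab, t, ht | ht, htb, w, hw, h⟩
      · refine ⟨a, .refl, .inl ⟨hap, ?_⟩⟩
        rw [hep, bp a ha]
        exact ⟨b, hab, t, ht, htb, w, hw, h⟩
      -- The activity is below `s` while `a` is in the bag of `p`, so the component crosses the bag
      -- of `s`, and the child label or a witness in that bag records it.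
      · obtain ⟨c, hbc, hcs, -⟩ := hsep.linked hedge (hab.symm hs) ⟨t, ht, htb⟩ (hpD _ hap)
        exact hchild a c ha (hab.trans hbc) hcs ⟨b, hab, t, ht, htb, w, hw, h⟩
  refine ⟨e, fun u => ?_, ⟨?_, ?_, ?_⟩, hep, hes, ?_, ?_⟩
  · have h1 := lp8 u; have h2 := ls8 u; simp only [he]; omega
  · rw [hes]
    exact (hsol.valid s).congr (fun u _ => (e0 u).symm) fun u _ hτ => (gs u hτ).symm
  · intro u _ _ hτ
    rw [hep, hes, gs u hτ, gp u hτ]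
  · intro a has hreq
    by_cases hp : ∃ b, Linked Adj τ a b ∧ X p (b / 2)
    · exact .inr hp
    · refine .inl (hchild a a hreq.1 .refl has ?_)
      obtain ⟨b, hab, t, -, htb, w, hw, h⟩ := hsol.hit a hreq
      by_cases ht : t ∈ D
      · exact ⟨b, hab, t, ht, htb, w, hw, h⟩
      · obtain ⟨c, hac, -, hc⟩ := hsep.linked hedge hab (hsD _ has) ⟨t, ht, htb⟩
        exact absurd ⟨c, hac, hc⟩ hp
  · intro u hu
    unfold newLabel solLabel
    congr 1
    · exact propext (e0 u)
    · by_cases hτ : τ u = 1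
      · have := hnew (2 * u) (by rwa [show 2 * u / 2 = u by omega]) (by rwa [show 2 * u / 2 = u by omega])
        simp [hτ, this]
      · have := gp u hτ
        simp [hτ, hep, this]
    · by_cases hτ : τ u = 1
      · have := hnew (2 * u + 1) (by rwa [show (2 * u + 1) / 2 = u by omega])
          (by rwa [show (2 * u + 1) / 2 = u by omega])
        simp [hτ, this]
      · simp [hτ]
  · exact forgotten_merge hsep hWp (fun _ _ => Iff.rfl) (fun _ _ => Iff.rfl) fun u _ => (e0 u).symm

end NonMonotone

/-! ### Rooted trees on initial segments of the natural numbers -/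

namespace NatTree

/-- `par` is the parent function of a rooted tree with root `m` and other nodes `0, …, m - 1`. -/
structure IsTree (m : ℕ) (par : ℕ → ℕ) : Prop where
  par_root : par m = m
  par_le : ∀ s < m, par s ≤ m
  reaches : ∀ s < m, ∃ k, par^[k] s = m

/-- The descendants of `s`, including `s`. -/
def Desc (m : ℕ) (par : ℕ → ℕ) (s : ℕ) : Set ℕ := {t | t < m ∧ ∃ k, par^[k] t = s}

/-- The descendants of the children of `t` that are in `P`. -/
def Below (m : ℕ) (par : ℕ → ℕ) (P : Set ℕ) (t : ℕ) : Set ℕ :=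
  {d | ∃ c ∈ P, c < m ∧ par c = t ∧ d ∈ Desc m par c}

variable {m : ℕ} {par : ℕ → ℕ}

/-- The depth is the number of parent steps to the root. It excludes cycles, and it makes the number
of steps between a node and a given ancestor unique. -/
theorem IsTree.exists_depth (h : IsTree m par) : ∃ depth : ℕ → ℕ,
    ∀ s < m, depth s = depth (par s) + 1 := by
  classical
  have hex : ∀ s, s ≤ m → ∃ k, par^[k] s = m := fun s hs => by
    rcases hs.lt_or_eq with hs | rfl
    · exact h.reaches s hs
    · exact ⟨0, rfl⟩
  refine ⟨fun s => if hs : s ≤ m then Nat.find (hex s hs) else 0, fun s hs => ?_⟩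
  simp only [dif_pos hs.le, dif_pos (h.par_le s hs)]
  refine (Nat.find_eq_iff _).2 ⟨?_, fun k hk => ?_⟩
  · rw [Function.iterate_succ_apply]
    exact Nat.find_spec (hex (par s) (h.par_le s hs))
  · cases k with
    | zero => simp; omega
    | succ k =>
      rw [Function.iterate_succ_apply]
      exact Nat.find_min (hex (par s) (h.par_le s hs)) (by omega)

theorem IsTree.iterate_depth (h : IsTree m par) {depth : ℕ → ℕ}
    (hd : ∀ s < m, depth s = depth (par s) + 1) {s : ℕ} (hs : s < m) (k : ℕ) :
    ∀ t ≤ m, par^[k] t = s → depth t = depth s + k := by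
  induction k with
  | zero => rintro t - rfl; rfl
  | succ k ih =>
    intro t ht hk
    rcases ht.lt_or_eq with ht | rfl
    · rw [Function.iterate_succ_apply] at hk
      rw [hd t ht, ih _ (h.par_le t ht) hk, add_assoc]
    · rw [Function.iterate_fixed h.par_root] at hk; omega

theorem mem_desc_self {s : ℕ} (hs : s < m) : s ∈ Desc m par s := ⟨hs, 0, rfl⟩

theorem desc_eq {s : ℕ} (h : IsTree m par) (hs : s < m) {P : Set ℕ}
    (hP : ∀ c < m, par c = s → c ∈ P) : Desc m par s = insert s (Below m par P s) := by
  ext t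
  constructor
  · rintro ⟨ht, k, hk⟩
    cases k with
    | zero => exact .inl hk
    | succ k =>
      rw [Function.iterate_succ_apply'] at hk
      have hc : par^[k] t < m := by
        by_contra hcon
        have : par^[k] t = m := by
          refine le_antisymm ?_ (by omega)
          clear hk hcon
          induction k with
          | zero => exact ht.le
          | succ k ih =>
            rw [Function.iterate_succ_apply']
            rcases ih.lt_or_eq with h' | h'
            · exact h.par_le _ h'
            · rw [h', h.par_root]
        rw [this, h.par_root] at hk; omega
      exact .inr ⟨_, hP _ hc hk, hc, hk, ht, k, rfl⟩
  · rintro (rfl | ⟨c, -, hc, hcs, ht, k, hk⟩)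
    · exact mem_desc_self hs
    · exact ⟨ht, k + 1, by rw [Function.iterate_succ_apply', hk, hcs]⟩

theorem parent_notMem_desc {s : ℕ} (h : IsTree m par) (hs : s < m) : par s ∉ Desc m par s := by
  obtain ⟨depth, hd⟩ := h.exists_depth
  rintro ⟨ht, k, hk⟩
  have := h.iterate_depth hd hs k _ ht.le hk
  have := hd s hs
  omega

/-- Siblings have equal depth, so a common descendant would reach both after the same number of
steps and they would coincide. -/
theorem desc_subset_compl {s c : ℕ} (h : IsTree m par) (hs : s < m) (hc : c < m) (hne : c ≠ s)
    (hpar : par c = par s) : Desc m par c ⊆ (Desc m par s)ᶜ := by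
  obtain ⟨depth, hd⟩ := h.exists_depth
  rintro t ⟨ht, k, hk⟩ ⟨-, l, hl⟩
  have h1 := h.iterate_depth hd hc k t ht.le hk
  have h2 := h.iterate_depth hd hs l t ht.le hl
  have h3 := hd s hs
  have h4 := hd c hc
  rw [hpar] at h4
  obtain rfl : k = l := by omega
  exact hne (hk.symm.trans hl)

/-- A node of maximum depth outside `P` has all its children in `P`. -/
theorem exists_ready (h : IsTree m par) (P : Set ℕ) (hP : ∃ s < m, s ∉ P) :
    ∃ s < m, s ∉ P ∧ ∀ c < m, par c = s → c ∈ P := by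
  classical
  obtain ⟨depth, hd⟩ := h.exists_depth
  obtain ⟨s, hs, hmax⟩ := ((Finset.range m).filter (· ∉ P)).exists_max_image depth
    (by obtain ⟨s, hs, hsP⟩ := hP; exact ⟨s, by simp [hs, hsP]⟩)
  simp only [Finset.mem_filter, Finset.mem_range] at hs hmax
  refine ⟨s, hs.1, hs.2, fun c hc hcs => ?_⟩
  by_contra hcP
  have h1 := hmax c ⟨hc, hcP⟩
  have h2 := hd c hc
  rw [hcs] at h2
  omega

theorem below_root (h : IsTree m par) {P : Set ℕ} (hP : ∀ c < m, c ∈ P) :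
    Below m par P m = {t | t < m} := by
  ext t
  constructor
  · rintro ⟨c, -, -, -, ht, -⟩; exact ht
  · intro ht
    have ht' : t < m := ht
    obtain ⟨k, hk⟩ := h.reaches t ht
    induction k generalizing t with
    | zero => simp only [Function.iterate_zero, id_eq] at hk; omega
    | succ k ih =>
      rw [Function.iterate_succ_apply] at hk
      rcases (h.par_le t ht).lt_or_eq with h1 | h1
      · obtain ⟨c, hcP, hc, hcm, -, j, hj⟩ := ih _ h1 h1 hk
        exact ⟨c, hcP, hc, hcm, ht, j + 1, by rwa [Function.iterate_succ_apply]⟩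
      · exact ⟨t, hP t ht, ht, h1, mem_desc_self ht⟩

theorem below_insert {P : Set ℕ} {s : ℕ} (hs : s < m) :
    Below m par (insert s P) (par s) = Below m par P (par s) ∪ Desc m par s := by
  ext t
  constructor
  · rintro ⟨c, rfl | hc, h1, h2, h3⟩
    · exact .inr h3
    · exact .inl ⟨c, hc, h1, h2, h3⟩
  · rintro (⟨c, hc, h⟩ | ht)
    · exact ⟨c, .inr hc, h⟩
    · exact ⟨s, .inl rfl, hs, rfl, ht⟩

theorem below_insert_of_ne {P : Set ℕ} {s t : ℕ} (ht : par s ≠ t) :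
    Below m par (insert s P) t = Below m par P t := by
  ext d
  constructor
  · rintro ⟨c, rfl | hc, h1, h2, h3⟩
    · exact absurd h2 ht
    · exact ⟨c, hc, h1, h2, h3⟩
  · rintro ⟨c, hc, h⟩
    exact ⟨c, .inr hc, h⟩

theorem below_subset_compl (h : IsTree m par) {P : Set ℕ} {s : ℕ} (hs : s < m) (hsP : s ∉ P) :
    Below m par P (par s) ⊆ (Desc m par s)ᶜ := by
  rintro t ⟨c, hc, hcm, hcp, ht⟩
  exact desc_subset_compl h hs hcm (fun hcs => hsP (hcs ▸ hc)) hcp ht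

end NatTree

/-! ### From graphs and tree decompositions to natural numbers -/

namespace NonMonotone

open NatTree

variable {n m : ℕ}

/-- Adjacency, for natural numbers. -/
def natAdj (G : SimpleGraph (Fin n)) (u v : ℕ) : Prop :=
  ∃ (hu : u < n) (hv : v < n), G.Adj ⟨u, hu⟩ ⟨v, hv⟩

/-- Membership in bags, for natural numbers. -/
def natBag (X : Fin m → Finset (Fin n)) (t u : ℕ) : Prop :=
  ∃ (ht : t < m) (hu : u < n), ⟨u, hu⟩ ∈ X ⟨t, ht⟩

/-- Membership in a set of vertices, for natural numbers. -/
def natMem (Y : Finset (Fin n)) (u : ℕ) : Prop := ∃ hu : u < n, ⟨u, hu⟩ ∈ Y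

/-- The parent function, with the additional node `m` as the parent of the root. -/
def natParent (T : ParentTree (Fin m)) (s : ℕ) : ℕ :=
  if h : s < m then if s = T.root then m else T.parent ⟨s, h⟩ else m

theorem natAdj_symm (G : SimpleGraph (Fin n)) (u v : ℕ) (h : natAdj G u v) : natAdj G v u := by
  obtain ⟨hu, hv, h⟩ := h
  exact ⟨hv, hu, h.symm⟩

theorem isTree_natParent (T : ParentTree (Fin m)) : IsTree m (natParent T) := by
  have hroot : natParent T T.root = m := by simp [natParent]
  refine ⟨by simp [natParent], fun s hs => ?_, fun s hs => ?_⟩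
  · unfold natParent
    split_ifs
    · exact le_rfl
    · exact (Fin.is_lt _).le
  · obtain ⟨k, hk⟩ := T.reaches_root ⟨s, hs⟩
    induction k generalizing s with
    | zero => exact ⟨1, by simp only [Function.iterate_zero, id_eq] at hk; simpa [← hk] using hroot⟩
    | succ k ih =>
      by_cases hr : s = T.root
      · exact ⟨1, by simpa [hr] using hroot⟩
      · rw [Function.iterate_succ_apply] at hk
        obtain ⟨j, hj⟩ := ih (T.parent ⟨s, hs⟩) (Fin.is_lt _) hk
        refine ⟨j + 1, ?_⟩
        rw [Function.iterate_succ_apply, natParent, dif_pos hs, if_neg hr, hj]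

/-- The bags containing `u` form a connected subtree, and the only tree edge that leaves the
descendants of `s` joins `s` to its parent. If `s` is the root, nothing is covered from outside,
since the additional node `m` has an empty bag. -/
theorem separates_desc {G : SimpleGraph (Fin n)} {T : ParentTree (Fin m)}
    {X : Fin m → Finset (Fin n)} (hX : T.IsTreeDecomposition G X) {s : ℕ} (hs : s < m) :
    Separates (natBag X) (Desc m (natParent T) s) s (natParent T s) := by
  have hT := isTree_natParent T
  refine ⟨mem_desc_self hs, parent_notMem_desc hT hs, ?_⟩
  rintro u ⟨t, ht, htm, hu, htu⟩ ⟨t', ht', htm', _, htu'⟩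
  have hconn := (hX.subtree ⟨u, hu⟩).preconnected ⟨⟨t, htm⟩, htu⟩ ⟨⟨t', htm'⟩, htu'⟩
  obtain ⟨w⟩ := hconn
  -- Induction along the walk: the first step out of the descendants must go from a child to its
  -- parent, and that child must be `s` itself.
  suffices key : ∀ (a b : {t | (⟨u, hu⟩ : Fin n) ∈ X t}),
      (T.graph.induce {t | (⟨u, hu⟩ : Fin n) ∈ X t}).Walk a b →
      (a.1 : ℕ) ∈ Desc m (natParent T) s → (b.1 : ℕ) ∉ Desc m (natParent T) s →
      natBag X s u ∧ natBag X (natParent T s) u from key _ _ w ht ht'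
  intro a b w
  induction w with
  | nil => intro h h'; exact absurd h h'
  | @cons a b c hab _ ih =>
    intro ha hc
    by_cases hb : (b.1 : ℕ) ∈ Desc m (natParent T) s
    · exact ih hb hc
    · have hadj : T.graph.Adj a.1 b.1 := hab
      rw [ParentTree.graph, SimpleGraph.fromRel_adj] at hadj
      obtain ⟨hne, h | h⟩ := hadj
      · have hroot : a.1 ≠ T.root := by
          intro hr; rw [hr, T.parent_root] at h; exact hne (hr.trans h)
        have hpar : natParent T a.1 = b.1 := by
          rw [natParent, dif_pos a.1.2, if_neg (fun h => hroot (Fin.ext h)), ← h]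
        obtain ⟨-, k, hk⟩ := ha
        cases k with
        | zero =>
          simp only [Function.iterate_zero, id_eq] at hk
          subst hk
          rw [hpar]
          exact ⟨⟨a.1.2, hu, a.2⟩, ⟨b.1.2, hu, b.2⟩⟩
        | succ k =>
          rw [Function.iterate_succ_apply, hpar] at hk
          exact absurd ⟨b.1.2, k, hk⟩ hb
      · have hroot : b.1 ≠ T.root := by
          intro hr; rw [hr, T.parent_root] at h; exact hne (h.symm.trans hr.symm)
        have hpar : natParent T b.1 = a.1 := by
          rw [natParent, dif_pos b.1.2, if_neg (fun h => hroot (Fin.ext h)), ← h]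
        obtain ⟨-, k, hk⟩ := ha
        exact absurd ⟨b.1.2, k + 1, by rw [Function.iterate_succ_apply, hpar, hk]⟩ hb

/-- The maximum order of a bag. -/
def maxBag (X : Fin m → Finset (Fin n)) : ℕ := Finset.univ.sup fun t => (X t).card

open Classical in
-- This is where niceness enters: for every tree edge one of the two bags contains the other, so
-- their union is a bag. Without it the union could have up to twice the size of a bag.
theorem card_union_le_maxBag {T : ParentTree (Fin m)} {X : Fin m → Finset (Fin n)}
    (hX : T.IsNice X) {s : ℕ} (hs : s < m) :
    ((Finset.range n).filter fun u => natBag X s u ∨ natBag X (natParent T s) u).card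
      ≤ maxBag X := by
  suffices h : ∃ t : Fin m, ∀ u, natBag X s u ∨ natBag X (natParent T s) u → natBag X t u by
    obtain ⟨t, ht⟩ := h
    refine le_trans ?_ (Finset.le_sup (f := fun t => (X t).card) (Finset.mem_univ t))
    rw [← Finset.card_map (Fin.valEmbedding : Fin n ↪ ℕ)]
    refine Finset.card_le_card fun u hu => ?_
    obtain ⟨_, hun, htu⟩ := ht u (Finset.mem_filter.1 hu).2
    exact Finset.mem_map.2 ⟨⟨u, hun⟩, htu, rfl⟩
  by_cases hr : s = T.root
  · refine ⟨⟨s, hs⟩, fun u hu => hu.resolve_right ?_⟩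
    rintro ⟨h, -⟩
    simp [natParent, hr] at h
  · have hpar : natParent T s = T.parent ⟨s, hs⟩ := by rw [natParent, dif_pos hs, if_neg hr]
    rw [hpar]
    set s' : Fin m := ⟨s, hs⟩ with hs'
    set p := T.parent s' with hp
    have hmem : s' ∈ T.children p := by
      simp only [ParentTree.children, Finset.mem_filter, Finset.mem_univ, true_and]
      exact ⟨fun h => hr (by rw [← h]), rfl⟩
    have hsub : X s' ⊆ X p ∨ X p ⊆ X s' := by
      rcases hX p with ⟨h, -⟩ | ⟨t', t'', -, h, h1, h2⟩ | ⟨t', h, -, h1⟩ | ⟨t', h, -, h1⟩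
      · rw [h] at hmem; simp at hmem
      · rw [h] at hmem
        simp only [Finset.mem_insert, Finset.mem_singleton] at hmem
        rcases hmem with h' | h' <;> rw [h']
        · exact .inl h1.ge
        · exact .inl h2.ge
      · rw [h, Finset.mem_singleton] at hmem
        rw [hmem]
        exact .inl (Finset.sdiff_eq_empty_iff_subset.1 (Finset.card_eq_zero.1 h1))
      · rw [h, Finset.mem_singleton] at hmem
        rw [hmem]
        exact .inr (Finset.sdiff_eq_empty_iff_subset.1 (Finset.card_eq_zero.1 h1))
    rcases hsub with h | h
    · refine ⟨p, fun u hu => hu.elim ?_ id⟩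
      rintro ⟨_, hun, hu⟩
      exact ⟨p.2, hun, h hu⟩
    · refine ⟨s', fun u hu => hu.elim id ?_⟩
      rintro ⟨_, hun, hu⟩
      exact ⟨hs, hun, h hu⟩

theorem natBag_edge {G : SimpleGraph (Fin n)} {T : ParentTree (Fin m)}
    {X : Fin m → Finset (Fin n)} (hX : T.IsTreeDecomposition G X) (u v : ℕ) (h : natAdj G u v) :
    ∃ t, natBag X t u ∧ natBag X t v := by
  obtain ⟨hu, hv, h⟩ := h
  obtain ⟨t, htu, htv⟩ := hX.edge _ _ h
  exact ⟨t, ⟨t.2, hu, htu⟩, ⟨t.2, hv, htv⟩⟩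

theorem natBag_covers {G : SimpleGraph (Fin n)} {T : ParentTree (Fin m)}
    {X : Fin m → Finset (Fin n)} (hX : T.IsTreeDecomposition G X) {u : ℕ} (hu : u < n) :
    Covers (natBag X) {t | t < m} u := by
  obtain ⟨⟨t, ht⟩⟩ := (hX.subtree ⟨u, hu⟩).nonempty
  exact ⟨t, t.2, t.2, hu, ht⟩

/-- The node `m` has an empty bag, so every vertex is covered and forgotten there, and the count is
the full cardinality. -/
theorem forgotten_natMem {G : SimpleGraph (Fin n)} {T : ParentTree (Fin m)} {X : Fin m → Finset (Fin n)}
    (hX : T.IsTreeDecomposition G X) (Y : Finset (Fin n)) :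
    forgotten (natBag X) n {t | t < m} m (natMem Y) = Y.card := by
  classical
  rw [← Finset.card_map (Fin.valEmbedding : Fin n ↪ ℕ), forgotten]
  congr 1
  ext u
  simp only [Finset.mem_map, Finset.mem_filter, Finset.mem_range]
  constructor
  · rintro ⟨hu, -, -, _, hY⟩
    exact ⟨⟨u, hu⟩, hY, rfl⟩
  · rintro ⟨v, hv, rfl⟩
    exact ⟨v.2, natBag_covers hX v.2, fun h => lt_irrefl _ h.1, v.2, hv⟩

/-! ### Translation between target sets and global solutions. -/

variable {G : SimpleGraph (Fin n)} [DecidableRel G.Adj] {τ : Fin n → ℕ}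

open WordRAM in
-- A threshold of at least 2 must be the degree, and that many active neighbors means all of them.
-- Thresholds that equal a degree of 0 or 1 fall under the first two cases of `Rule`.
theorem natMem_activation_succ (h1 : ∀ u, τ u = 0 ∨ τ u = 1 ∨ τ u = G.degree u)
    (Y : Finset (Fin n)) (t : ℕ) (u : ℕ) (hu : u < n) :
    natMem (activation G τ Y (t + 1)) u ↔
      Rule (natAdj G) (vecArray τ) (natMem (activation G τ Y t)) u := by
  set A := activation G τ Y t with hA
  have hτ : vecArray τ u = τ ⟨u, hu⟩ := by simp [vecArray, hu]
  have hl : natMem (activation G τ Y (t + 1)) u ↔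
      τ ⟨u, hu⟩ ≤ (G.neighborFinset ⟨u, hu⟩ ∩ A).card := by
    simp [natMem, activation, hu, ← hA]
  rw [hl, Rule, hτ]
  set k := τ ⟨u, hu⟩ with hk
  rcases Nat.lt_or_ge k 2 with h2 | h2
  · rcases Nat.lt_or_ge k 1 with h0 | h0
    · simp [show k = 0 by omega]
    · have hk1 : k = 1 := by omega
      simp only [hk1, one_ne_zero, false_or, true_and, Nat.not_ofNat_le_one, false_and, or_false]
      rw [Nat.one_le_iff_ne_zero, ← Nat.pos_iff_ne_zero, Finset.card_pos]
      constructor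
      · rintro ⟨w, hw⟩
        rw [Finset.mem_inter, SimpleGraph.mem_neighborFinset] at hw
        exact ⟨w, ⟨hu, w.2, hw.1⟩, w.2, hw.2⟩
      · rintro ⟨w, ⟨_, hw, h⟩, _, hwA⟩
        exact ⟨⟨w, hw⟩, by rw [Finset.mem_inter, SimpleGraph.mem_neighborFinset]; exact ⟨h, hwA⟩⟩
  · have hdeg : k = G.degree ⟨u, hu⟩ := by
      rcases h1 ⟨u, hu⟩ with h | h | h
      · omega
      · omega
      · exact h
    have : (k ≤ (G.neighborFinset ⟨u, hu⟩ ∩ A).card) ↔ G.neighborFinset ⟨u, hu⟩ ⊆ A := by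
      rw [hdeg, ← SimpleGraph.card_neighborFinset_eq_degree]
      constructor
      · intro h
        exact Finset.inter_eq_left.1 (Finset.eq_of_subset_of_card_le Finset.inter_subset_left h)
      · intro h; rw [Finset.inter_eq_left.2 h]
    rw [this]
    constructor
    · intro h
      refine .inr (.inr ⟨h2, ?_⟩)
      rintro w ⟨_, hw, hadj⟩
      exact ⟨hw, h (by simpa using hadj)⟩
    · rintro (h | ⟨h, -⟩ | ⟨-, h⟩)
      · omega
      · omega
      · intro w hw
        obtain ⟨_, h'⟩ := h w ⟨hu, w.2, by simpa using hw⟩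
        exact h'

theorem isTargetSet_iff (Y : Finset (Fin n)) :
    IsTargetSet G τ Y ↔ ∃ t₀, ∀ t ≥ t₀, ∀ u < n, natMem (activation G τ Y t) u := by
  unfold IsTargetSet
  refine exists_congr fun t₀ => forall₂_congr fun t _ => ?_
  rw [Finset.eq_univ_iff_forall]
  exact ⟨fun h u hu => ⟨hu, h _⟩, fun h u => (h u u.2).2⟩

open WordRAM in
theorem vecArray_ne_zero {τ : Fin n → ℕ} (u : ℕ) (h : vecArray τ u ≠ 0) : u < n := by
  by_contra hu; simp [vecArray, hu] at h

open WordRAM in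
-- Here `g` is defined as the exact neighborhood condition. A witness is an edge, and every edge
-- lies in some bag, so witnesses become visible to `Hit`.
theorem IsTargetSet.isSol {T : ParentTree (Fin m)} {X : Fin m → Finset (Fin n)}
    (hX : T.IsTreeDecomposition G X) (h1 : ∀ u, τ u = 0 ∨ τ u = 1 ∨ τ u = G.degree u)
    {Y : Finset (Fin n)} (hY : IsTargetSet G τ Y) :
    IsSol (natAdj G) (vecArray τ) (natBag X) (natMem Y)
      fun w => ∀ v, natAdj G w v → natMem Y v := by
  rw [isTargetSet_iff] at hY
  have hact := natMem_activation_succ h1 Y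
  refine ⟨fun t u v hu hv huv => ⟨fun _ h => h v huv, fun h2 h3 w hw => ?_⟩, fun a ha => ?_⟩
  · exact neighbor_mem_of_target (natAdj_symm G) (fun u v h => h.1) hact hY huv h2 h3 hw
  · obtain ⟨b, hab, w, hw⟩ := exists_witness_of_target (natAdj_symm G) hact
      vecArray_ne_zero ha hY
    obtain ⟨t, htb, htw⟩ := natBag_edge hX _ _ hw.1
    exact ⟨b, hab, t, trivial, htb, w, htw, hw⟩

open WordRAM in
-- Conversely `g` is only a certificate: every edge lies in a bag, so validity of all bags shows
-- that `g` implies the neighborhood condition at vertices of threshold different from 1, the only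
-- ones where it is used.
theorem IsSol.isTargetSet {T : ParentTree (Fin m)} {X : Fin m → Finset (Fin n)}
    (hX : T.IsTreeDecomposition G X) (h1 : ∀ u, τ u = 0 ∨ τ u = 1 ∨ τ u = G.degree u)
    {x g : ℕ → Prop} (h : IsSol (natAdj G) (vecArray τ) (natBag X) x g) {Y : Finset (Fin n)}
    (hY : ∀ u, natMem Y u ↔ u < n ∧ x u) : IsTargetSet G τ Y := by
  rw [isTargetSet_iff]
  have hg : ∀ u v, natAdj G u v → vecArray τ u ≠ 1 → g u → natMem Y v := by
    intro u v huv h1 hgu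
    obtain ⟨t, htu, htv⟩ := natBag_edge hX _ _ huv
    exact (hY v).2 ⟨huv.2.1, (h.valid t u v htu htv huv).1 h1 hgu⟩
  refine target_of_witness (natAdj_symm G) (fun u v h => h.1) (natMem_activation_succ h1 Y) ?_ ?_
  · intro u v w huv hu hv hw
    obtain ⟨t, htu, htv⟩ := natBag_edge hX _ _ huv
    exact hg u w hw (by omega) ((h.valid t u v htu htv huv).2 hu hv)
  · intro a ha
    obtain ⟨b, hab, t, -, htb, w, htw, hw⟩ := h.hit a ha
    refine ⟨b, hab, w, hw.congr (fun hx => (hY w).2 ⟨hw.1.2.1, hx⟩) fun h1 hgw v hv => hg w v hv h1 hgw⟩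

open WordRAM in
-- Since the bag of `m` is empty, no component meets it, so the clause on forgotten components
-- covers all required components.
theorem exists_targetSet_of_partialSol {T : ParentTree (Fin m)} {X : Fin m → Finset (Fin n)}
    (hX : T.IsTreeDecomposition G X) (h1 : ∀ u, τ u = 0 ∨ τ u = 1 ∨ τ u = G.degree u)
    {d : ℕ → ℕ} {c : ℕ}
    (h : PartialSol (natAdj G) (vecArray τ) (natBag X) n {t | t < m} m d c) :
    ∃ Y, IsTargetSet G τ Y ∧ Y.card = c := by
  classical
  obtain ⟨x, g, hv, -, -, -, hr, rfl⟩ := h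
  have hm : ∀ u, ¬ natBag X m u := fun u hu => lt_irrefl _ hu.1
  have hsol : IsSol (natAdj G) (vecArray τ) (natBag X) x g := by
    refine ⟨fun t u v hu => hv t hu.1 u v hu, fun a ha => ?_⟩
    have han : a / 2 < n := vecArray_ne_zero _ (by rw [ha.1]; exact one_ne_zero)
    exact (hr a ha ⟨a, .refl, natBag_covers hX han⟩ fun b _ => hm _).congr
      (Set.subset_univ _) (fun _ _ _ _ => id) fun _ _ _ _ _ => id
  refine ⟨Finset.univ.filter fun u => x u, hsol.isTargetSet hX h1 fun u => ?_, ?_⟩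
  · simp [natMem]
  · rw [← Finset.card_map (Fin.valEmbedding : Fin n ↪ ℕ), forgotten]
    congr 1
    ext u
    simp only [Finset.mem_map, Finset.mem_filter, Finset.mem_univ, true_and, Finset.mem_range]
    constructor
    · rintro ⟨v, hv, rfl⟩
      exact ⟨v.2, natBag_covers hX v.2, hm _, hv⟩
    · rintro ⟨hu, -, -, hx⟩
      exact ⟨⟨u, hu⟩, hx, rfl⟩

end NonMonotone

namespace WordRAM

/-! ### Logical operations on terms -/

namespace Tm

/-- The term is true, that is, its value is not `0`. -/
def Holds (s : State) (e : Tm) : Prop := e.eval s ≠ 0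

/-- Negation. -/
def not (e : Tm) : Tm := .sub (.lit 1) e

/-- Conjunction. -/
def and (e f : Tm) : Tm := .mul e f

/-- Disjunction. -/
def or (e f : Tm) : Tm := .add e f

/-- Comparison. -/
def le (e f : Tm) : Tm := not (.sub e f)

/-- Equality. -/
def eq (e f : Tm) : Tm := and (le e f) (le f e)

/-- The truth value. -/
def ind (e : Tm) : Tm := not (not e)

/-- The remainder. -/
def mod (e f : Tm) : Tm := .sub e (.mul (.div e f) f)

/-- There is a value of the register `x` below the content of the register `y` such that `e` holds. -/
def ex (x y : ℕ) (e : Tm) : Tm := .sum x y e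

variable {s : State} {e f : Tm}

/-- Truth is being nonzero, and truncated subtraction from 1 is nonzero only for 0. Products, sums
and bounded sums then serve as conjunction, disjunction and bounded search. -/
theorem holds_not : (not e).Holds s ↔ ¬ e.Holds s := by
  simp only [Holds, not, eval]; omega

theorem holds_and : (and e f).Holds s ↔ e.Holds s ∧ f.Holds s := by
  simp [Holds, and, eval]

theorem holds_or : (or e f).Holds s ↔ e.Holds s ∨ f.Holds s := by
  simp only [Holds, or, eval]; omega

theorem holds_le : (le e f).Holds s ↔ e.eval s ≤ f.eval s := by
  rw [le, holds_not]; simp only [Holds, eval]; omega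

theorem holds_eq : (eq e f).Holds s ↔ e.eval s = f.eval s := by
  rw [eq, holds_and, holds_le, holds_le, le_antisymm_iff]

open Classical in
theorem eval_ind : (ind e).eval s = if e.Holds s then 1 else 0 := by
  by_cases h : e.Holds s
  · rw [if_pos h]; simp only [ind, not, eval, Holds] at h ⊢; omega
  · rw [if_neg h]; simp only [ind, not, eval, Holds] at h ⊢; omega

theorem eval_mod : (mod e f).eval s = e.eval s % f.eval s := by
  simp only [mod, eval]
  have := Nat.div_add_mod (e.eval s) (f.eval s)
  rw [mul_comm] at this
  omega

theorem holds_ex {x y : ℕ} : (ex x y e).Holds s ↔ ∃ i < s.reg y, e.Holds (s.setReg x i) := by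
  simp only [Holds, ex, eval, ne_eq, Finset.sum_eq_zero_iff, Finset.mem_range, not_forall]
  simp

theorem holds_load {a : ℕ} : (load a e).Holds s ↔ s.mem a (e.eval s) ≠ 0 := Iff.rfl

end Tm

/-! ### The terms of the program

The registers `0`, …, `4` hold `n`, `2 * n`, `n + 1`, `m` and the root. The arrays `0`, …, `3` hold the
input, and the array `4` holds the relation `Linked`. During the combination of a node with its
parent, the registers `6`, `7` hold the node and its parent, the registers `15`, `16`, `17` hold the
code of a joint label and two numbers of vertices, the arrays `8`, `9`, `10` hold place values, the
array `7` holds for every node the number of its current table, and the array `11` holds the tables.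
The registers from `20` on are summation variables. -/

namespace Tm

/-- Adjacency. -/
def adj (u v : Tm) : Tm := load 0 (add (mul u (reg 0)) v)

/-- The threshold. -/
def tau (u : Tm) : Tm := load 1 u

/-- The vertex `u` is in the bag of `t`. -/
def bag (t u : Tm) : Tm := load 3 (add (mul t (reg 0)) u)

/-- Elements of the double cover are linked. -/
def link (a b : Tm) : Tm := load 4 (add (mul a (reg 1)) b)

/-- The vertex of an element of the double cover. -/
def half (a : Tm) : Tm := div a (lit 2)

/-- The parity of an element of the double cover. -/
def parity (a : Tm) : Tm := mod a (lit 2)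

/-- The bit of `d` with value `q`. -/
def bit (d q : Tm) : Tm := mod (div d q) (lit 2)

/-- The joint label of `u`. -/
def joint (u : Tm) : Tm :=
  mod (div (reg 15) (load 8 u)) (add (lit 1) (mul (lit 31) (ind (or (bag (reg 6) u) (bag (reg 7) u)))))

/-- The label of `u` at the parent. -/
def parentLabel (u : Tm) : Tm := mod (joint u) (lit 8)

/-- The label of `u` at the child. -/
def childLabel (u : Tm) : Tm := add (mod (joint u) (lit 2)) (mul (lit 2) (div (joint u) (lit 8)))

/-- The neighbor `w` causes the activity of `b`. -/
def wit (b w : Tm) : Tm :=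
  and (adj (half b) w) (or (and (parity b) (bit (joint w) (lit 1)))
    (and (not (parity b)) (and (not (eq (tau w) (lit 1))) (bit (childLabel w) (lit 2)))))

/-- The value of the bit that belongs to the parity of `b`. -/
def hitBit (b : Tm) : Tm := mul (lit 2) (add (lit 1) (parity b))

/-- The component of `a` has an activity. -/
def newHit (a : Tm) : Tm :=
  ex 28 1 (and (link a (reg 28))
    (or (and (bag (reg 7) (half (reg 28))) (bit (parentLabel (half (reg 28))) (hitBit (reg 28))))
      (and (bag (reg 6) (half (reg 28))) (or (bit (childLabel (half (reg 28))) (hitBit (reg 28)))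
        (ex 29 0 (and (bag (reg 6) (reg 29)) (wit (reg 28) (reg 29))))))))

/-- The component of `a` needs an activity. -/
def required (a : Tm) : Tm :=
  and (eq (tau (half a)) (lit 1)) (not (ex 30 1 (and (link a (reg 30))
    (ex 31 0 (and (adj (half (reg 30)) (reg 31)) (eq (tau (reg 31)) (lit 0)))))))

/-- The local conditions in the bag of the child are violated. -/
def invalid : Tm :=
  ex 20 0 (ex 21 0 (and (and (bag (reg 6) (reg 20)) (and (bag (reg 6) (reg 21)) (adj (reg 20) (reg 21))))
    (or (and (not (eq (tau (reg 20)) (lit 1))) (and (bit (childLabel (reg 20)) (lit 2))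
        (not (bit (joint (reg 21)) (lit 1)))))
      (and (le (lit 2) (tau (reg 20))) (and (le (lit 2) (tau (reg 21)))
        (not (bit (childLabel (reg 20)) (lit 2))))))))

/-- The labels at the parent and at the child do not fit to each other. -/
def disagree : Tm :=
  ex 20 0 (and (and (bag (reg 7) (reg 20)) (and (bag (reg 6) (reg 20)) (not (eq (tau (reg 20)) (lit 1)))))
    (or (and (bit (parentLabel (reg 20)) (lit 2)) (not (bit (childLabel (reg 20)) (lit 2))))
      (and (not (bit (parentLabel (reg 20)) (lit 2))) (bit (childLabel (reg 20)) (lit 2)))))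

/-- Some component that needs an activity is forgotten without an activity. -/
def missing : Tm :=
  ex 20 1 (and (and (bag (reg 6) (half (reg 20))) (required (reg 20))) (and (not (newHit (reg 20)))
    (not (ex 21 1 (and (link (reg 20) (reg 21)) (bag (reg 7) (half (reg 21))))))))

/-- The new label of `u`. -/
def label (u : Tm) : Tm :=
  add (add (ind (bit (joint u) (lit 1)))
    (mul (lit 2) (ind (or (and (eq (tau u) (lit 1)) (newHit (mul (lit 2) u)))
      (and (not (eq (tau u) (lit 1))) (bit (parentLabel u) (lit 2)))))))
    (mul (lit 4) (ind (and (eq (tau u) (lit 1)) (newHit (add (mul (lit 2) u) (lit 1))))))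

/-- The code of labels `d` of the bag of `t`, where the array `q` holds the place values. -/
def codeOf (t : Tm) (q : ℕ) (d : Tm → Tm) : Tm :=
  sum 22 0 (mul (mul (ind (bag t (reg 22))) (d (reg 22))) (load q (reg 22)))

/-- The number of elements that are forgotten. -/
def forget : Tm :=
  sum 22 0 (ind (and (bag (reg 6) (reg 22)) (and (not (bag (reg 7) (reg 22)))
    (bit (joint (reg 22)) (lit 1)))))

/-- The index of a cell in the array of tables. -/
def cell (v i c : Tm) : Tm := add (mul (add (mul i (reg 2)) c) (add (reg 3) (lit 1))) v

/-- Some component has an activity according to the label `d` of the bag of `t`. -/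
def someHit (t : Tm) (d : Tm → Tm) : Tm :=
  ex 22 0 (and (bag t (reg 22)) (and (eq (tau (reg 22)) (lit 1))
    (or (bit (d (reg 22)) (lit 2)) (bit (d (reg 22)) (lit 4)))))

/-- The current table of `t` has the entry with label `d` and number `c`. -/
def entry (t : Tm) (q : ℕ) (d : Tm → Tm) (c : Tm) : Tm :=
  or (and (eq (load 7 t) (lit 0)) (and (eq c (lit 0)) (not (someHit t d))))
    (and (load 7 t) (load 11 (cell (load 7 t) (codeOf t q d) c)))

/-- The number of forgotten elements after the combination. -/
def newCount : Tm := add (add (reg 16) (reg 17)) forget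

/-- The combination of two entries is possible. -/
def mergeCond : Tm :=
  and (and (entry (reg 7) 10 parentLabel (reg 16)) (entry (reg 6) 9 childLabel (reg 17)))
    (and (and (not invalid) (and (not disagree) (not missing))) (le newCount (reg 0)))

/-- The cell of the combination of two entries. -/
def mergeCell : Tm := cell (add (reg 6) (lit 1)) (codeOf (reg 7) 10 label) newCount

end Tm

/-- The largest terms are checked by computation; the bounds of 40 registers and weight 3000 are
chosen large enough for them. -/
theorem mergeCond_adm : Tm.mergeCond.Adm := by decide +kernel

theorem mergeCell_adm : Tm.mergeCell.Adm := by decide +kernel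

/-! ### The meaning of the program terms during a combination. -/

open NonMonotone MixedRadix

section Semantics

variable (Adj : ℕ → ℕ → Prop) (τ : ℕ → ℕ) (X : ℕ → ℕ → Prop) (n m : ℕ)

/-- The vertices of edges and bags are less than `n`. -/
structure Ranges : Prop where
  adj_lt : ∀ u v, Adj u v → u < n ∧ v < n
  bag_lt : ∀ t u, X t u → u < n

/-- The registers and arrays that describe the input. -/
structure Inp (a : State) : Prop where
  r0 : a.reg 0 = n
  r1 : a.reg 1 = 2 * n
  r2 : a.reg 2 = n + 1
  r3 : a.reg 3 = m
  adj : ∀ u < n, ∀ v < n, a.mem 0 (u * n + v) ≠ 0 ↔ Adj u v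
  tau : ∀ u < n, a.mem 1 u = τ u
  bag : ∀ t ≤ m, ∀ u < n, a.mem 3 (t * n + u) ≠ 0 ↔ X t u

/-- The array `4` holds the relation `Linked`. -/
def HasLink (a : State) : Prop :=
  ∀ b < 2 * n, ∀ c < 2 * n, a.mem 4 (b * (2 * n) + c) ≠ 0 ↔ Linked Adj τ b c

/-- The joint label with the code `z`. -/
noncomputable def jointLabel (s p z : ℕ) (u : ℕ) : ℕ :=
  digit (base 32 fun u => X s u ∨ X p u) z u

/-- The registers and arrays during the combination of `s` with its parent `p`. -/
structure MergeEnv (s p z : ℕ) (a : State) : Prop where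
  inp : Inp Adj τ X n m a
  link : HasLink Adj τ n a
  s_le : s ≤ m
  p_le : p ≤ m
  r6 : a.reg 6 = s
  r7 : a.reg 7 = p
  r15 : a.reg 15 = z
  place8 : ∀ u < n, a.mem 8 u = place (base 32 fun u => X s u ∨ X p u) u
  place9 : ∀ u < n, a.mem 9 u = place (base 8 (X s)) u
  place10 : ∀ u < n, a.mem 10 u = place (base 8 (X p)) u

/-- The index of a cell in the array of tables. -/
def cellIdx (v i c : ℕ) : ℕ := (i * (n + 1) + c) * (m + 1) + v

/-- The table number `v` for the bag `B` has the entry with label `d` and number `c`. -/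
def Entry (a : State) (v : ℕ) (B : ℕ → Prop) (d : ℕ → ℕ) (c : ℕ) : Prop :=
  (v = 0 ∧ c = 0 ∧ ∀ u, B u → τ u = 1 → ¬ Bit (d u) 1 ∧ ¬ Bit (d u) 2) ∨
    (v ≠ 0 ∧ a.mem 11 (cellIdx n m v (code n 8 B d) c) ≠ 0)

variable {Adj τ X n m}

theorem Linked.half_lt (hr : Ranges Adj X n) {a b : ℕ} (h : Linked Adj τ a b) (ha : a / 2 < n) :
    b / 2 < n := by
  induction h with
  | refl => exact ha
  | tail _ h _ => exact (hr.adj_lt _ _ h.1).2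

theorem MergeEnv.congr {s p z : ℕ} {a a' : State} (h : MergeEnv Adj τ X n m s p z a)
    (ha : Agree 20 a a') : MergeEnv Adj τ X n m s p z a' := by
  obtain ⟨⟨h0, h1, h2, h3, h4, h5, h6⟩, hl, hs, hp, h7, h8, h9, h10, h11, h12⟩ := h
  refine ⟨⟨?_, ?_, ?_, ?_, ?_, ?_, ?_⟩, ?_, hs, hp, ?_, ?_, ?_, ?_, ?_, ?_⟩
  · rw [ha.2 _ (by omega), h0]
  · rw [ha.2 _ (by omega), h1]
  · rw [ha.2 _ (by omega), h2]
  · rw [ha.2 _ (by omega), h3]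
  · rwa [ha.1]
  · rwa [ha.1]
  · rwa [ha.1]
  · unfold HasLink; rwa [ha.1]
  · rw [ha.2 _ (by omega), h7]
  · rw [ha.2 _ (by omega), h8]
  · rw [ha.2 _ (by omega), h9]
  · rwa [ha.1]
  · rwa [ha.1]
  · rwa [ha.1]

/-- Summation variables start at register 20, so the environment persists below the binders of a
term. -/
theorem MergeEnv.setReg {s p z : ℕ} {a : State} (h : MergeEnv Adj τ X n m s p z a) {x : ℕ}
    (hx : 20 ≤ x) (v : ℕ) : MergeEnv Adj τ X n m s p z (a.setReg x v) :=
  h.congr ((Agree.refl 20 a).setReg_right hx v)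

namespace MergeEnv

variable {s p z i j : ℕ} {a : State} {u v : Tm}

theorem holds_adj (h : MergeEnv Adj τ X n m s p z a) (hu : u.eval a = i) (hv : v.eval a = j)
    (hi : i < n) (hj : j < n) : (Tm.adj u v).Holds a ↔ Adj i j := by
  rw [Tm.adj, Tm.holds_load]; simp only [Tm.eval, hu, hv, h.inp.r0]; exact h.inp.adj i hi j hj

theorem eval_tau (h : MergeEnv Adj τ X n m s p z a) (hu : u.eval a = i) (hi : i < n) :
    (Tm.tau u).eval a = τ i := by
  simp only [Tm.tau, Tm.eval, hu]; exact h.inp.tau i hi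

theorem holds_bag (h : MergeEnv Adj τ X n m s p z a) (hu : u.eval a = i) (hv : v.eval a = j)
    (hi : i ≤ m) (hj : j < n) : (Tm.bag u v).Holds a ↔ X i j := by
  rw [Tm.bag, Tm.holds_load]; simp only [Tm.eval, hu, hv, h.inp.r0]; exact h.inp.bag i hi j hj

theorem holds_link (h : MergeEnv Adj τ X n m s p z a) (hu : u.eval a = i) (hv : v.eval a = j)
    (hi : i < 2 * n) (hj : j < 2 * n) : (Tm.link u v).Holds a ↔ Linked Adj τ i j := by
  rw [Tm.link, Tm.holds_load]; simp only [Tm.eval, hu, hv, h.inp.r1]; exact h.link i hi j hj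

theorem eval_half (hu : u.eval a = i) : (Tm.half u).eval a = i / 2 := by
  simp [Tm.half, Tm.eval, hu]

theorem holds_parity (hu : u.eval a = i) : (Tm.parity u).Holds a ↔ i % 2 = 1 := by
  simp [Tm.parity, Tm.Holds, Tm.eval_mod, hu, Tm.eval]

theorem holds_bit {q : Tm} {k : ℕ} (hu : u.eval a = i) (hq : q.eval a = 2 ^ k) :
    (Tm.bit u q).Holds a ↔ Bit i k := by
  simp [Tm.bit, Tm.Holds, Tm.eval_mod, hu, hq, Tm.eval, Bit]

theorem eval_hitBit (hu : u.eval a = i) : (Tm.hitBit u).eval a = 2 ^ (1 + i % 2) := by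
  simp only [Tm.hitBit, Tm.parity, Tm.eval_mod, hu, Tm.eval]
  rcases Nat.mod_two_eq_zero_or_one i with h | h <;> simp [h]

theorem holds_bag_child (h : MergeEnv Adj τ X n m s p z a) (hu : u.eval a = i) (hi : i < n) :
    (Tm.bag (.reg 6) u).Holds a ↔ X s i :=
  h.holds_bag (show a.reg 6 = s from h.r6) hu h.s_le hi

theorem holds_bag_parent (h : MergeEnv Adj τ X n m s p z a) (hu : u.eval a = i) (hi : i < n) :
    (Tm.bag (.reg 7) u).Holds a ↔ X p i :=
  h.holds_bag (show a.reg 7 = p from h.r7) hu h.p_le hi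

/-- The modulus `1 + 31 * ind` is the base at the place: 32 on the two bags, and 1 elsewhere, which
yields the digit 0. -/
theorem eval_joint (h : MergeEnv Adj τ X n m s p z a) (hu : u.eval a = i) (hi : i < n) :
    (Tm.joint u).eval a = jointLabel X s p z i := by
  classical
  simp only [Tm.joint, Tm.eval_mod, Tm.eval, Tm.eval_ind, Tm.holds_or, h.holds_bag_child hu hi,
    h.holds_bag_parent hu hi, hu, h.r15, h.place8 i hi, jointLabel, digit]
  congr 1
  rw [base]
  split_ifs <;> rfl

theorem eval_parentLabel (h : MergeEnv Adj τ X n m s p z a) (hu : u.eval a = i) (hi : i < n) :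
    (Tm.parentLabel u).eval a = parentPart (jointLabel X s p z) i := by
  simp only [Tm.parentLabel, Tm.eval_mod, Tm.eval, h.eval_joint hu hi, parentPart]

theorem eval_childLabel (h : MergeEnv Adj τ X n m s p z a) (hu : u.eval a = i) (hi : i < n) :
    (Tm.childLabel u).eval a = childPart (jointLabel X s p z) i := by
  simp only [Tm.childLabel, Tm.eval_mod, Tm.eval, h.eval_joint hu hi, childPart]

theorem holds_tau_eq (h : MergeEnv Adj τ X n m s p z a) (hu : u.eval a = i) (hi : i < n) (c : ℕ) :
    (Tm.eq (.tau u) (.lit c)).Holds a ↔ τ i = c := by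
  rw [Tm.holds_eq, h.eval_tau hu hi]; rfl

theorem holds_wit (h : MergeEnv Adj τ X n m s p z a) (hu : u.eval a = i) (hi : i / 2 < n)
    (hv : v.eval a = j) (hj : j < n) : (Tm.wit u v).Holds a ↔
      Witness Adj τ (fun w => Bit (jointLabel X s p z w) 0)
        (fun w => Bit (childPart (jointLabel X s p z) w) 1) i j := by
  rw [Tm.wit, Tm.holds_and, Tm.holds_or, Tm.holds_and, Tm.holds_and, Tm.holds_and, Tm.holds_not,
    Tm.holds_not, h.holds_adj (eval_half hu) hv hi hj, holds_parity hu, h.holds_tau_eq hv hj,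
    holds_bit (k := 0) (q := .lit 1) (h.eval_joint hv hj) rfl, holds_bit (k := 1) (q := .lit 2) (h.eval_childLabel hv hj) rfl,
    Witness]
  split_ifs with hpar <;> simp [hpar]

/-- Machine searches are bounded, while the mathematical conditions quantify over all numbers;
adjacency and bags force the witnesses below the bound. -/
theorem exists_lt_iff {P Q : ℕ → Prop} {N : ℕ} (h : ∀ i < N, P i ↔ Q i) (hQ : ∀ i, Q i → i < N) :
    (∃ i < N, P i) ↔ ∃ i, Q i :=
  ⟨fun ⟨i, hi, hp⟩ => ⟨i, (h i hi).1 hp⟩, fun ⟨i, hq⟩ => ⟨i, hQ i hq, (h i (hQ i hq)).2 hq⟩⟩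

/-- The argument must not depend on the variables bound inside the term, which are numbered from 28;
this is the reason for the hypothesis on `u`. The bound for the search holds because linked elements
stay below `2 * n`. -/
theorem holds_newHit (hr : Ranges Adj X n) (h : MergeEnv Adj τ X n m s p z a)
    (hu : ∀ k v, 28 ≤ k → u.eval (a.setReg k v) = i) (hi : i < 2 * n) :
    (Tm.newHit u).Holds a ↔ NewHit Adj τ X s p (jointLabel X s p z) i := by
  rw [Tm.newHit, Tm.holds_ex, NewHit, h.inp.r1]
  refine exists_lt_iff (fun b hb => ?_) fun b hb => ?_
  · have h' := h.setReg (x := 28) (by omega) b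
    have hb' : (Tm.reg 28).eval (a.setReg 28 b) = b := setReg_reg_self _ _ _
    have hb2 : b / 2 < n := by omega
    rw [Tm.holds_and, Tm.holds_or, Tm.holds_and, Tm.holds_and, Tm.holds_or,
      h'.holds_link (hu 28 b le_rfl) hb' hi hb, h'.holds_bag_parent (eval_half hb') hb2,
      h'.holds_bag_child (eval_half hb') hb2,
      holds_bit (h'.eval_parentLabel (eval_half hb') hb2) (eval_hitBit hb'),
      holds_bit (h'.eval_childLabel (eval_half hb') hb2) (eval_hitBit hb'), Tm.holds_ex, h'.inp.r0]
    have : (∃ w < n, (Tm.and (.bag (.reg 6) (.reg 29)) (.wit (.reg 28) (.reg 29))).Holds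
        ((a.setReg 28 b).setReg 29 w)) ↔ ∃ w, X s w ∧
        Witness Adj τ (fun w => Bit (jointLabel X s p z w) 0)
          (fun w => Bit (childPart (jointLabel X s p z) w) 1) b w := by
      refine exists_lt_iff (fun w hw => ?_) fun w hw => hr.bag_lt _ _ hw.1
      have h'' := h'.setReg (x := 29) (by omega) w
      have hw' : (Tm.reg 29).eval ((a.setReg 28 b).setReg 29 w) = w := setReg_reg_self _ _ _
      have hb'' : (Tm.reg 28).eval ((a.setReg 28 b).setReg 29 w) = b := by
        simp [Tm.eval, setReg_reg]
      rw [Tm.holds_and, h''.holds_bag_child hw' hw, h''.holds_wit hb'' hb2 hw' hw]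
    rw [this]
  · have := Linked.half_lt hr hb.1 (by omega)
    omega

theorem holds_required (hr : Ranges Adj X n) (h : MergeEnv Adj τ X n m s p z a)
    (hu : u.eval a = i) (hu' : ∀ v, u.eval (a.setReg 30 v) = i) (hi : i < 2 * n) :
    (Tm.required u).Holds a ↔ Required Adj τ i := by
  rw [Tm.required, Tm.holds_and, Tm.holds_not, h.holds_tau_eq (eval_half hu) (by omega),
    Tm.holds_ex, Required, h.inp.r1]
  have : (∃ b < 2 * n, (Tm.and (.link u (.reg 30)) (.ex 31 0 (.and (.adj (.half (.reg 30)) (.reg 31))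
      (.eq (.tau (.reg 31)) (.lit 0))))).Holds (a.setReg 30 b)) ↔
      ∃ b, Linked Adj τ i b ∧ ∃ w, Adj (b / 2) w ∧ τ w = 0 := by
    refine exists_lt_iff (fun b hb => ?_) fun b hb => ?_
    · have h' := h.setReg (x := 30) (by omega) b
      have hb' : (Tm.reg 30).eval (a.setReg 30 b) = b := setReg_reg_self _ _ _
      rw [Tm.holds_and, h'.holds_link (hu' b) hb' hi hb, Tm.holds_ex, h'.inp.r0]
      refine and_congr_right fun _ => exists_lt_iff (fun w hw => ?_) fun w hw => (hr.adj_lt _ _ hw.1).2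
      have h'' := h'.setReg (x := 31) (by omega) w
      have hw' : (Tm.reg 31).eval ((a.setReg 30 b).setReg 31 w) = w := setReg_reg_self _ _ _
      have hb'' : (Tm.reg 30).eval ((a.setReg 30 b).setReg 31 w) = b := by
        simp [Tm.eval, setReg_reg]
      rw [Tm.holds_and, h''.holds_adj (eval_half hb'') hw' (by omega) hw, h''.holds_tau_eq hw' hw]
    · have := Linked.half_lt hr hb.1 (by omega)
      omega
  rw [this]
  push Not
  rfl

theorem holds_invalid (hr : Ranges Adj X n) (h : MergeEnv Adj τ X n m s p z a) :
    ¬ Tm.invalid.Holds a ↔ Valid Adj τ X s (fun w => Bit (jointLabel X s p z w) 0)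
      (fun w => Bit (childPart (jointLabel X s p z) w) 1) := by
  rw [Tm.invalid, Tm.holds_ex, h.inp.r0]
  refine (not_congr (exists_lt_iff (Q := fun u => ∃ v, (X s u ∧ X s v ∧ Adj u v) ∧
      ((τ u ≠ 1 ∧ Bit (childPart (jointLabel X s p z) u) 1 ∧ ¬ Bit (jointLabel X s p z v) 0) ∨
      (2 ≤ τ u ∧ 2 ≤ τ v ∧ ¬ Bit (childPart (jointLabel X s p z) u) 1)))
    (fun u hu => by
      have h' := h.setReg (x := 20) (by omega) u
      rw [Tm.holds_ex, h'.inp.r0]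
      refine exists_lt_iff (fun v hv => ?_) fun v hv => hr.bag_lt _ _ hv.1.2.1
      have h'' := h'.setReg (x := 21) (by omega) v
      have hv' : (Tm.reg 21).eval ((a.setReg 20 u).setReg 21 v) = v := setReg_reg_self _ _ _
      have hu' : (Tm.reg 20).eval ((a.setReg 20 u).setReg 21 v) = u := by
        simp [Tm.eval, setReg_reg]
      simp only [Tm.holds_and, Tm.holds_or, Tm.holds_not, h''.holds_bag_child hu' hu,
        h''.holds_bag_child hv' hv, h''.holds_adj hu' hv' hu hv, h''.holds_tau_eq hu' hu,
        Tm.holds_le, h''.eval_tau hu' hu, h''.eval_tau hv' hv,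
        holds_bit (k := 0) (q := .lit 1) (h''.eval_joint hv' hv) rfl,
        holds_bit (k := 1) (q := .lit 2) (h''.eval_childLabel hu' hu) rfl, Tm.eval,
        Ne])
    fun u ⟨v, hv⟩ => hr.bag_lt _ _ hv.1.1)).trans ?_
  unfold Valid
  push Not
  refine forall₂_congr fun u v => ?_
  tauto

theorem holds_disagree (hr : Ranges Adj X n) (h : MergeEnv Adj τ X n m s p z a) :
    ¬ Tm.disagree.Holds a ↔ ∀ u, X p u → X s u → τ u ≠ 1 →
      (Bit (parentPart (jointLabel X s p z) u) 1 ↔ Bit (childPart (jointLabel X s p z) u) 1) := by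
  rw [Tm.disagree, Tm.holds_ex, h.inp.r0]
  refine (not_congr (exists_lt_iff (Q := fun u => (X p u ∧ X s u ∧ τ u ≠ 1) ∧
      ((Bit (parentPart (jointLabel X s p z) u) 1 ∧ ¬ Bit (childPart (jointLabel X s p z) u) 1) ∨
      (¬ Bit (parentPart (jointLabel X s p z) u) 1 ∧ Bit (childPart (jointLabel X s p z) u) 1)))
      (fun u hu => ?_) fun u hu => hr.bag_lt _ _ hu.1.1)).trans ?_
  · have h' := h.setReg (x := 20) (by omega) u
    have hu' : (Tm.reg 20).eval (a.setReg 20 u) = u := setReg_reg_self _ _ _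
    rw [← h'.holds_bag_child hu' hu, ← h'.holds_bag_parent hu' hu, Ne, ← h'.holds_tau_eq hu' hu,
      ← holds_bit (k := 1) (q := .lit 2) (h'.eval_childLabel hu' hu) rfl,
      ← holds_bit (k := 1) (q := .lit 2) (h'.eval_parentLabel hu' hu) rfl]
    simp only [← Tm.holds_not, ← Tm.holds_and, ← Tm.holds_or]
  · push Not
    refine forall_congr' fun u => ?_
    tauto

theorem holds_missing (hr : Ranges Adj X n) (h : MergeEnv Adj τ X n m s p z a) :
    ¬ Tm.missing.Holds a ↔ ∀ b, X s (b / 2) → Required Adj τ b →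
      NewHit Adj τ X s p (jointLabel X s p z) b ∨ ∃ c, Linked Adj τ b c ∧ X p (c / 2) := by
  rw [Tm.missing, Tm.holds_ex, h.inp.r1]
  refine (not_congr (exists_lt_iff (Q := fun b => (X s (b / 2) ∧ Required Adj τ b) ∧
      (¬ NewHit Adj τ X s p (jointLabel X s p z) b ∧ ¬ ∃ c, Linked Adj τ b c ∧ X p (c / 2)))
      (fun b hb => ?_) fun b hb => by have := hr.bag_lt _ _ hb.1.1; omega)).trans ?_
  · have h' := h.setReg (x := 20) (by omega) b
    have hb' : (Tm.reg 20).eval (a.setReg 20 b) = b := setReg_reg_self _ _ _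
    have hlink : (Tm.ex 21 1 (.and (.link (.reg 20) (.reg 21)) (.bag (.reg 7) (.half (.reg 21))))).Holds
        (a.setReg 20 b) ↔ ∃ c, Linked Adj τ b c ∧ X p (c / 2) := by
      rw [Tm.holds_ex, h'.inp.r1]
      refine exists_lt_iff (fun c hc => ?_) fun c hc => ?_
      · have h'' := h'.setReg (x := 21) (by omega) c
        have hc' : (Tm.reg 21).eval ((a.setReg 20 b).setReg 21 c) = c := setReg_reg_self _ _ _
        have hb'' : (Tm.reg 20).eval ((a.setReg 20 b).setReg 21 c) = b := by
          simp [Tm.eval, setReg_reg]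
        rw [Tm.holds_and, h''.holds_link hb'' hc' hb hc,
          h''.holds_bag_parent (eval_half hc') (by omega)]
      · have := hr.bag_lt _ _ hc.2; omega
    have hev : ∀ k v, 28 ≤ k → (Tm.reg 20).eval ((a.setReg 20 b).setReg k v) = b := by
      intro k v hk
      simp only [Tm.eval]
      rw [setReg_reg_of_ne _ _ (by omega), setReg_reg_self]
    rw [← hlink, ← h'.holds_bag_child (eval_half hb') (by omega),
      ← h'.holds_required hr hb' (fun v => hev 30 v (by omega)) hb,
      ← h'.holds_newHit hr hev hb]
    simp only [← Tm.holds_not, ← Tm.holds_and]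
  · push Not
    refine forall_congr' fun u => ?_
    tauto

theorem eval_label (hr : Ranges Adj X n) (h : MergeEnv Adj τ X n m s p z a)
    (hu : u.eval a = i) (hu' : ∀ k v, 28 ≤ k → u.eval (a.setReg k v) = i) (hi : i < n) :
    (Tm.label u).eval a = newLabel Adj τ X s p (jointLabel X s p z) i := by
  classical
  have e1 := h.holds_newHit hr (u := .mul (.lit 2) u) (i := 2 * i)
    (fun k v hk => by simp only [Tm.eval, hu' k v hk]) (by omega)
  have e2 := h.holds_newHit hr (u := .add (.mul (.lit 2) u) (.lit 1)) (i := 2 * i + 1)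
    (fun k v hk => by simp only [Tm.eval, hu' k v hk]) (by omega)
  simp only [Tm.label, Tm.eval, Tm.eval_ind, newLabel, threeBits, Tm.holds_or, Tm.holds_and,
    Tm.holds_not, h.holds_tau_eq hu hi, e1, e2, holds_bit (k := 0) (q := .lit 1) (h.eval_joint hu hi) rfl,
    holds_bit (k := 1) (q := .lit 2) (h.eval_parentLabel hu hi) rfl, Ne]
  congr!

theorem eval_codeOf {q t : ℕ} {f : Tm → Tm} {d : ℕ → ℕ} {T : Tm}
    (h : MergeEnv Adj τ X n m s p z a) (hT : ∀ i, T.eval (a.setReg 22 i) = t) (ht : t ≤ m)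
    (hq : ∀ u < n, a.mem q u = place (base 8 (X t)) u)
    (hf : ∀ i < n, (f (.reg 22)).eval (a.setReg 22 i) = d i) :
    (Tm.codeOf T q f).eval a = code n 8 (X t) d := by
  simp only [Tm.codeOf, Tm.eval, h.inp.r0, code, encode]
  refine Finset.sum_congr rfl fun i hi => ?_
  rw [Finset.mem_range] at hi
  have h' := h.setReg (x := 22) (by omega) i
  have hi' : (Tm.reg 22).eval (a.setReg 22 i) = i := setReg_reg_self _ _ _
  have hb := h'.holds_bag (hT i) hi' ht hi
  rw [Tm.eval_ind, hf i hi, setReg_reg_self, setReg_mem, hq i hi, mask]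
  by_cases hX : X t i
  · rw [if_pos (hb.2 hX), if_pos hX, one_mul]
  · rw [if_neg (fun h => hX (hb.1 h)), if_neg hX, zero_mul]

theorem eval_forget (h : MergeEnv Adj τ X n m s p z a) :
    Tm.forget.eval a = newForgotten X n s p (jointLabel X s p z) := by
  classical
  simp only [Tm.forget, Tm.eval, h.inp.r0, newForgotten, Finset.card_filter]
  refine Finset.sum_congr rfl fun i hi => ?_
  rw [Finset.mem_range] at hi
  have h' := h.setReg (x := 22) (by omega) i
  have hi' : (Tm.reg 22).eval (a.setReg 22 i) = i := setReg_reg_self _ _ _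
  simp only [Tm.eval_ind, Tm.holds_and, Tm.holds_not, h'.holds_bag_child hi' hi,
    h'.holds_bag_parent hi' hi, holds_bit (k := 0) (q := .lit 1) (h'.eval_joint hi' hi) rfl]

theorem eval_cell (h : MergeEnv Adj τ X n m s p z a) (v i c : Tm) :
    (Tm.cell v i c).eval a = cellIdx n m (v.eval a) (i.eval a) (c.eval a) := by
  simp only [Tm.cell, Tm.eval, h.inp.r2, h.inp.r3, cellIdx]

/-- Table number 0 is virtual: it is evaluated by a formula instead of being stored, so no table has
to be written for a node whose children have not yet been absorbed. -/
theorem holds_entry (hr : Ranges Adj X n) {q t : ℕ} {f : Tm → Tm} {d : ℕ → ℕ} {T c : Tm}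
    (h : MergeEnv Adj τ X n m s p z a) (hT : T.eval a = t) (hT' : ∀ i, T.eval (a.setReg 22 i) = t)
    (ht : t ≤ m) (hq : ∀ u < n, a.mem q u = place (base 8 (X t)) u)
    (hf : ∀ i < n, (f (.reg 22)).eval (a.setReg 22 i) = d i) :
    (Tm.entry T q f c).Holds a ↔ Entry τ n m a (a.mem 7 t) (X t) d (c.eval a) := by
  have hs : (Tm.someHit T f).Holds a ↔ ∃ u, X t u ∧ τ u = 1 ∧ (Bit (d u) 1 ∨ Bit (d u) 2) := by
    rw [Tm.someHit, Tm.holds_ex, h.inp.r0]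
    refine exists_lt_iff (fun i hi => ?_) fun i hi => hr.bag_lt _ _ hi.1
    have h' := h.setReg (x := 22) (by omega) i
    have hi' : (Tm.reg 22).eval (a.setReg 22 i) = i := setReg_reg_self _ _ _
    rw [Tm.holds_and, Tm.holds_and, Tm.holds_or, h'.holds_bag (hT' i) hi' ht hi,
      h'.holds_tau_eq hi' hi, holds_bit (k := 1) (q := .lit 2) (hf i hi) rfl, holds_bit (k := 2) (hf i hi) rfl]
  rw [Tm.entry, Tm.holds_or, Tm.holds_and, Tm.holds_and, Tm.holds_and, Tm.holds_not, hs, Tm.holds_eq,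
    Tm.holds_eq, Tm.holds_load, Tm.holds_load, h.eval_cell, h.eval_codeOf hT' ht hq hf]
  simp only [Tm.eval, hT, Entry]
  push Not
  rfl

theorem holds_mergeCond (hr : Ranges Adj X n) (h : MergeEnv Adj τ X n m s p z a) :
    Tm.mergeCond.Holds a ↔
      Entry τ n m a (a.mem 7 p) (X p) (parentPart (jointLabel X s p z)) (a.reg 16) ∧
      Entry τ n m a (a.mem 7 s) (X s) (childPart (jointLabel X s p z)) (a.reg 17) ∧
      MergeOk Adj τ X s p (jointLabel X s p z) ∧
      a.reg 16 + a.reg 17 + newForgotten X n s p (jointLabel X s p z) ≤ n := by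
  have e1 := h.holds_entry hr (q := 10) (t := p) (f := Tm.parentLabel) (T := .reg 7) (c := .reg 16)
    (d := parentPart (jointLabel X s p z)) h.r7
    (fun i => (setReg_reg_of_ne _ _ (by omega)).trans h.r7) h.p_le h.place10
    fun i hi => (h.setReg (x := 22) (by omega) i).eval_parentLabel (setReg_reg_self _ _ _) hi
  have e2 := h.holds_entry hr (q := 9) (t := s) (f := Tm.childLabel) (T := .reg 6) (c := .reg 17)
    (d := childPart (jointLabel X s p z)) h.r6
    (fun i => (setReg_reg_of_ne _ _ (by omega)).trans h.r6) h.s_le h.place9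
    fun i hi => (h.setReg (x := 22) (by omega) i).eval_childLabel (setReg_reg_self _ _ _) hi
  simp only [Tm.mergeCond, Tm.holds_and, Tm.holds_not, e1, e2, h.holds_invalid hr,
    h.holds_disagree hr, h.holds_missing hr, Tm.holds_le, Tm.newCount, Tm.eval, h.eval_forget,
    h.inp.r0]
  constructor
  · rintro ⟨⟨h1, h2⟩, ⟨h3, h4, h5⟩, h6⟩
    exact ⟨h1, h2, ⟨h3, h4, h5⟩, h6⟩
  · rintro ⟨h1, h2, ⟨h3, h4, h5⟩, h6⟩
    exact ⟨⟨h1, h2⟩, ⟨h3, h4, h5⟩, h6⟩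

theorem eval_mergeCell (hr : Ranges Adj X n) (h : MergeEnv Adj τ X n m s p z a) :
    Tm.mergeCell.eval a = cellIdx n m (s + 1)
      (code n 8 (X p) (newLabel Adj τ X s p (jointLabel X s p z)))
      (a.reg 16 + a.reg 17 + newForgotten X n s p (jointLabel X s p z)) := by
  rw [Tm.mergeCell, h.eval_cell, h.eval_codeOf (t := p) (T := .reg 7) (f := Tm.label)
    (d := newLabel Adj τ X s p (jointLabel X s p z))
    (fun i => (setReg_reg_of_ne _ _ (by omega)).trans h.r7) h.p_le h.place10 fun i hi =>
      (h.setReg (x := 22) (by omega) i).eval_label hr (setReg_reg_self _ _ _) (fun k v hk => by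
        simp only [Tm.eval]
        rw [setReg_reg_of_ne _ _ (by omega), setReg_reg_self]) hi]
  simp only [Tm.eval, Tm.newCount, h.eval_forget, h.r6]

end MergeEnv

end Semantics

end WordRAM

namespace WordRAM

open NonMonotone MixedRadix

/-! ### Frames -/

/-- Only the registers in `R` and the arrays in `A` have changed. -/
structure Frame (R A : Finset ℕ) (a a' : State) : Prop where
  reg : ∀ x ∉ R, a'.reg x = a.reg x
  mem : ∀ i ∉ A, a'.mem i = a.mem i

namespace Frame

variable {R A R' A' : Finset ℕ} {a a' a'' : State}

theorem refl (R A : Finset ℕ) (a : State) : Frame R A a a := ⟨fun _ _ => rfl, fun _ _ => rfl⟩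

theorem trans (h : Frame R A a a') (h' : Frame R A a' a'') : Frame R A a a'' :=
  ⟨fun x hx => (h'.reg x hx).trans (h.reg x hx), fun x hx => (h'.mem x hx).trans (h.mem x hx)⟩

theorem mono (h : Frame R A a a') (hR : R ⊆ R') (hA : A ⊆ A') : Frame R' A' a a' :=
  ⟨fun x hx => h.reg x fun h' => hx (hR h'), fun x hx => h.mem x fun h' => hx (hA h')⟩

theorem setReg (h : Frame R A a a') {x : ℕ} (hx : x ∈ R) (v : ℕ) : Frame R A a (a'.setReg x v) :=
  ⟨fun y hy => by rw [setReg_reg_of_ne _ _ (ne_of_mem_of_not_mem hx hy).symm, h.reg y hy], h.mem⟩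

theorem setMem (h : Frame R A a a') {x : ℕ} (hx : x ∈ A) (i v : ℕ) :
    Frame R A a (a'.setMem x i v) :=
  ⟨h.reg, fun y hy => by rw [setMem_mem_of_ne _ _ _ (ne_of_mem_of_not_mem hx hy).symm, h.mem y hy]⟩

end Frame

section

variable {Adj : ℕ → ℕ → Prop} {τ : ℕ → ℕ} {X : ℕ → ℕ → Prop} {n m : ℕ}

theorem Inp.frame {R A : Finset ℕ} {a a' : State} (h : Inp Adj τ X n m a) (hf : Frame R A a a')
    (hR : ∀ x < 4, x ∉ R) (hA : ∀ x < 4, x ∉ A) : Inp Adj τ X n m a' := by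
  obtain ⟨h0, h1, h2, h3, h4, h5, h6⟩ := h
  refine ⟨?_, ?_, ?_, ?_, ?_, ?_, ?_⟩
  · rw [hf.reg _ (hR 0 (by omega)), h0]
  · rw [hf.reg _ (hR 1 (by omega)), h1]
  · rw [hf.reg _ (hR 2 (by omega)), h2]
  · rw [hf.reg _ (hR 3 (by omega)), h3]
  · rwa [hf.mem _ (hA 0 (by omega))]
  · rwa [hf.mem _ (hA 1 (by omega))]
  · rwa [hf.mem _ (hA 3 (by omega))]

end

/-- The running time of `set`. -/
noncomputable def setTime (e : Tm) : Polynomial ℕ := e.time + 2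

/-- The running time of `put`. -/
noncomputable def putTime (i e : Tm) : Polynomial ℕ := i.time + e.time + 3

/-- The running time of `cond`, without the branches. -/
noncomputable def condTime (c : Tm) : Polynomial ℕ := c.time + 2

namespace Runs

variable {π : Params} {p q : Prog} {a : State} {T : ℕ} {Q : State → Prop}

theorem set' {x : ℕ} {e : Tm} (he : e.Adm) (hx : 3 ≤ x) {v : ℕ} (hev : e.eval a = v)
    (hv : v < π.M) (h : Q (a.setReg x v)) :
    Runs π (WordRAM.set x e) a ((setTime e).eval π.N) Q := by
  subst hev
  exact (Runs.set he hx hv h).mono (by simp [setTime]) fun _ _ => id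

theorem put' {b : ℕ} {i e : Tm} (hi : i.Adm) (he : e.Adm) {k v : ℕ} (hik : i.eval a = k)
    (hev : e.eval a = v) (hv : v < π.M) (h : Q (a.setMem b k v)) :
    Runs π (WordRAM.put b i e) a ((putTime i e).eval π.N) Q := by
  subst hik hev
  exact (Runs.put hi he hv h).mono (by simp [putTime]) fun _ _ => id

/-- A conditional without an alternative. -/
theorem when {c : Tm} (hc : c.Adm) (h1 : c.Holds a → Runs π p a T Q) (h2 : ¬ c.Holds a → Q a) :
    Runs π (WordRAM.cond c p .skip) a ((condTime c).eval π.N + (T + 1)) Q := by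
  refine (Runs.cond hc (T := T + 1) (fun h => (h1 h).mono (by omega) fun _ _ => id) fun h =>
    (Runs.skip (h2 (by simpa [Tm.Holds] using h))).mono (by omega) fun _ _ => id).mono
    (by simp [condTime]) fun _ _ => id

/-- A conditional with nothing to do if the condition holds. -/
theorem whenNot {c : Tm} (hc : c.Adm) (h1 : c.Holds a → Q a) (h2 : ¬ c.Holds a → Runs π p a T Q) :
    Runs π (WordRAM.cond c .skip p) a ((condTime c).eval π.N + (T + 1)) Q := by
  refine (Runs.cond hc (T := T + 1) (fun h => (Runs.skip (h1 h)).mono (by omega) fun _ _ => id)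
    fun h => (h2 (by simpa [Tm.Holds] using h)).mono (by omega) fun _ _ => id).mono
    (by simp [condTime]) fun _ _ => id

end Runs

/-! ### The computation of the components of the double cover -/

/-- Walks all of whose inner vertices are less than `k`. -/
inductive Via (E : ℕ → ℕ → Prop) (k : ℕ) : ℕ → ℕ → Prop
  | refl (a : ℕ) : Via E k a a
  | single {a b : ℕ} : E a b → Via E k a b
  | cons {a b c : ℕ} : E a c → c < k → Via E k c b → Via E k a b

/-- If the inner vertex `k` occurs, the part before its first occurrence and the part after its last
one avoid `k` as an inner vertex; loops at `k` are dropped. -/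
theorem Via.split {E : ℕ → ℕ → Prop} {k a b : ℕ} (h : Via E (k + 1) a b) :
    Via E k a b ∨ (Via E k a k ∧ Via E k k b) := by
  induction h with
  | refl a => exact .inl (.refl a)
  | single h => exact .inl (.single h)
  | @cons a b c h hc _ ih =>
    rcases Nat.lt_succ_iff_lt_or_eq.1 hc with hc | rfl
    · rcases ih with ih | ⟨ih, ih'⟩
      · exact .inl (.cons h hc ih)
      · exact .inr ⟨.cons h hc ih, ih'⟩
    · rcases ih with ih | ⟨-, ih⟩
      · exact .inr ⟨.single h, ih⟩
      · exact .inr ⟨.single h, ih⟩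

theorem Via.of_reflTransGen {E : ℕ → ℕ → Prop} {k a b : ℕ} (hE : ∀ a b, E a b → b < k)
    (h : Relation.ReflTransGen E a b) : Via E k a b := by
  induction h using Relation.ReflTransGen.head_induction_on with
  | refl => exact .refl b
  | head h _ ih => exact .cons h (hE _ _ h) ih

namespace Tm

/-- The row of the entry of the matrix with `2 * n` columns whose index is in the register `13`. -/
def row : Tm := div (reg 13) (reg 1)

/-- The column of the entry of the matrix with `2 * n` columns whose index is in the register `13`. -/
def col : Tm := mod (reg 13) (reg 1)

/-- Equality or adjacency in the double cover. -/
def startLink : Tm :=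
  or (eq row col) (and (and (adj (half row) (half col)) (eq (tau (half row)) (lit 1)))
    (and (eq (tau (half col)) (lit 1)) (not (eq (parity row) (parity col)))))

/-- A connection via the element in the register `5`. -/
def viaLink : Tm := and (link row (reg 5)) (link (reg 5) col)

end Tm

/-- The computation of the relation `Linked`. -/
def closureProg : Prog :=
  .seq (set 18 (.mul (.reg 1) (.reg 1))) <|
  .seq (forLoop 13 18 (cond .startLink (put 4 (.reg 13) (.lit 1)) .skip)) <|
  forLoop 5 1 (forLoop 13 18 (cond .viaLink (put 4 (.reg 13) (.lit 1)) .skip))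

/-- The running time of `closureProg`. -/
noncomputable def closureTime : Polynomial ℕ :=
  setTime (.mul (.reg 1) (.reg 1)) +
  (Polynomial.X * Polynomial.X * (condTime .startLink + (putTime (.reg 13) (.lit 1) + 1) + 8) + 6 +
  (Polynomial.X * (Polynomial.X * Polynomial.X *
    (condTime .viaLink + (putTime (.reg 13) (.lit 1) + 1) + 8) + 6 + 8) + 6))

section Closure

variable {Adj : ℕ → ℕ → Prop} {τ : ℕ → ℕ} {X : ℕ → ℕ → Prop} {n m : ℕ} {π : Params}

theorem holds_startLink {a : State} (h : Inp Adj τ X n m a) {y : ℕ} (hy : a.reg 13 = y)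
    (hlt : y < 2 * n * (2 * n)) : Tm.startLink.Holds a ↔
      y / (2 * n) = y % (2 * n) ∨ CoverAdj Adj τ (y / (2 * n)) (y % (2 * n)) := by
  have hn : 0 < 2 * n := Nat.pos_of_ne_zero fun h => by simp [h] at hlt
  have h1 : y / (2 * n) / 2 < n := by
    have : y / (2 * n) < 2 * n := Nat.div_lt_of_lt_mul hlt
    omega
  have h2 : y % (2 * n) / 2 < n := by
    have := Nat.mod_lt y hn
    omega
  have e1 : Tm.row.eval a = y / (2 * n) := by simp [Tm.row, Tm.eval, hy, h.r1]
  have e2 : Tm.col.eval a = y % (2 * n) := by simp [Tm.col, Tm.eval_mod, Tm.eval, hy, h.r1]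
  have e3 : (Tm.half .row).eval a = y / (2 * n) / 2 := by simp only [Tm.half, Tm.eval, e1]
  have e4 : (Tm.half .col).eval a = y % (2 * n) / 2 := by simp only [Tm.half, Tm.eval, e2]
  simp only [Tm.startLink, Tm.holds_or, Tm.holds_and, Tm.holds_not, Tm.holds_eq, e1, e2, Tm.adj,
    Tm.holds_load, Tm.tau, Tm.eval, e3, e4, h.r0, h.adj _ h1 _ h2, h.tau _ h1, h.tau _ h2,
    Tm.parity, Tm.eval_mod, CoverAdj, and_assoc, Ne]

theorem holds_viaLink {a : State} (h : Inp Adj τ X n m a) {y k : ℕ} (hy : a.reg 13 = y)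
    (hk : a.reg 5 = k) : Tm.viaLink.Holds a ↔
      a.mem 4 (y / (2 * n) * (2 * n) + k) ≠ 0 ∧ a.mem 4 (k * (2 * n) + y % (2 * n)) ≠ 0 := by
  simp only [Tm.viaLink, Tm.holds_and, Tm.link, Tm.holds_load, Tm.row, Tm.col, Tm.eval_mod, Tm.eval,
    hy, hk, h.r1]

/-- A loop that sets the marks of a matrix with `2 * n` columns. -/
theorem runs_markLoop {a : State} {c : Tm} (hc : c.Adm)
    (h18 : a.reg 18 = 2 * n * (2 * n)) (F : ℕ → Prop)
    (hsound : ∀ a', Frame {13} {4} a a' → (∀ y, a'.mem 4 y ≠ 0 → F y) →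
      ∀ y < 2 * n * (2 * n), a'.reg 13 = y → c.Holds a' → F y)
    (hF : ∀ y, a.mem 4 y ≠ 0 → F y) {Q : State → Prop}
    (hQ : ∀ a', Frame {13} {4} a a' → (∀ y, a'.mem 4 y ≠ 0 → F y) →
      (∀ y, a.mem 4 y ≠ 0 → a'.mem 4 y ≠ 0) →
      (∀ y < 2 * n * (2 * n), a'.mem 4 y ≠ 0 ∨ ∃ a'', Frame {13} {4} a a'' ∧
        (∀ y, a.mem 4 y ≠ 0 → a''.mem 4 y ≠ 0) ∧ a''.reg 13 = y ∧ ¬ c.Holds a'') → Q a') :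
    Runs π (forLoop 13 18 (cond c (put 4 (.reg 13) (.lit 1)) .skip)) a
      (2 * n * (2 * n) * ((condTime c).eval π.N + ((putTime (.reg 13) (.lit 1)).eval π.N + 1) + 8) + 6)
      Q := by
  have hM := π.le_M
  -- An unmarked cell is recorded together with the intermediate state in which its test failed.
  -- Marks only grow, so that state still contains all marks of the initial one.
  refine Runs.forLoop (by omega) (by decide) (by decide) h18 (by omega)
    (fun i a' => Frame {13} {4} a a' ∧ (∀ y, a'.mem 4 y ≠ 0 → F y) ∧
      (∀ y, a.mem 4 y ≠ 0 → a'.mem 4 y ≠ 0) ∧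
      (∀ y < i, a'.mem 4 y ≠ 0 ∨ ∃ a'', Frame {13} {4} a a'' ∧
        (∀ y, a.mem 4 y ≠ 0 → a''.mem 4 y ≠ 0) ∧ a''.reg 13 = y ∧ ¬ c.Holds a'')) ?_ ?_ ?_
  · exact ⟨(Frame.refl _ _ a).setReg (by simp) _, hF, fun y => id, by simp⟩
  · rintro i hi a' - h13 h18' ⟨hf, h1, h2, h3⟩
    refine Runs.when hc (fun hh => ?_) fun hh => ?_
    · refine Runs.put' (k := i) (v := 1) (by decide) (by decide) h13 rfl (by omega) ⟨h13, h18', ?_, ?_, ?_, ?_⟩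
      · exact (hf.setMem (by simp) _ _).setReg (by simp) _
      · intro y hy
        simp only [setReg_mem, setMem_mem_self, Function.update_apply] at hy
        split_ifs at hy with hyi
        · rw [hyi]; exact hsound a' hf h1 i hi h13 hh
        · exact h1 y hy
      · intro y hy
        simp only [setReg_mem, setMem_mem_self, Function.update_apply]
        split_ifs
        · simp
        · exact h2 y hy
      · intro y hy
        simp only [setReg_mem, setMem_mem_self, Function.update_apply]
        split_ifs with hyi
        · simp
        · exact h3 y (by omega)
    · refine ⟨h13, h18', hf.setReg (by simp) _, h1, h2, fun y hy => ?_⟩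
      rcases Nat.lt_succ_iff_lt_or_eq.1 hy with hy | rfl
      · exact h3 y hy
      · exact .inr ⟨a', hf, h2, h13, hh⟩
  · rintro a' - ⟨hf, h1, h2, h3⟩
    exact hQ a' hf h1 h2 h3

/-- Transitive closure with one more admissible inner vertex per round, in place. Overwriting during
a round is harmless: marks are always sound because `Linked` is transitive, and they never
disappear, so the marks needed for completeness are present when tested. -/
theorem runs_closureProg (hr : Ranges Adj X n) {a : State} (h : Inp Adj τ X n m a)
    (h4 : ∀ y, a.mem 4 y = 0) (hlt : 2 * n * (2 * n) < π.M) {Q : State → Prop}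
    (hQ : ∀ a', Frame {5, 13, 18} {4} a a' → HasLink Adj τ n a' → Q a') :
    Runs π closureProg a (closureTime.eval π.N) Q := by
  refine Runs.of_bdd fun hb => ?_
  have hM := π.le_M
  have hN : 2 * n ≤ π.N := h.r1 ▸ hb.len 1 (by omega)
  have hNN : 2 * n * (2 * n) ≤ π.N * π.N := Nat.mul_le_mul hN hN
  let F : ℕ → Prop := fun y => y < 2 * n * (2 * n) ∧ Linked Adj τ (y / (2 * n)) (y % (2 * n))
  have hidx : ∀ {b c : ℕ}, b < 2 * n → c < 2 * n → (b * (2 * n) + c) / (2 * n) = b ∧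
      (b * (2 * n) + c) % (2 * n) = c ∧ b * (2 * n) + c < 2 * n * (2 * n) := by
    intro b c hb hc
    refine ⟨?_, ?_, ?_⟩
    · rw [mul_comm, Nat.mul_add_div (by omega), Nat.div_eq_of_lt hc, add_zero]
    · rw [mul_comm, Nat.mul_add_mod, Nat.mod_eq_of_lt hc]
    · nlinarith
  have hrun : Runs π closureProg a ((setTime (.mul (.reg 1) (.reg 1))).eval π.N +
      ((2 * n * (2 * n) * ((condTime .startLink).eval π.N +
        ((putTime (.reg 13) (.lit 1)).eval π.N + 1) + 8) + 6) +
      (2 * n * (2 * n * (2 * n) * ((condTime .viaLink).eval π.N +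
        ((putTime (.reg 13) (.lit 1)).eval π.N + 1) + 8) + 6 + 8) + 6))) Q := by
    unfold closureProg
    refine Runs.seq (Runs.set' (v := 2 * n * (2 * n)) (by decide) (by omega)
      (by simp only [Tm.eval, h.r1]) hlt ?_)
    set a₁ := a.setReg 18 (2 * n * (2 * n)) with ha₁
    have f₁ : Frame {5, 13, 18} {4} a a₁ := (Frame.refl _ _ a).setReg (by simp) _
    have i₁ : Inp Adj τ X n m a₁ := h.frame f₁ (by decide) (by decide)
    have h18 : a₁.reg 18 = 2 * n * (2 * n) := by simp [ha₁]
    refine Runs.seq (runs_markLoop (by decide) h18 F ?_ ?_ ?_)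
    · intro a' hf _ y hy h13 hc
      rw [holds_startLink (i₁.frame hf (by decide) (by decide)) h13 hy] at hc
      refine ⟨hy, ?_⟩
      rcases hc with hc | hc
      · rw [hc]; exact .refl
      · exact .single hc
    · intro y hy; exact absurd (h4 y) hy
    intro a₂ f₂ s₂ _ c₂
    have f₂' : Frame {5, 13, 18} {4} a a₂ := f₁.trans (f₂.mono (by decide) (by decide))
    have i₂ : Inp Adj τ X n m a₂ := h.frame f₂' (by decide) (by decide)
    have h18₂ : a₂.reg 18 = 2 * n * (2 * n) := by rw [f₂.reg 18 (by decide), h18]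
    refine Runs.forLoop (by omega) (by decide) (by decide) i₂.r1 (by omega)
      (fun k a' => Frame {5, 13, 18} {4} a a' ∧ a'.reg 18 = 2 * n * (2 * n) ∧
        (∀ y, a'.mem 4 y ≠ 0 → F y) ∧ ∀ b < 2 * n, ∀ c < 2 * n, Via (CoverAdj Adj τ) k b c →
          a'.mem 4 (b * (2 * n) + c) ≠ 0) ?_ ?_ ?_
    · refine ⟨f₂'.setReg (by decide) _, by rw [setReg_reg_of_ne _ _ (by omega), h18₂], s₂, ?_⟩
      intro b hb c hc hv
      obtain ⟨e1, e2, e3⟩ := hidx hb hc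
      rcases c₂ _ e3 with h' | ⟨a'', hf, -, h13, hno⟩
      · exact h'
      · rw [holds_startLink (i₁.frame hf (by decide) (by decide)) h13 e3, e1, e2] at hno
        cases hv with
        | refl => exact absurd (.inl rfl) hno
        | single h' => exact absurd (.inr h') hno
        | cons _ h' _ => omega
    · rintro k hk a₃ - h5 h1 ⟨f₃, h18₃, s₃, c₃⟩
      have i₃ : Inp Adj τ X n m a₃ := h.frame f₃ (by decide) (by decide)
      refine runs_markLoop (by decide) h18₃ F ?_ s₃ ?_
      · intro a' hf hs y hy h13 hc
        have h5' : a'.reg 5 = k := by rw [hf.reg 5 (by decide), h5]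
        rw [holds_viaLink (i₃.frame hf (by decide) (by decide)) h13 h5'] at hc
        have hyn : y / (2 * n) < 2 * n := Nat.div_lt_of_lt_mul hy
        have hym : y % (2 * n) < 2 * n := Nat.mod_lt _ (by omega)
        obtain ⟨e1, e2, -⟩ := hidx hyn hk
        obtain ⟨e3, e4, -⟩ := hidx hk hym
        have l1 := (hs _ hc.1).2
        have l2 := (hs _ hc.2).2
        rw [e1, e2] at l1
        rw [e3, e4] at l2
        exact ⟨hy, l1.trans l2⟩
      · intro a₄ f₄ s₄ m₄ c₄
        refine ⟨by rw [f₄.reg 5 (by decide), h5], by rw [f₄.reg 1 (by decide), h1], ?_, ?_, s₄, ?_⟩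
        · exact (f₃.trans (f₄.mono (by decide) (by decide))).setReg (by decide) _
        · rw [setReg_reg_of_ne _ _ (by omega), f₄.reg 18 (by decide), h18₃]
        · intro b hb c hc hv
          -- Walks that avoid `k` were marked before this round; the others consist of two walks
          -- marked before, which the test combines.
          rcases hv.split with hv | ⟨hv1, hv2⟩
          · exact m₄ _ (c₃ b hb c hc hv)
          · obtain ⟨e1, e2, e3⟩ := hidx hb hc
            rcases c₄ _ e3 with h' | ⟨a'', hf, hm, h13, hno⟩
            · exact h'
            · have h5' : a''.reg 5 = k := by rw [hf.reg 5 (by decide), h5]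
              rw [holds_viaLink (i₃.frame hf (by decide) (by decide)) h13 h5', e1, e2] at hno
              exact absurd ⟨hm _ (c₃ b hb k hk hv1), hm _ (c₃ k hk c hc hv2)⟩ hno
    · rintro a' - ⟨hf, -, hs, hc⟩
      refine hQ a' hf fun b hb c hc' => ⟨fun h' => ?_, fun h' => hc b hb c hc' ?_⟩
      · obtain ⟨e1, e2, -⟩ := hidx hb hc'
        have := (hs _ h').2
        rwa [e1, e2] at this
      · refine Via.of_reflTransGen (fun b c hbc => ?_) h'
        have := (hr.adj_lt _ _ hbc.1).2
        omega
  refine hrun.mono ?_ fun _ _ => id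
  simp only [closureTime, Polynomial.eval_add, Polynomial.eval_mul, Polynomial.eval_X,
    Polynomial.eval_ofNat, Polynomial.eval_one]
  gcongr

end Closure

end WordRAM

namespace WordRAM

open NonMonotone MixedRadix

/-! ### The combination of a node with its parent -/

/-- The factor of a place value with base `q` in the bags `e`. -/
def Tm.factor (q : ℕ) (e : Tm) : Tm := .add (.lit 1) (.mul (.lit q) (.ind e))

/-- The computation of the place values. -/
def placeProg : Prog :=
  .seq (set 9 (.lit 1)) <| .seq (set 10 (.lit 1)) <| .seq (set 11 (.lit 1)) <|
  forLoop 13 0 <| .seq (put 8 (.reg 13) (.reg 9)) <| .seq (put 9 (.reg 13) (.reg 10)) <|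
    .seq (put 10 (.reg 13) (.reg 11)) <|
    .seq (set 9 (.mul (.reg 9) (.factor 31 (.or (.bag (.reg 6) (.reg 13)) (.bag (.reg 7) (.reg 13)))))) <|
    .seq (set 10 (.mul (.reg 10) (.factor 7 (.bag (.reg 6) (.reg 13)))))
      (set 11 (.mul (.reg 11) (.factor 7 (.bag (.reg 7) (.reg 13)))))

/-- The running time of `placeProg`. -/
noncomputable def placeTime : Polynomial ℕ :=
  setTime (.lit 1) + (setTime (.lit 1) + (setTime (.lit 1) + (Polynomial.X *
    (putTime (.reg 13) (.reg 9) + (putTime (.reg 13) (.reg 10) + (putTime (.reg 13) (.reg 11) +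
    (setTime (.mul (.reg 9) (.factor 31 (.or (.bag (.reg 6) (.reg 13)) (.bag (.reg 7) (.reg 13))))) +
    (setTime (.mul (.reg 10) (.factor 7 (.bag (.reg 6) (.reg 13)))) +
      setTime (.mul (.reg 11) (.factor 7 (.bag (.reg 7) (.reg 13)))))))) + 8) + 6)))

/-- The combination of all pairs of entries. -/
def tableProg : Prog :=
  .seq (set 18 (.mul (.reg 9) (.mul (.reg 2) (.reg 2)))) <|
  forLoop 12 18 <| .seq (set 15 (.div (.reg 12) (.mul (.reg 2) (.reg 2)))) <|
    .seq (set 16 (.mod (.div (.reg 12) (.reg 2)) (.reg 2))) <|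
    .seq (set 17 (.mod (.reg 12) (.reg 2))) <|
    cond .mergeCond (put 11 .mergeCell (.lit 1)) .skip

/-- The running time of one round of the loop in `tableProg`. -/
noncomputable def pairTime : Polynomial ℕ :=
  setTime (.div (.reg 12) (.mul (.reg 2) (.reg 2))) +
  (setTime (.mod (.div (.reg 12) (.reg 2)) (.reg 2)) +
  (setTime (.mod (.reg 12) (.reg 2)) +
  (condTime .mergeCond + (putTime .mergeCell (.lit 1) + 1))))

/-! ### Place values, tables, and the correctness of their combination. -/

section

variable {Adj : ℕ → ℕ → Prop} {τ : ℕ → ℕ} {X : ℕ → ℕ → Prop} {n m : ℕ} {π : Params}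

theorem place_mono {b b' : ℕ → ℕ} (h : ∀ u, b u ≤ b' u) (u : ℕ) : place b u ≤ place b' u :=
  Finset.prod_le_prod' fun v _ => h v

theorem place_le_place {b : ℕ → ℕ} (h : ∀ u, 1 ≤ b u) {u v : ℕ} (huv : u ≤ v) :
    place b u ≤ place b v :=
  Finset.prod_le_prod_of_subset_of_one_le' (Finset.range_subset_range.2 huv) fun i _ _ => h i

theorem one_le_base {q : ℕ} (hq : 1 ≤ q) (B : ℕ → Prop) (u : ℕ) : 1 ≤ base q B u := by
  unfold base; split_ifs <;> omega

theorem eval_factor {a : State} {e : Tm} {q u : ℕ} {B : ℕ → Prop} (h : e.Holds a ↔ B u) :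
    (Tm.factor q e).eval a = base (q + 1) B u := by
  simp only [Tm.factor, Tm.eval, Tm.eval_ind, base]
  by_cases hB : B u
  · rw [if_pos (h.2 hB), if_pos hB]; omega
  · rw [if_neg (fun h' => hB (h.1 h')), if_neg hB, mul_zero, add_zero]

theorem runs_placeProg {a : State} (h : Inp Adj τ X n m a) {s p : ℕ} (hs : s ≤ m) (hp : p ≤ m)
    (h6 : a.reg 6 = s) (h7 : a.reg 7 = p)
    (hlt : place (base 32 fun u => X s u ∨ X p u) n < π.M) {Q : State → Prop}
    (hQ : ∀ a', Frame {9, 10, 11, 13} {8, 9, 10} a a' →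
      a'.reg 9 = place (base 32 fun u => X s u ∨ X p u) n →
      (∀ u < n, a'.mem 8 u = place (base 32 fun u => X s u ∨ X p u) u) →
      (∀ u < n, a'.mem 9 u = place (base 8 (X s)) u) →
      (∀ u < n, a'.mem 10 u = place (base 8 (X p)) u) → Q a') :
    Runs π placeProg a (placeTime.eval π.N) Q := by
  refine Runs.of_bdd fun hb => ?_
  have hM := π.le_M
  have hN : n ≤ π.N := h.r0 ▸ hb.len 0 (by omega)
  have hlt0 : ∀ u ≤ n, place (base 32 fun u => X s u ∨ X p u) u < π.M := fun u hu =>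
    (place_le_place (one_le_base (by omega) _) hu).trans_lt hlt
  -- The places with base 8 for a single bag are dominated by those with base 32 for the union, so a
  -- single bound covers all three arrays.
  have hlts : ∀ u ≤ n, place (base 8 (X s)) u < π.M := fun u hu =>
    (place_mono (fun v => by unfold base; split_ifs <;> simp_all) u).trans_lt (hlt0 u hu)
  have hltp : ∀ u ≤ n, place (base 8 (X p)) u < π.M := fun u hu =>
    (place_mono (fun v => by unfold base; split_ifs <;> simp_all) u).trans_lt (hlt0 u hu)
  unfold placeProg
  refine Runs.mono (T := (setTime (.lit 1)).eval π.N + ((setTime (.lit 1)).eval π.N +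
    ((setTime (.lit 1)).eval π.N + (n *
    ((putTime (.reg 13) (.reg 9)).eval π.N + ((putTime (.reg 13) (.reg 10)).eval π.N +
    ((putTime (.reg 13) (.reg 11)).eval π.N +
    ((setTime (.mul (.reg 9) (.factor 31 (.or (.bag (.reg 6) (.reg 13))
      (.bag (.reg 7) (.reg 13)))))).eval π.N +
    ((setTime (.mul (.reg 10) (.factor 7 (.bag (.reg 6) (.reg 13))))).eval π.N +
      (setTime (.mul (.reg 11) (.factor 7 (.bag (.reg 7) (.reg 13))))).eval π.N)))) + 8) + 6))))
    (Q := Q) ?_ ?_ fun _ _ => id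
  · refine Runs.seq (Runs.set' (v := 1) (by decide) (by omega) rfl (by omega) ?_)
    refine Runs.seq (Runs.set' (v := 1) (by decide) (by omega) rfl (by omega) ?_)
    refine Runs.seq (Runs.set' (v := 1) (by decide) (by omega) rfl (by omega) ?_)
    refine Runs.forLoop (b := n) (by omega) (by decide) (by decide)
      (by simp [setReg_reg, h.r0]) (by omega)
      (fun i a' => Frame {9, 10, 11, 13} {8, 9, 10} a a' ∧
        a'.reg 9 = place (base 32 fun u => X s u ∨ X p u) i ∧
        a'.reg 10 = place (base 8 (X s)) i ∧ a'.reg 11 = place (base 8 (X p)) i ∧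
        (∀ u < i, a'.mem 8 u = place (base 32 fun u => X s u ∨ X p u) u) ∧
        (∀ u < i, a'.mem 9 u = place (base 8 (X s)) u) ∧
        (∀ u < i, a'.mem 10 u = place (base 8 (X p)) u)) ?_ ?_ ?_
    · refine ⟨?_, ?_, ?_, ?_, by simp, by simp, by simp⟩
      · exact ((((Frame.refl _ _ a).setReg (by decide) _).setReg (by decide) _).setReg
          (by decide) _).setReg (by decide) _
      · simp [setReg_reg, place]
      · simp [setReg_reg, place]
      · simp [setReg_reg, place]
    · rintro i hi a₀ - h13 h0 ⟨f₀, h9, h10, h11, m8, m9, m10⟩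
      refine Runs.seq (Runs.put' (by decide) (by decide) (k := i)
        (v := place (base 32 fun u => X s u ∨ X p u) i) h13 h9 (hlt0 i hi.le) ?_)
      refine Runs.seq (Runs.put' (by decide) (by decide) (k := i)
        (v := place (base 8 (X s)) i) h13 h10 (hlts i hi.le) ?_)
      refine Runs.seq (Runs.put' (by decide) (by decide) (k := i)
        (v := place (base 8 (X p)) i) h13 h11 (hltp i hi.le) ?_)
      set a₁ := ((a₀.setMem 8 i (place (base 32 fun u => X s u ∨ X p u) i)).setMem 9 i
        (place (base 8 (X s)) i)).setMem 10 i (place (base 8 (X p)) i) with ha₁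
      have r₁ : a₁.reg = a₀.reg := rfl
      have f₁ : Frame {9, 10, 11, 13} {8, 9, 10} a a₁ :=
        ((f₀.setMem (by decide) _ _).setMem (by decide) _ _).setMem (by decide) _ _
      have n8 : ∀ u < i + 1, a₁.mem 8 u = place (base 32 fun u => X s u ∨ X p u) u := by
        intro u hu
        rw [ha₁, setMem_mem_of_ne _ _ _ (by omega), setMem_mem_of_ne _ _ _ (by omega),
          setMem_mem_self, Function.update_apply]
        split_ifs with hui
        · rw [hui]
        · exact m8 u (by omega)
      have n9 : ∀ u < i + 1, a₁.mem 9 u = place (base 8 (X s)) u := by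
        intro u hu
        rw [ha₁, setMem_mem_of_ne _ _ _ (by omega), setMem_mem_self, Function.update_apply]
        split_ifs with hui
        · rw [hui]
        · rw [setMem_mem_of_ne _ _ _ (by omega)]; exact m9 u (by omega)
      have n10 : ∀ u < i + 1, a₁.mem 10 u = place (base 8 (X p)) u := by
        intro u hu
        rw [ha₁, setMem_mem_self, Function.update_apply]
        split_ifs with hui
        · rw [hui]
        · rw [setMem_mem_of_ne _ _ _ (by omega), setMem_mem_of_ne _ _ _ (by omega)]
          exact m10 u (by omega)
      clear_value a₁
      have hbag : ∀ a', Frame {9, 10, 11, 13} {8, 9, 10} a a' → a'.reg 13 = i →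
          ((Tm.bag (.reg 6) (.reg 13)).Holds a' ↔ X s i) ∧
          ((Tm.bag (.reg 7) (.reg 13)).Holds a' ↔ X p i) := by
        intro a' hf h13'
        have hi' := h.frame hf (by decide) (by decide)
        simp only [Tm.bag, Tm.holds_load, Tm.eval, hf.reg 6 (by decide), hf.reg 7 (by decide), h6,
          h7, h13', hi'.r0, hi'.bag s hs i hi, hi'.bag p hp i hi, and_self]
      obtain ⟨b1, b2⟩ := hbag a₁ f₁ (by rw [r₁, h13])
      refine Runs.seq (Runs.set' (v := place (base 32 fun u => X s u ∨ X p u) (i + 1)) (by decide)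
        (by omega) ?_ (hlt0 _ hi) ?_)
      · rw [place_succ, ← eval_factor (q := 31) (B := fun u => X s u ∨ X p u)
          (Tm.holds_or.trans (or_congr b1 b2)), ← h9, ← r₁]; rfl
      set a₂ := a₁.setReg 9 (place (base 32 fun u => X s u ∨ X p u) (i + 1)) with ha₂
      have f₂ : Frame {9, 10, 11, 13} {8, 9, 10} a a₂ := f₁.setReg (by decide) _
      have r₂ : ∀ x, x ≠ 9 → a₂.reg x = a₀.reg x := fun x hx => by
        rw [ha₂, setReg_reg_of_ne _ _ hx, r₁]
      have r₂9 : a₂.reg 9 = place (base 32 fun u => X s u ∨ X p u) (i + 1) := setReg_reg_self _ _ _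
      have e₂ : a₂.mem = a₁.mem := rfl
      clear_value a₂
      obtain ⟨b1, b2⟩ := hbag a₂ f₂ (by rw [r₂ _ (by omega), h13])
      refine Runs.seq (Runs.set' (v := place (base 8 (X s)) (i + 1)) (by decide)
        (by omega) ?_ (hlts _ hi) ?_)
      · rw [place_succ, ← eval_factor (q := 7) b1, ← h10, ← r₂ 10 (by omega)]; rfl
      set a₃ := a₂.setReg 10 (place (base 8 (X s)) (i + 1)) with ha₃
      have f₃ : Frame {9, 10, 11, 13} {8, 9, 10} a a₃ := f₂.setReg (by decide) _
      have r₃ : ∀ x, x ≠ 10 → a₃.reg x = a₂.reg x := fun x hx => by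
        rw [ha₃, setReg_reg_of_ne _ _ hx]
      have r₃10 : a₃.reg 10 = place (base 8 (X s)) (i + 1) := setReg_reg_self _ _ _
      have e₃ : a₃.mem = a₁.mem := e₂
      clear_value a₃
      obtain ⟨b1, b2⟩ := hbag a₃ f₃ (by rw [r₃ _ (by omega), r₂ _ (by omega), h13])
      refine Runs.set' (v := place (base 8 (X p)) (i + 1)) (by decide) (by omega) ?_ (hltp _ hi) ?_
      · rw [place_succ, ← eval_factor (q := 7) b2, ← h11, ← r₂ 11 (by omega), ← r₃ 11 (by omega)]; rfl
      refine ⟨?_, ?_, ?_, ?_, ?_, ?_, ?_, ?_, ?_⟩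
      · rw [setReg_reg_of_ne _ _ (by omega), r₃ _ (by omega), r₂ _ (by omega), h13]
      · rw [setReg_reg_of_ne _ _ (by omega), r₃ _ (by omega), r₂ _ (by omega), h0]
      · exact (f₃.setReg (by decide) _).setReg (by decide) _
      · rw [setReg_reg_of_ne _ _ (by omega), setReg_reg_of_ne _ _ (by omega), r₃ _ (by omega), r₂9]
      · rw [setReg_reg_of_ne _ _ (by omega), setReg_reg_of_ne _ _ (by omega), r₃10]
      · rw [setReg_reg_of_ne _ _ (by omega), setReg_reg_self]
      · simpa only [setReg_mem, e₃] using n8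
      · simpa only [setReg_mem, e₃] using n9
      · simpa only [setReg_mem, e₃] using n10
    · rintro a' - ⟨hf, h9, -, -, m8, m9, m10⟩
      exact hQ a' hf h9 m8 m9 m10
  · simp only [placeTime, Polynomial.eval_add, Polynomial.eval_mul, Polynomial.eval_X,
      Polynomial.eval_ofNat]
    gcongr

/-- The index is a number with lower digits `v ≤ m` and `c ≤ n`; the code `i` is the unbounded
leading part. -/
theorem cellIdx_inj {v v' i i' c c' : ℕ} (hv : v ≤ m) (hv' : v' ≤ m) (hc : c ≤ n) (hc' : c' ≤ n)
    (h : cellIdx n m v i c = cellIdx n m v' i' c') : v = v' ∧ i = i' ∧ c = c' := by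
  unfold cellIdx at h
  have key : ∀ {b x y x' y' : ℕ}, y < b → y' < b → x * b + y = x' * b + y' → x = x' ∧ y = y' := by
    intro b x y x' y' hy hy' h
    have h1 := congrArg (· / b) h
    have h2 := congrArg (· % b) h
    simp only [mul_comm _ b, Nat.mul_add_div (Nat.zero_lt_of_lt hy), Nat.div_eq_of_lt hy,
      Nat.div_eq_of_lt hy', Nat.mul_add_mod, Nat.mod_eq_of_lt hy, Nat.mod_eq_of_lt hy',
      add_zero] at h1 h2
    exact ⟨h1, h2⟩
  obtain ⟨h1, h2⟩ := key (by omega) (by omega) h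
  obtain ⟨h3, h4⟩ := key (by omega) (by omega) h1
  exact ⟨h2, h3, h4⟩

theorem MergeEnv.frame {s p z z' : ℕ} {a a' : State} (h : MergeEnv Adj τ X n m s p z a)
    (hf : Frame {12, 15, 16, 17, 18} {11} a a') (hz : a'.reg 15 = z') :
    MergeEnv Adj τ X n m s p z' a' := by
  obtain ⟨hi, hl, hs, hp, h6, h7, -, h8, h9, h10⟩ := h
  refine ⟨hi.frame hf (by decide) (by decide), ?_, hs, hp, ?_, ?_, hz, ?_, ?_, ?_⟩
  · unfold HasLink; rwa [hf.mem _ (by decide)]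
  · rw [hf.reg _ (by decide), h6]
  · rw [hf.reg _ (by decide), h7]
  · rwa [hf.mem _ (by decide)]
  · rwa [hf.mem _ (by decide)]
  · rwa [hf.mem _ (by decide)]

theorem Entry.congr {a a' : State} {v c : ℕ} {B : ℕ → Prop} {d : ℕ → ℕ}
    (h : ∀ i, a'.mem 11 (cellIdx n m v i c) = a.mem 11 (cellIdx n m v i c)) :
    Entry τ n m a' v B d c ↔ Entry τ n m a v B d c := by
  simp only [Entry, h]

theorem Entry.label_congr {a : State} {v c : ℕ} {B : ℕ → Prop} {d d' : ℕ → ℕ}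
    (h : ∀ u, B u → d u = d' u) : Entry τ n m a v B d c ↔ Entry τ n m a v B d' c := by
  unfold Entry
  rw [code_congr h]
  refine or_congr_left (and_congr_right fun _ => and_congr_right fun _ => forall₂_congr fun u hu => ?_)
  rw [h u hu]

/-- The entries with numbers `c₁`, `c₂` for the joint label with code `z` can be combined. -/
def Combines (Adj : ℕ → ℕ → Prop) (τ : ℕ → ℕ) (X : ℕ → ℕ → Prop) (n m : ℕ) (a : State)
    (s p z c₁ c₂ : ℕ) : Prop :=
  Entry τ n m a (a.mem 7 p) (X p) (parentPart (jointLabel X s p z)) c₁ ∧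
  Entry τ n m a (a.mem 7 s) (X s) (childPart (jointLabel X s p z)) c₂ ∧
  MergeOk Adj τ X s p (jointLabel X s p z) ∧
  c₁ + c₂ + newForgotten X n s p (jointLabel X s p z) ≤ n

/-- One counter packs the triple of a joint label code and two counts in base `n + 1`. The table
being written is new and differs from both tables being read, so the condition may be stated in
terms of the state before the loop. -/
theorem runs_tableProg (hr : Ranges Adj X n) {a : State} {s p z : ℕ}
    (h : MergeEnv Adj τ X n m s p z a) (hs : s < m)
    (h9 : a.reg 9 = place (base 32 fun u => X s u ∨ X p u) n)
    (hvp : a.mem 7 p ≤ m) (hvp' : a.mem 7 p ≠ s + 1) (hvs : a.mem 7 s ≤ m)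
    (hvs' : a.mem 7 s ≠ s + 1) (hzero : ∀ i c, c ≤ n → a.mem 11 (cellIdx n m (s + 1) i c) = 0)
    (hlt : place (base 32 fun u => X s u ∨ X p u) n * ((n + 1) * (n + 1)) < π.M)
    {Q : State → Prop}
    (hQ : ∀ a', Frame {12, 15, 16, 17, 18} {11} a a' →
      (∀ v i c, v ≤ m → v ≠ s + 1 → c ≤ n →
        a'.mem 11 (cellIdx n m v i c) = a.mem 11 (cellIdx n m v i c)) →
      (∀ i c, c ≤ n → (a'.mem 11 (cellIdx n m (s + 1) i c) ≠ 0 ↔ ∃ z c₁ c₂,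
        z < place (base 32 fun u => X s u ∨ X p u) n ∧ c₁ ≤ n ∧ c₂ ≤ n ∧
        Combines Adj τ X n m a s p z c₁ c₂ ∧
        i = code n 8 (X p) (newLabel Adj τ X s p (jointLabel X s p z)) ∧
        c = c₁ + c₂ + newForgotten X n s p (jointLabel X s p z))) → Q a') :
    Runs π tableProg a ((setTime (.mul (.reg 9) (.mul (.reg 2) (.reg 2)))).eval π.N +
      (place (base 32 fun u => X s u ∨ X p u) n * ((n + 1) * (n + 1)) * (pairTime.eval π.N + 8) + 6))
      Q := by
  have hM := π.le_M
  set P := place (base 32 fun u => X s u ∨ X p u) n with hP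
  have hadm := mergeCond_adm
  have hadm' := mergeCell_adm
  unfold tableProg
  refine Runs.seq (Runs.set' (v := P * ((n + 1) * (n + 1))) (by decide) (by omega)
    (by simp only [Tm.eval, h9, h.inp.r2]) hlt ?_)
  set a₁ := a.setReg 18 (P * ((n + 1) * (n + 1))) with ha₁
  have f₁ : Frame {12, 15, 16, 17, 18} {11} a a₁ := (Frame.refl _ _ a).setReg (by decide) _
  refine Runs.forLoop (b := P * ((n + 1) * (n + 1))) (by omega) (by decide) (by decide)
    (setReg_reg_self _ _ _) (by omega)
    (fun y a' => Frame {12, 15, 16, 17, 18} {11} a a' ∧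
      (∀ v i c, v ≤ m → v ≠ s + 1 → c ≤ n →
        a'.mem 11 (cellIdx n m v i c) = a.mem 11 (cellIdx n m v i c)) ∧
      ∀ i c, c ≤ n → (a'.mem 11 (cellIdx n m (s + 1) i c) ≠ 0 ↔ ∃ y' < y,
        Combines Adj τ X n m a s p (y' / ((n + 1) * (n + 1))) (y' / (n + 1) % (n + 1))
          (y' % (n + 1)) ∧
        i = code n 8 (X p) (newLabel Adj τ X s p (jointLabel X s p (y' / ((n + 1) * (n + 1))))) ∧
        c = y' / (n + 1) % (n + 1) + y' % (n + 1) +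
          newForgotten X n s p (jointLabel X s p (y' / ((n + 1) * (n + 1)))))) ?_ ?_ ?_
  · refine ⟨f₁.setReg (by decide) _, fun _ _ _ _ _ _ => rfl, fun i c hc => ?_⟩
    simp [ha₁, hzero i c hc]
  · rintro y hy a₂ - h12 h18 ⟨f₂, u₂, c₂⟩
    have r2 : a₂.reg 2 = n + 1 := by rw [f₂.reg 2 (by decide), h.inp.r2]
    have hyM : y < π.M := hy.trans hlt
    set z' := y / ((n + 1) * (n + 1)) with hz'
    set d₁ := y / (n + 1) % (n + 1) with hd₁
    set d₂ := y % (n + 1) with hd₂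
    have hd₁n : d₁ ≤ n := Nat.lt_succ_iff.1 (Nat.mod_lt _ (by omega))
    have hd₂n : d₂ ≤ n := Nat.lt_succ_iff.1 (Nat.mod_lt _ (by omega))
    simp only [pairTime, Polynomial.eval_add, Polynomial.eval_one]
    refine Runs.seq (Runs.set' (v := z') (by decide) (by omega)
      (by simp only [Tm.eval, h12, r2, hz']) ((Nat.div_le_self _ _).trans_lt hyM) ?_)
    refine Runs.seq (Runs.set' (v := d₁) (by decide) (by omega)
      (by simp [Tm.eval, Tm.eval_mod, setReg_reg, h12, r2, hd₁])
      ((Nat.mod_le _ _).trans_lt ((Nat.div_le_self _ _).trans_lt hyM)) ?_)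
    refine Runs.seq (Runs.set' (v := d₂) (by decide) (by omega)
      (by simp [Tm.eval, Tm.eval_mod, setReg_reg, h12, r2, hd₂])
      ((Nat.mod_le _ _).trans_lt hyM) ?_)
    set a₃ := ((a₂.setReg 15 z').setReg 16 d₁).setReg 17 d₂ with ha₃
    have f₃ : Frame {12, 15, 16, 17, 18} {11} a a₃ :=
      ((f₂.setReg (by decide) _).setReg (by decide) _).setReg (by decide) _
    have m₃ : a₃.mem = a₂.mem := rfl
    have r₃12 : a₃.reg 12 = y := by simp [ha₃, setReg_reg, h12]
    have r₃18 : a₃.reg 18 = P * ((n + 1) * (n + 1)) := by simp [ha₃, setReg_reg, h18]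
    have r₃15 : a₃.reg 15 = z' := by simp [ha₃, setReg_reg]
    have r₃16 : a₃.reg 16 = d₁ := by simp [ha₃, setReg_reg]
    have r₃17 : a₃.reg 17 = d₂ := by simp [ha₃]
    clear_value a₃
    have env : MergeEnv Adj τ X n m s p z' a₃ := h.frame f₃ r₃15
    -- Both entries come from tables with numbers other than `s + 1`, which the loop has not
    -- touched.
    have hcond : Tm.mergeCond.Holds a₃ ↔ Combines Adj τ X n m a s p z' d₁ d₂ := by
      rw [env.holds_mergeCond hr, r₃16, r₃17, f₃.mem 7 (by decide),
        Entry.congr (a := a) (a' := a₃) (c := d₁) fun i => m₃ ▸ u₂ _ i _ hvp hvp' hd₁n,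
        Entry.congr (a := a) (a' := a₃) (c := d₂) fun i => m₃ ▸ u₂ _ i _ hvs hvs' hd₂n, Combines]
    have hcell := env.eval_mergeCell hr
    rw [r₃16, r₃17] at hcell
    refine Runs.when hadm (fun hh => ?_) fun hh => ?_
    · rw [hcond] at hh
      refine Runs.put' hadm' (by decide) hcell (v := 1) rfl (by omega)
        ⟨r₃12, r₃18, (f₃.setMem (by decide) _ _).setReg (by decide) _, ?_, ?_⟩
      · intro v i c hv hv' hc
        rw [setReg_mem, setMem_mem_self, Function.update_apply, if_neg, m₃]
        · exact u₂ v i c hv hv' hc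
        · exact fun heq => hv' (cellIdx_inj hv hs hc hh.2.2.2 heq).1
      · intro i c hc
        rw [setReg_mem, setMem_mem_self, Function.update_apply]
        constructor
        · split_ifs with heq
          · rintro -
            obtain ⟨-, hi, hc⟩ := cellIdx_inj hs hs hc hh.2.2.2 heq
            exact ⟨y, by omega, hh, hi, hc⟩
          · rw [m₃, c₂ i c hc]
            rintro ⟨y', hy', hrest⟩
            exact ⟨y', by omega, hrest⟩
        · rintro ⟨y', hy', hcomb, hi, hc'⟩
          split_ifs with heq
          · simp
          · rw [m₃, c₂ i c hc]
            rcases Nat.lt_succ_iff_lt_or_eq.1 hy' with hy' | rfl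
            · exact ⟨y', hy', hcomb, hi, hc'⟩
            · exact absurd (by rw [hi, hc']) heq
    · rw [hcond] at hh
      refine ⟨r₃12, r₃18, f₃.setReg (by decide) _, ?_, ?_⟩
      · rw [setReg_mem, m₃]; exact u₂
      · intro i c hc
        rw [setReg_mem, m₃, c₂ i c hc]
        constructor
        · rintro ⟨y', hy', hrest⟩
          exact ⟨y', by omega, hrest⟩
        · rintro ⟨y', hy', hcomb, hrest⟩
          rcases Nat.lt_succ_iff_lt_or_eq.1 hy' with hy' | rfl
          · exact ⟨y', hy', hcomb, hrest⟩
          · exact absurd hcomb hh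
  · rintro a' - ⟨hf, hu, hc⟩
    refine hQ a' hf hu fun i c hcn => ?_
    rw [hc i c hcn]
    constructor
    · rintro ⟨y, hy, hcomb, hi, hc⟩
      refine ⟨_, _, _, ?_, ?_, ?_, hcomb, hi, hc⟩
      · exact Nat.div_lt_of_lt_mul (by rwa [mul_comm])
      · exact Nat.lt_succ_iff.1 (Nat.mod_lt _ (by omega))
      · exact Nat.lt_succ_iff.1 (Nat.mod_lt _ (by omega))
    · rintro ⟨z, c₁, c₂, hz, h₁, h₂, hcomb, hi, hc⟩
      -- Unpacking of the counter value that encodes the triple `z`, `c₁`, `c₂`.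
      have e1 : ((z * (n + 1) + c₁) * (n + 1) + c₂) / (n + 1) = z * (n + 1) + c₁ := by
        rw [mul_comm, Nat.mul_add_div (by omega), Nat.div_eq_of_lt (by omega), add_zero]
      have e2 : ((z * (n + 1) + c₁) * (n + 1) + c₂) % (n + 1) = c₂ := by
        rw [mul_comm, Nat.mul_add_mod, Nat.mod_eq_of_lt (by omega)]
      have e3 : ((z * (n + 1) + c₁) * (n + 1) + c₂) / ((n + 1) * (n + 1)) = z := by
        rw [← Nat.div_div_eq_div_mul, e1, mul_comm, Nat.mul_add_div (by omega),
          Nat.div_eq_of_lt (by omega), add_zero]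
      have e4 : (z * (n + 1) + c₁) % (n + 1) = c₁ := by
        rw [mul_comm, Nat.mul_add_mod, Nat.mod_eq_of_lt (by omega)]
      refine ⟨(z * (n + 1) + c₁) * (n + 1) + c₂, ?_, ?_⟩
      · have h1 : (z * (n + 1) + c₁) * (n + 1) + c₂ < (z + 1) * ((n + 1) * (n + 1)) := by nlinarith
        exact h1.trans_le (Nat.mul_le_mul_right _ hz)
      · rw [e1, e2, e3, e4]; exact ⟨hcomb, hi, hc⟩

/-- The current table of the node `t` is correct with respect to the nodes in `W`. -/
structure TableOk (Adj : ℕ → ℕ → Prop) (τ : ℕ → ℕ) (X : ℕ → ℕ → Prop) (n m : ℕ) (a : State) (t : ℕ)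
    (W : Set ℕ) : Prop where
  sound : ∀ d c, (∀ u, d u < 8) → c ≤ n → Entry τ n m a (a.mem 7 t) (X t) d c →
    PartialSol Adj τ X n W t d c
  complete : ∀ x g, IsSol Adj τ X x g →
    Entry τ n m a (a.mem 7 t) (X t) (solLabel Adj τ X W x g) (forgotten X n W t x)

theorem forgotten_le (W : Set ℕ) (p : ℕ) (x : ℕ → Prop) : forgotten X n W p x ≤ n := by
  classical
  unfold forgotten
  exact (Finset.card_filter_le _ _).trans (by simp)

/-- With no nodes below, nothing is forgotten and no component has been hit, so a label fits iff it
promises no hit and the count is 0; `x` and `g` may be read off the label. -/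
theorem TableOk.empty {a : State} {t : ℕ} (h : a.mem 7 t = 0) : TableOk Adj τ X n m a t ∅ := by
  classical
  have hforg : ∀ x, forgotten X n ∅ t x = 0 := fun x => by simp [forgotten, Covers]
  have hhit : ∀ x g b, ¬ Hit Adj τ X ∅ x g b := fun x g b h => by
    obtain ⟨_, _, t, ht, _⟩ := h
    exact ht
  constructor
  · rintro d c - - (⟨-, hc, hd⟩ | ⟨hv, -⟩)
    · refine ⟨fun u => Bit (d u) 0, fun u => Bit (d u) 1, ?_, fun u _ => Iff.rfl,
        fun u _ _ => Iff.rfl, ?_, ?_, by rw [hforg, hc]⟩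
      · rintro t ⟨⟩
      · intro u hu hτ j hj hbit
        interval_cases j
        · exact absurd hbit (hd u hu hτ).1
        · exact absurd hbit (hd u hu hτ).2
      · rintro b - ⟨c, -, t, ⟨⟩, -⟩
    · exact absurd h hv
  · intro x g _
    refine .inl ⟨h, hforg x, fun u _ hτ => ⟨?_, ?_⟩⟩
    · rw [solLabel, bit_threeBits_one]
      rintro (h | h)
      · exact hhit _ _ _ h.2
      · exact h.1 hτ
    · rw [solLabel, bit_threeBits_two]
      exact fun h => hhit _ _ _ h.2

theorem TableOk.congr {a a' : State} {t : ℕ} {W : Set ℕ} (h : TableOk Adj τ X n m a t W)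
    (h7 : a'.mem 7 t = a.mem 7 t) (h11 : ∀ i c, c ≤ n →
      a'.mem 11 (cellIdx n m (a.mem 7 t) i c) = a.mem 11 (cellIdx n m (a.mem 7 t) i c)) :
    TableOk Adj τ X n m a' t W := by
  constructor
  · intro d c hd hc he
    rw [h7, Entry.congr fun i => h11 i c hc] at he
    exact h.sound d c hd hc he
  · intro x g hsol
    rw [h7, Entry.congr fun i => h11 i _ (forgotten_le _ _ _)]
    exact h.complete x g hsol

theorem jointLabel_lt (s p z u : ℕ) : jointLabel X s p z u < 32 := by
  unfold jointLabel digit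
  refine (Nat.mod_lt _ (one_le_base (by omega) _ u)).trans_le ?_
  unfold base; split_ifs <;> omega

/-- Soundness is `PartialSol.merge`. Completeness is `IsSol.merge`, applied to the exact joint
label, whose code is among those enumerated. -/
theorem TableOk.merge (hr : Ranges Adj X n) (hsym : ∀ u v, Adj u v → Adj v u)
    (hedge : ∀ u v, Adj u v → ∃ t, X t u ∧ X t v) {a a' : State} {s p : ℕ} {Ws Wp : Set ℕ}
    (hp : TableOk Adj τ X n m a p Wp) (hs : TableOk Adj τ X n m a s Ws)
    (hsep : Separates X (insert s Ws) s p) (hWp : Wp ⊆ (insert s Ws)ᶜ) (h7 : a'.mem 7 p = s + 1)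
    (h11 : ∀ i c, c ≤ n → (a'.mem 11 (cellIdx n m (s + 1) i c) ≠ 0 ↔ ∃ z c₁ c₂,
        z < place (base 32 fun u => X s u ∨ X p u) n ∧ c₁ ≤ n ∧ c₂ ≤ n ∧
        Combines Adj τ X n m a s p z c₁ c₂ ∧
        i = code n 8 (X p) (newLabel Adj τ X s p (jointLabel X s p z)) ∧
        c = c₁ + c₂ + newForgotten X n s p (jointLabel X s p z))) :
    TableOk Adj τ X n m a' p (Wp ∪ insert s Ws) := by
  constructor
  · intro d c hd hc he
    rw [h7] at he
    rcases he with ⟨h0, -⟩ | ⟨-, he⟩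
    · omega
    · rw [h11 _ _ hc] at he
      obtain ⟨z, c₁, c₂, -, hc₁, hc₂, ⟨e1, e2, hok, -⟩, hcode, rfl⟩ := he
      have j1 : ∀ u, parentPart (jointLabel X s p z) u < 8 := fun u => Nat.mod_lt _ (by omega)
      have j2 : ∀ u, childPart (jointLabel X s p z) u < 8 := fun u => by
        have := jointLabel_lt (X := X) s p z u
        unfold childPart; omega
      refine (PartialSol.merge hsym hsep hWp (hp.sound _ _ j1 hc₁ e1) (hs.sound _ _ j2 hc₂ e2)
        hok).congr fun u hu => ?_
      -- A code determines a label only on the bag, which is all that `PartialSol` depends on.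
      exact (eq_of_code_eq hd (fun u => threeBits_lt) hcode (hr.bag_lt _ _ hu) hu).symm
  · intro x g hsol
    obtain ⟨e, he, hok, hep, hes, hnew, hforg⟩ := hsol.merge (n := n) hsym hedge hsep hWp
    refine .inr ⟨by omega, ?_⟩
    rw [h7, h11 _ _ (forgotten_le _ _ _)]
    set U : ℕ → Prop := fun u => X s u ∨ X p u with hU
    -- The decoded label agrees with `e` only on the two bags, so the conditions are transferred
    -- below; each of them looks at the label inside these bags only.
    set z := code n 32 U e with hz
    have hje : ∀ u, U u → jointLabel X s p z u = e u := fun u hu =>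
      digit_code he (hu.elim (hr.bag_lt _ _) (hr.bag_lt _ _)) hu
    have hjs : ∀ u, X s u → jointLabel X s p z u = e u := fun u hu => hje u (.inl hu)
    have hjp : ∀ u, X p u → jointLabel X s p z u = e u := fun u hu => hje u (.inr hu)
    have hok' : MergeOk Adj τ X s p (jointLabel X s p z) ∧
        (∀ b, NewHit Adj τ X s p (jointLabel X s p z) b ↔ NewHit Adj τ X s p e b) := by
      have hwit : ∀ b w, X s w → (Witness Adj τ (fun w => Bit (jointLabel X s p z w) 0)
          (fun w => Bit (childPart (jointLabel X s p z) w) 1) b w ↔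
          Witness Adj τ (fun w => Bit (e w) 0) (fun w => Bit (childPart e w) 1) b w) := by
        intro b w hw
        simp only [Witness, childPart, hjs w hw]
      have hnh : ∀ b, NewHit Adj τ X s p (jointLabel X s p z) b ↔ NewHit Adj τ X s p e b := by
        intro b
        unfold NewHit
        refine exists_congr fun c => and_congr_right fun _ => or_congr ?_ ?_
        · refine and_congr_right fun hc => ?_
          simp only [parentPart, hjp _ hc]
        · refine and_congr_right fun hc => or_congr ?_ (exists_congr fun w => and_congr_right fun hw => ?_)
          · simp only [childPart, hjs _ hc]
          · exact hwit c w hw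
      refine ⟨⟨?_, ?_, ?_⟩, hnh⟩
      · refine hok.valid.congr (fun u hu => ?_) fun u hu _ => ?_
        · simp only [hjs u hu]
        · simp only [childPart, hjs u hu]
      · intro u hup hus hτ
        have := hok.agree u hup hus hτ
        simpa only [parentPart, childPart, hjs u hus] using this
      · intro b hb hreq
        rw [hnh]
        exact hok.hit b hb hreq
    have hnf : newForgotten X n s p (jointLabel X s p z) = newForgotten X n s p e := by
      unfold newForgotten
      congr 1
      ext u
      simp only [Finset.mem_filter]
      refine and_congr_right fun _ => and_congr_right fun hu => ?_
      rw [hjs u hu]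
    refine ⟨z, forgotten X n Wp p x, forgotten X n Ws s x, code_lt he, forgotten_le _ _ _,
      forgotten_le _ _ _, ⟨?_, ?_, hok'.1, ?_⟩, ?_, ?_⟩
    · have := hp.complete x g hsol
      rw [← hep] at this
      refine (Entry.label_congr fun u hu => ?_).2 this
      simp only [parentPart, hjp u hu]
    · have := hs.complete x g hsol
      rw [← hes] at this
      refine (Entry.label_congr fun u hu => ?_).2 this
      simp only [childPart, hjs u hu]
    · rw [hnf, ← hforg]; exact forgotten_le _ _ _
    · refine code_congr fun u hu => ?_
      rw [← hnew u hu]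
      simp only [newLabel, hok'.2, hjp u hu, parentPart]
    · rw [hnf, ← hforg]

end

end WordRAM

namespace NatTree

/-! ### A queue of the nodes of a tree -/

variable {m : ℕ} {par : ℕ → ℕ} {P : Set ℕ} {s t : ℕ}

open Classical in
/-- The number of children of `t` that are not in `P`. -/
noncomputable def openChildren (m : ℕ) (par : ℕ → ℕ) (P : Set ℕ) (t : ℕ) : ℕ :=
  ((Finset.range m).filter fun c => par c = t ∧ c ∉ P).card

theorem openChildren_eq_zero : openChildren m par P t = 0 ↔ ∀ c < m, par c = t → c ∈ P := by
  classical
  simp [openChildren, Finset.filter_eq_empty_iff]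

theorem openChildren_le : openChildren m par P t ≤ m := by
  classical
  exact (Finset.card_filter_le _ _).trans (by simp)

theorem openChildren_insert (hs : s < m) (hP : s ∉ P) :
    openChildren m par P (par s) = openChildren m par (insert s P) (par s) + 1 := by
  classical
  rw [openChildren, openChildren, ← Finset.card_insert_of_notMem (a := s) (by simp)]
  congr 1
  ext c
  by_cases hc : c = s
  · simp [hc, hs, hP]
  · simp [hc]

theorem openChildren_insert_of_ne (ht : par s ≠ t) :
    openChildren m par (insert s P) t = openChildren m par P t := by
  classical
  unfold openChildren
  congr 1
  ext c
  by_cases hc : c = s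
  · simp [hc, ht]
  · simp [hc]

end NatTree

namespace WordRAM

open NonMonotone MixedRadix NatTree

/-- The computation of the numbers of children. -/
def countProg : Prog :=
  forLoop 5 3 (cond (.eq (.reg 5) (.reg 4)) .skip
    (put 5 (.load 2 (.reg 5)) (.add (.load 5 (.load 2 (.reg 5))) (.lit 1))))

/-- The running time of one round of the loop in `countProg`. -/
noncomputable def countTime : Polynomial ℕ :=
  condTime (.eq (.reg 5) (.reg 4)) +
    (putTime (.load 2 (.reg 5)) (.add (.load 5 (.load 2 (.reg 5))) (.lit 1)) + 1)

/-- The initialization of the queue with the leaves. -/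
def leafProg : Prog :=
  forLoop 5 3 (cond (.load 5 (.reg 5)) .skip
    (.seq (put 6 (.reg 8) (.reg 5)) (set 8 (.add (.reg 8) (.lit 1)))))

/-- The running time of one round of the loop in `leafProg`. -/
noncomputable def leafTime : Polynomial ℕ :=
  condTime (.load 5 (.reg 5)) + (putTime (.reg 8) (.reg 5) + setTime (.add (.reg 8) (.lit 1)) + 1)

/-- The update of the queue after the combination of the node in the register `6` with its parent in
the register `7`. -/
def pushProg : Prog :=
  cond (.eq (.reg 6) (.reg 4)) .skip <|
    .seq (put 5 (.reg 7) (.sub (.load 5 (.reg 7)) (.lit 1))) <|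
    cond (.load 5 (.reg 7)) .skip
      (.seq (put 6 (.reg 8) (.reg 7)) (set 8 (.add (.reg 8) (.lit 1))))

/-- The running time of `pushProg`. -/
noncomputable def pushTime : Polynomial ℕ :=
  condTime (.eq (.reg 6) (.reg 4)) + (putTime (.reg 7) (.sub (.load 5 (.reg 7)) (.lit 1)) +
    (condTime (.load 5 (.reg 7)) + (putTime (.reg 8) (.reg 7) + setTime (.add (.reg 8) (.lit 1)) + 1)) + 1)

/-- The number of nodes, the root and the parents of the other nodes are in the registers `3`, `4` and
in the array `2`. -/
structure TreeInp (m root : ℕ) (par : ℕ → ℕ) (a : State) : Prop where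
  r3 : a.reg 3 = m
  r4 : a.reg 4 = root
  par : ∀ s < m, s ≠ root → a.mem 2 s = par s

/-- The array `6` is a queue with end `a.reg 8`, whose first `h` elements are the elements of `P`. The
array `5` holds the numbers of children that are not in `P`, and the nodes for which this number is
`0` are in the queue. -/
structure Queue (m : ℕ) (par : ℕ → ℕ) (P : Set ℕ) (h : ℕ) (a : State) : Prop where
  mem_iff : ∀ s, s ∈ P ↔ ∃ j < h, a.mem 6 j = s
  le_tail : h ≤ a.reg 8
  lt : ∀ j < a.reg 8, a.mem 6 j < m
  inj : ∀ j < a.reg 8, ∀ k < a.reg 8, a.mem 6 j = a.mem 6 k → j = k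
  count : ∀ t < m, a.mem 5 t = openChildren m par P t
  ready : ∀ t < m, a.mem 5 t = 0 ↔ ∃ j < a.reg 8, a.mem 6 j = t

/-! ### Correctness of the queue. -/

section

variable {m root h : ℕ} {par : ℕ → ℕ} {P : Set ℕ} {π : Params}

theorem TreeInp.frame {R A : Finset ℕ} {a a' : State} (h : TreeInp m root par a)
    (hf : Frame R A a a') (hR : 3 ∉ R ∧ 4 ∉ R) (hA : 2 ∉ A) : TreeInp m root par a' := by
  obtain ⟨h3, h4, hp⟩ := h
  refine ⟨?_, ?_, ?_⟩
  · rw [hf.reg _ hR.1, h3]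
  · rw [hf.reg _ hR.2, h4]
  · rwa [hf.mem _ hA]

theorem Queue.frame {R A : Finset ℕ} {a a' : State} (hq : Queue m par P h a)
    (hf : Frame R A a a') (hR : 8 ∉ R) (hA : 5 ∉ A ∧ 6 ∉ A) : Queue m par P h a' := by
  obtain ⟨h1, h2, h3, h4, h5, h6⟩ := hq
  refine ⟨?_, ?_, ?_, ?_, ?_, ?_⟩ <;> simpa only [hf.reg _ hR, hf.mem _ hA.1, hf.mem _ hA.2]

theorem Queue.tail_le {a : State} (hq : Queue m par P h a) : a.reg 8 ≤ m := by
  have := Finset.card_le_card_of_injOn (s := Finset.range (a.reg 8)) (t := Finset.range m) (a.mem 6)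
    (fun j hj => by simpa using hq.lt j (by simpa using hj))
    (fun j hj k hk => hq.inj j (by simpa using hj) k (by simpa using hk))
  simpa using this

/-- The queue never runs dry: while fewer than `m` nodes are processed, some unprocessed node is
ready, hence queued, and its position is not among the first `h`. -/
theorem Queue.lt_tail {a : State} (hT : IsTree m par) (hq : Queue m par P h a) (hm : h < m) :
    h < a.reg 8 := by
  classical
  obtain ⟨s, hs, hsP, hc⟩ := exists_ready hT P <| by
    by_contra hcon
    push Not at hcon
    have : Finset.range m ⊆ (Finset.range h).image (a.mem 6) := fun s hs => by
      obtain ⟨j, hj, rfl⟩ := (hq.mem_iff s).1 (hcon s (by simpa using hs))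
      exact Finset.mem_image_of_mem _ (by simpa using hj)
    have := (Finset.card_le_card this).trans Finset.card_image_le
    simp at this
    omega
  obtain ⟨j, hj, hjs⟩ := (hq.ready s hs).1 (by rw [hq.count s hs, openChildren_eq_zero]; exact hc)
  have : ¬ j < h := fun hjh => hsP ((hq.mem_iff s).2 ⟨j, hjh, hjs⟩)
  omega

/-- The first node in the queue that is not in `P`. -/
theorem Queue.next {a : State} (hT : IsTree m par) (hq : Queue m par P h a) (hm : h < m) :
    a.mem 6 h < m ∧ a.mem 6 h ∉ P ∧ ∀ c < m, par c = a.mem 6 h → c ∈ P := by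
  have hlt := hq.lt_tail hT hm
  have hs := hq.lt h hlt
  refine ⟨hs, fun hP => ?_, ?_⟩
  · obtain ⟨j, hj, hjs⟩ := (hq.mem_iff _).1 hP
    have := hq.inj j (by omega) h hlt hjs
    omega
  · rw [← openChildren_eq_zero, ← hq.count _ hs]
    exact (hq.ready _ hs).2 ⟨h, hlt, rfl⟩

theorem runs_countProg (hroot : par root = m) (hpar : ∀ s < m, s ≠ root → par s < m) {a : State}
    (hi : TreeInp m root par a) (h5 : ∀ y, a.mem 5 y = 0) (hlt : m < π.M) {Q : State → Prop}
    (hQ : ∀ a', Frame {5} {5} a a' → (∀ t < m, a'.mem 5 t = openChildren m par ∅ t) → Q a') :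
    Runs π countProg a (m * (countTime.eval π.N + 8) + 6) Q := by
  classical
  unfold countProg
  refine Runs.forLoop (by omega) (by decide) (by decide) hi.r3 (by omega)
    (fun i a' => Frame {5} {5} a a' ∧ ∀ t < m, a'.mem 5 t = openChildren i par ∅ t) ?_ ?_ ?_
  · refine ⟨(Frame.refl _ _ a).setReg (by decide) _, fun t _ => ?_⟩
    simp [openChildren, h5]
  · rintro i hi' a' - r5 r3 ⟨hf, hc⟩
    have hi₁ := hi.frame hf (by decide) (by decide)
    have hsucc : ∀ t, openChildren (i + 1) par ∅ t =
        openChildren i par ∅ t + if par i = t then 1 else 0 := by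
      intro t
      simp only [openChildren, Finset.range_add_one, Finset.filter_insert, Set.mem_empty_iff_false,
        not_false_eq_true, and_true]
      split_ifs <;> simp
    simp only [countTime, Polynomial.eval_add, Polynomial.eval_one]
    refine Runs.whenNot (by decide) (fun hh => ?_) fun hh => ?_
    · rw [Tm.holds_eq] at hh
      simp only [Tm.eval, r5, hi₁.r4] at hh
      refine ⟨r5, r3, hf.setReg (by decide) _, fun t ht => ?_⟩
      rw [setReg_mem, hsucc, if_neg (by rw [hh, hroot]; omega), hc t ht, add_zero]
    · rw [Tm.holds_eq] at hh
      simp only [Tm.eval, r5, hi₁.r4] at hh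
      have e2 : a'.mem 2 i = par i := hi₁.par i hi' hh
      have hp := hpar i hi' hh
      refine Runs.put' (k := par i) (v := openChildren i par ∅ (par i) + 1) (by decide) (by decide)
        (by simp only [Tm.eval, r5, e2]) (by simp only [Tm.eval, r5, e2, hc _ hp]) ?_ ?_
      · have := openChildren_le (m := i) (par := par) (P := ∅) (t := par i)
        omega
      · refine ⟨r5, r3, (hf.setMem (by decide) _ _).setReg (by decide) _, fun t ht => ?_⟩
        rw [setReg_mem, setMem_mem_self, Function.update_apply, hsucc]
        split_ifs with h1 h2 h2
        · rw [h1]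
        · exact absurd h1.symm h2
        · exact absurd h2.symm h1
        · rw [hc t ht, add_zero]
  · rintro a' - ⟨hf, hc⟩
    exact hQ a' hf hc

theorem runs_leafProg {a : State} (h3 : a.reg 3 = m) (h8 : a.reg 8 = 0)
    (hc : ∀ t < m, a.mem 5 t = openChildren m par ∅ t) (hlt : m < π.M) {Q : State → Prop}
    (hQ : ∀ a', Frame {5, 8} {6} a a' → Queue m par ∅ 0 a' → Q a') :
    Runs π leafProg a (m * (leafTime.eval π.N + 8) + 6) Q := by
  unfold leafProg
  refine Runs.forLoop (by omega) (by decide) (by decide) h3 (by omega)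
    (fun i a' => Frame {5, 8} {6} a a' ∧ a'.reg 8 ≤ i ∧ (∀ j < a'.reg 8, a'.mem 6 j < i) ∧
      (∀ j < a'.reg 8, ∀ k < a'.reg 8, a'.mem 6 j = a'.mem 6 k → j = k) ∧
      ∀ t < i, a.mem 5 t = 0 ↔ ∃ j < a'.reg 8, a'.mem 6 j = t) ?_ ?_ ?_
  · refine ⟨(Frame.refl _ _ a).setReg (by decide) _, ?_⟩
    simp [setReg_reg, h8]
  · rintro i hi a' - r5 r3 ⟨hf, h1, h2, h3, h4⟩
    have e5 : a'.mem 5 = a.mem 5 := hf.mem 5 (by decide)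
    simp only [leafTime, Polynomial.eval_add, Polynomial.eval_one]
    refine Runs.whenNot (by decide) (fun hh => ?_) fun hh => ?_
    · rw [Tm.holds_load] at hh
      simp only [Tm.eval, r5, e5] at hh
      refine ⟨r5, r3, hf.setReg (by decide) _, ?_⟩
      simp only [setReg_reg_of_ne _ (x := 5) (y := 8) _ (by omega), setReg_mem]
      refine ⟨by omega, fun j hj => (h2 j hj).trans (by omega), h3, fun t ht => ?_⟩
      rcases Nat.lt_succ_iff_lt_or_eq.1 ht with ht | rfl
      · exact h4 t ht
      · refine iff_of_false hh ?_
        rintro ⟨j, hj, hjt⟩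
        exact absurd (h2 j hj) (by omega)
    · rw [Tm.holds_load, not_not] at hh
      simp only [Tm.eval, r5, e5] at hh
      set b := a'.reg 8 with hb
      refine Runs.seq (Runs.put' (k := b) (v := i) (by decide) (by decide) rfl r5 (by omega) ?_)
      refine Runs.set' (v := b + 1) (by decide) (by omega) rfl (by omega) ?_
      refine ⟨?_, ?_, ?_, ?_⟩
      · rw [setReg_reg_of_ne _ _ (by omega)]; exact r5
      · rw [setReg_reg_of_ne _ _ (by omega)]; exact r3
      · exact ((hf.setMem (by decide) _ _).setReg (by decide) _).setReg (by decide) _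
      · simp only [setReg_reg_of_ne _ (x := 5) (y := 8) _ (by omega), setReg_mem, setReg_reg_self,
          setMem_mem_self, Function.update_apply]
        refine ⟨by omega, fun j hj => ?_, fun j hj k hk => ?_, fun t ht => ?_⟩
        · split_ifs with hjb
          · omega
          · exact (h2 j (by omega)).trans (by omega)
        · split_ifs with hjb hkb hkb
          · omega
          · intro he; have := h2 k (by omega); omega
          · intro he; have := h2 j (by omega); omega
          · exact h3 j (by omega) k (by omega)
        · rcases Nat.lt_succ_iff_lt_or_eq.1 ht with ht | rfl
          · rw [h4 t ht]
            constructor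
            · rintro ⟨j, hj, hjt⟩
              exact ⟨j, by omega, by rw [if_neg (by omega), hjt]⟩
            · rintro ⟨j, hj, hjt⟩
              split_ifs at hjt with hjb
              · omega
              · exact ⟨j, by omega, hjt⟩
          · exact iff_of_true hh ⟨b, by omega, if_pos rfl⟩
  · rintro a' - ⟨hf, h1, h2, h3, h4⟩
    refine hQ a' hf ⟨by simp, by omega, h2, h3, ?_, ?_⟩
    · rwa [hf.mem 5 (by decide)]
    · rwa [hf.mem 5 (by decide)]

/-- Only the parent loses an open child. It enters the queue exactly when its count drops to 0, that
is, once. The root is exempt because its parent is the additional node, which is never queued. -/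
theorem runs_pushProg (hT : IsTree m par) (hroot : par root = m)
    (hpar : ∀ s < m, s ≠ root → par s < m) {a : State} {s : ℕ} (hi : TreeInp m root par a)
    (hq : Queue m par P h a) (hm : h < m) (h6 : a.reg 6 = s) (h7 : a.reg 7 = par s)
    (hs : s = a.mem 6 h) (hlt : m + 1 < π.M)
    {Q : State → Prop}
    (hQ : ∀ a', Frame {8} {5, 6} a a' → Queue m par (insert s P) (h + 1) a' → Q a') :
    Runs π pushProg a (pushTime.eval π.N) Q := by
  obtain ⟨hsm, hsP, -⟩ := hq.next hT hm
  rw [← hs] at hsm hsP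
  have htail := hq.lt_tail hT hm
  have htl := hq.tail_le
  have hmem : ∀ a' : State, (∀ j ≤ h, a'.mem 6 j = a.mem 6 j) →
      ∀ u, u ∈ insert s P ↔ ∃ j < h + 1, a'.mem 6 j = u := by
    intro a' he u
    rw [Set.mem_insert_iff, hq.mem_iff]
    constructor
    · rintro (rfl | ⟨j, hj, hju⟩)
      · exact ⟨h, by omega, by rw [he _ le_rfl, hs]⟩
      · exact ⟨j, by omega, by rw [he _ (by omega), hju]⟩
    · rintro ⟨j, hj, hju⟩
      rw [he j (by omega)] at hju
      rcases Nat.lt_succ_iff_lt_or_eq.1 hj with hj | rfl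
      · exact .inr ⟨j, hj, hju⟩
      · exact .inl (by rw [hs, hju])
  unfold pushProg
  simp only [pushTime, Polynomial.eval_add, Polynomial.eval_one]
  refine Runs.whenNot (by decide) (fun hh => ?_) fun hh => ?_
  · rw [Tm.holds_eq] at hh
    simp only [Tm.eval, h6, hi.r4] at hh
    refine hQ a (Frame.refl _ _ a) ⟨hmem a fun _ _ => rfl, htail, hq.lt, hq.inj, fun t ht => ?_,
      hq.ready⟩
    rw [openChildren_insert_of_ne (by rw [hh, hroot]; omega), hq.count t ht]
  · rw [Tm.holds_eq] at hh
    simp only [Tm.eval, h6, hi.r4] at hh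
    have hp := hpar s hsm hh
    have hcnt : a.mem 5 (par s) = openChildren m par (insert s P) (par s) + 1 := by
      rw [hq.count _ hp, openChildren_insert hsm hsP]
    have hle := openChildren_le (m := m) (par := par) (P := insert s P) (t := par s)
    refine Runs.seq (Runs.put' (k := par s) (v := openChildren m par (insert s P) (par s))
      (by decide) (by decide) h7 (by simp only [Tm.eval, h7, hcnt]; omega) (by omega) ?_)
    set a₁ := a.setMem 5 (par s) (openChildren m par (insert s P) (par s)) with ha₁
    have f₁ : Frame {8} {5, 6} a a₁ := (Frame.refl _ _ a).setMem (by decide) _ _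
    have m5 : a₁.mem 5 = Function.update (a.mem 5) (par s)
        (openChildren m par (insert s P) (par s)) := setMem_mem_self _ _ _ _
    have m6 : a₁.mem 6 = a.mem 6 := setMem_mem_of_ne _ _ _ (by omega)
    have r1 : a₁.reg = a.reg := rfl
    have hcount : ∀ t < m, a₁.mem 5 t = openChildren m par (insert s P) t := by
      intro t ht
      rw [m5, Function.update_apply]
      split_ifs with h1
      · rw [h1]
      · rw [hq.count t ht, openChildren_insert_of_ne (Ne.symm h1)]
    have hready : ∀ t < m, t ≠ par s →
        (a₁.mem 5 t = 0 ↔ ∃ j < a.reg 8, a.mem 6 j = t) := by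
      intro t ht hne
      rw [m5, Function.update_of_ne hne, hq.ready t ht]
    -- The parent had an open child, so it was not ready and is not in the queue; this keeps the
    -- queue free of repetitions.
    have hnot : ∀ j < a.reg 8, a.mem 6 j ≠ par s := by
      intro j hj hjs
      have := (hq.ready _ hp).2 ⟨j, hj, hjs⟩
      omega
    clear_value a₁
    refine Runs.whenNot (by decide) (fun hc => ?_) fun hc => ?_
    · rw [Tm.holds_load] at hc
      simp only [Tm.eval, r1, h7] at hc
      refine hQ a₁ f₁ ⟨hmem a₁ fun _ _ => by rw [m6], by rw [r1]; exact htail, ?_, ?_, hcount, ?_⟩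
      · rw [r1, m6]; exact hq.lt
      · rw [r1, m6]; exact hq.inj
      · intro t ht
        rw [r1, m6]
        by_cases hne : t = par s
        · rw [hne]
          exact iff_of_false hc fun ⟨j, hj, hjs⟩ => hnot j hj hjs
        · exact hready t ht hne
    · rw [Tm.holds_load, not_not] at hc
      simp only [Tm.eval, r1, h7] at hc
      refine Runs.seq (Runs.put' (k := a.reg 8) (v := par s) (by decide) (by decide)
        (by simp only [Tm.eval, r1]) (by simp only [Tm.eval, r1, h7]) (by omega) ?_)
      refine Runs.set' (v := a.reg 8 + 1) (by decide) (by omega) (by rw [← r1]; rfl) (by omega) ?_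
      have m6' : ((a₁.setMem 6 (a.reg 8) (par s)).setReg 8 (a.reg 8 + 1)).mem 6 =
          Function.update (a.mem 6) (a.reg 8) (par s) := by
        rw [setReg_mem, setMem_mem_self, m6]
      have m5' : ((a₁.setMem 6 (a.reg 8) (par s)).setReg 8 (a.reg 8 + 1)).mem 5 = a₁.mem 5 := by
        rw [setReg_mem, setMem_mem_of_ne _ _ _ (by omega)]
      have hold : ∀ j < a.reg 8, Function.update (a.mem 6) (a.reg 8) (par s) j = a.mem 6 j :=
        fun j hj => Function.update_of_ne (by omega) _ _
      refine hQ _ ((f₁.setMem (by decide) _ _).setReg (by decide) _) ⟨hmem _ fun j hj => ?_, ?_, ?_,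
        ?_, ?_, ?_⟩
      · rw [m6', hold j (by omega)]
      · rw [setReg_reg_self]; omega
      · rw [setReg_reg_self, m6']
        intro j hj
        rcases Nat.lt_succ_iff_lt_or_eq.1 hj with hj | rfl
        · rw [hold j hj]; exact hq.lt j hj
        · rwa [Function.update_self]
      · rw [setReg_reg_self, m6']
        intro j hj k hk he
        rcases Nat.lt_succ_iff_lt_or_eq.1 hj with hj | rfl <;>
          rcases Nat.lt_succ_iff_lt_or_eq.1 hk with hk | rfl
        · rw [hold j hj, hold k hk] at he
          exact hq.inj j hj k hk he
        · rw [hold j hj, Function.update_self] at he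
          exact absurd he (hnot j hj)
        · rw [hold k hk, Function.update_self] at he
          exact absurd he.symm (hnot k hk)
        · rfl
      · rw [m5']; exact hcount
      · rw [setReg_reg_self, m6', m5']
        intro t ht
        by_cases hne : t = par s
        · rw [hne]
          exact iff_of_true hc ⟨a.reg 8, by omega, Function.update_self _ _ _⟩
        · rw [hready t ht hne]
          constructor
          · rintro ⟨j, hj, hjt⟩
            exact ⟨j, by omega, by rw [hold j hj, hjt]⟩
          · rintro ⟨j, hj, hjt⟩
            rcases Nat.lt_succ_iff_lt_or_eq.1 hj with hj | rfl
            · exact ⟨j, hj, by rw [← hold j hj, hjt]⟩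
            · rw [Function.update_self] at hjt
              exact absurd hjt.symm hne

end

end WordRAM

namespace WordRAM

open NonMonotone MixedRadix NatTree

/-! ### The complete program -/

/-- The combination of the node in the register `6` with its parent. -/
def mergeProg : Prog :=
  .seq (set 7 (.load 2 (.reg 6))) <|
  .seq (cond (.eq (.reg 6) (.reg 4)) (set 7 (.reg 3)) .skip) <|
  .seq placeProg <| .seq tableProg (put 7 (.reg 7) (.add (.reg 6) (.lit 1)))

/-- The running time of `mergeProg`, up to the number of codes of joint labels. -/
noncomputable def mergeTime : Polynomial ℕ :=
  setTime (.load 2 (.reg 6)) + (condTime (.eq (.reg 6) (.reg 4)) + (setTime (.reg 3) + 1) +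
  (placeTime + (setTime (.mul (.reg 9) (.mul (.reg 2) (.reg 2))) +
    (Polynomial.X * Polynomial.X * (pairTime + 8) + 6) + putTime (.reg 7) (.add (.reg 6) (.lit 1)))))

/-- The combination of the next node of the queue with its parent. -/
def stepProg : Prog := .seq (set 6 (.load 6 (.reg 5))) (.seq mergeProg pushProg)

/-- The running time of `stepProg`, up to the number of codes of joint labels. -/
noncomputable def stepTime : Polynomial ℕ := setTime (.load 6 (.reg 5)) + (mergeTime + pushTime)

/-- The smallest number in the table of the additional root. -/
def Tm.minEntry : Tm :=
  .sum 20 2 (.not (.ex 21 2 (.and (.le (.reg 21) (.reg 20))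
    (.load 11 (.cell (.load 7 (.reg 3)) (.lit 0) (.reg 21))))))

/-- The program after the preparation of the registers. -/
def solveProg : Prog :=
  .seq closureProg <| .seq countProg <| .seq leafProg <| .seq (forLoop 5 3 stepProg)
    (set 19 .minEntry)

/-- The running time of `solveProg`, up to the number of nodes and the number of codes of joint
labels. -/
noncomputable def solveTime : Polynomial ℕ :=
  closureTime + (countTime + 8 + 6 + (leafTime + 8 + 6 + (stepTime + 8 + 6 + setTime .minEntry)))

/-- The array `7` holds the numbers of the current tables, and these are correct with respect to the
nodes below the children in `P`. The other tables are empty. -/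
structure Tables (Adj : ℕ → ℕ → Prop) (τ : ℕ → ℕ) (X : ℕ → ℕ → Prop) (n m root : ℕ) (par : ℕ → ℕ)
    (P : Set ℕ) (a : State) : Prop where
  table : ∀ t ≤ m, TableOk Adj τ X n m a t (Below m par P t)
  number : ∀ t ≤ m, a.mem 7 t = 0 ∨ ∃ c ∈ P, c < m ∧ a.mem 7 t = c + 1
  fresh : ∀ s < m, s ∉ P → ∀ i c, c ≤ n → a.mem 11 (cellIdx n m (s + 1) i c) = 0
  root_number : root ∈ P → a.mem 7 m ≠ 0

/-! ### Correctness and running time of the main loop. -/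

section

variable {Adj : ℕ → ℕ → Prop} {τ : ℕ → ℕ} {X : ℕ → ℕ → Prop} {n m root h K : ℕ} {par : ℕ → ℕ}
  {P : Set ℕ} {π : Params}

theorem Tables.frame {R A : Finset ℕ} {a a' : State} (h : Tables Adj τ X n m root par P a)
    (hf : Frame R A a a') (hA : 7 ∉ A ∧ 11 ∉ A) : Tables Adj τ X n m root par P a' := by
  have e7 := hf.mem 7 hA.1
  have e11 := hf.mem 11 hA.2
  obtain ⟨h1, h2, h3, h4⟩ := h
  exact ⟨fun t ht => (h1 t ht).congr (by rw [e7]) fun _ _ _ => by rw [e11], by rwa [e7],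
    by rwa [e11], by rwa [e7]⟩

theorem HasLink.frame {R A : Finset ℕ} {a a' : State} (h : HasLink Adj τ n a)
    (hf : Frame R A a a') (hA : 4 ∉ A) : HasLink Adj τ n a' := by
  unfold HasLink
  rwa [hf.mem 4 hA]

/-- When all children of `s` are absorbed, its table describes everything strictly below it, and the
combination adds all descendants of `s`, itself included, to what the parent has seen. The result is
table number `s + 1`, so no table is ever cleared. -/
theorem runs_mergeProg (hr : Ranges Adj X n) (hsym : ∀ u v, Adj u v → Adj v u)
    (hedge : ∀ u v, Adj u v → ∃ t, X t u ∧ X t v) (hT : IsTree m par) (hroot : par root = m)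
    (hsep : ∀ s < m, Separates X (Desc m par s) s (par s))
    (hK : ∀ s < m, place (base 32 fun u => X s u ∨ X (par s) u) n ≤ K)
    (hKM : K * ((n + 1) * (n + 1)) < π.M) (hm : m < π.M) {a : State} {s : ℕ}
    (hi : Inp Adj τ X n m a) (hl : HasLink Adj τ n a) (ht : TreeInp m root par a)
    (htab : Tables Adj τ X n m root par P a) (hs : s < m) (hsP : s ∉ P)
    (hc : ∀ c < m, par c = s → c ∈ P) (h6 : a.reg 6 = s) {Q : State → Prop}
    (hQ : ∀ a', Frame {7, 9, 10, 11, 12, 13, 15, 16, 17, 18} {7, 8, 9, 10, 11} a a' →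
      a'.reg 7 = par s → Tables Adj τ X n m root par (insert s P) a' → Q a') :
    Runs π mergeProg a (K * mergeTime.eval π.N) Q := by
  refine Runs.of_bdd fun hb => ?_
  have hplace := hK s hs
  have hpos : 1 ≤ place (base 32 fun u => X s u ∨ X (par s) u) n :=
    Finset.one_le_prod' fun u _ => one_le_base (by omega) _ u
  have hN : n + 1 ≤ π.N := hi.r2 ▸ hb.len 2 (by omega)
  have hpm := hT.par_le s hs
  refine Runs.mono (T := (setTime (.load 2 (.reg 6))).eval π.N +
    ((condTime (.eq (.reg 6) (.reg 4))).eval π.N + ((setTime (.reg 3)).eval π.N + 1) +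
    (placeTime.eval π.N + ((setTime (.mul (.reg 9) (.mul (.reg 2) (.reg 2)))).eval π.N +
    (place (base 32 fun u => X s u ∨ X (par s) u) n * ((n + 1) * (n + 1)) *
      (pairTime.eval π.N + 8) + 6) +
    (putTime (.reg 7) (.add (.reg 6) (.lit 1))).eval π.N)))) (Q := Q) ?_ ?_ fun _ _ => id
  · unfold mergeProg
    -- In the input the root is its own parent; the conditional that follows replaces this value by
    -- the additional node `m`.
    refine Runs.seq (Runs.set' (v := a.mem 2 s) (by decide) (by omega)
      (by simp only [Tm.eval, h6]) (hb.mem _ _) ?_)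
    have key : ∀ a₁, Frame {7} ∅ a a₁ → a₁.reg 7 = par s → Runs π
        (.seq placeProg <| .seq tableProg (put 7 (.reg 7) (.add (.reg 6) (.lit 1)))) a₁
        (placeTime.eval π.N + ((setTime (.mul (.reg 9) (.mul (.reg 2) (.reg 2)))).eval π.N +
          (place (base 32 fun u => X s u ∨ X (par s) u) n * ((n + 1) * (n + 1)) *
            (pairTime.eval π.N + 8) + 6) +
          (putTime (.reg 7) (.add (.reg 6) (.lit 1))).eval π.N)) Q := by
      intro a₁ f₁ h7₁
      have i₁ := hi.frame f₁ (by decide) (by decide)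
      have h6₁ : a₁.reg 6 = s := by rw [f₁.reg 6 (by decide), h6]
      refine Runs.seq (runs_placeProg i₁ hs.le hpm h6₁ h7₁ ?_ ?_)
      · refine lt_of_le_of_lt ?_ hKM
        exact hplace.trans (Nat.le_mul_of_pos_right _ (by positivity))
      intro a₂ f₂ h9 p8 p9 p10
      have i₂ := i₁.frame f₂ (by decide) (by decide)
      have f₂' : Frame {7, 9, 10, 11, 13} {8, 9, 10} a a₂ :=
        (f₁.mono (by decide) (by decide)).trans (f₂.mono (by decide) (by decide))
      have t₂ := htab.frame f₂' (by decide)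
      have h6₂ : a₂.reg 6 = s := by rw [f₂'.reg 6 (by decide), h6]
      have h7₂ : a₂.reg 7 = par s := by rw [f₂.reg 7 (by decide), h7₁]
      have env : MergeEnv Adj τ X n m s (par s) (a₂.reg 15) a₂ :=
        ⟨i₂, hl.frame f₂' (by decide), hs.le, hpm, h6₂, h7₂, rfl, p8, p9, p10⟩
      -- Tables in use have number 0 or `c + 1` with `c` already processed, so table `s + 1` is
      -- still unused.
      have hnum : ∀ t ≤ m, a₂.mem 7 t ≤ m ∧ a₂.mem 7 t ≠ s + 1 := by
        intro t ht
        rcases t₂.number t ht with h0 | ⟨c, hc, hcm, h0⟩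
        · omega
        · have : c ≠ s := fun h => hsP (h ▸ hc)
          omega
      refine Runs.seq (runs_tableProg hr env hs h9 (hnum _ hpm).1 (hnum _ hpm).2 (hnum _ hs.le).1
        (hnum _ hs.le).2 (t₂.fresh s hs hsP) ?_ ?_)
      · exact (Nat.mul_le_mul_right _ hplace).trans_lt hKM
      intro a₃ f₃ hold hnew
      have h7₃ : a₃.reg 7 = par s := by rw [f₃.reg 7 (by decide), h7₂]
      have h6₃ : a₃.reg 6 = s := by rw [f₃.reg 6 (by decide), h6₂]
      have e7 : a₃.mem 7 = a₂.mem 7 := f₃.mem 7 (by decide)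
      refine Runs.put' (k := par s) (v := s + 1) (by decide) (by decide) h7₃
        (by simp only [Tm.eval, h6₃]) (by omega) ?_
      have m7 : (a₃.setMem 7 (par s) (s + 1)).mem 7 =
          Function.update (a₂.mem 7) (par s) (s + 1) := by rw [setMem_mem_self, e7]
      have m11 : (a₃.setMem 7 (par s) (s + 1)).mem 11 = a₃.mem 11 :=
        setMem_mem_of_ne _ _ _ (by omega)
      refine hQ _ ?_ h7₃ ⟨?_, ?_, ?_, ?_⟩
      · exact ((f₂'.mono (by decide) (by decide)).trans (f₃.mono (by decide) (by decide))).setMem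
          (by decide) _ _
      · intro t ht
        by_cases htp : par s = t
        · subst htp
          -- Since all children of `s` are in `P`, its descendants are `s` together with the nodes
          -- its table already accounts for, which is the shape needed for combining.
          rw [below_insert hs, desc_eq hT hs hc]
          have hsep' := hsep s hs
          have hcompl := below_subset_compl hT hs hsP
          rw [desc_eq hT hs hc] at hsep' hcompl
          refine TableOk.merge hr hsym hedge (t₂.table _ hpm) (t₂.table _ hs.le) hsep' hcompl ?_ ?_
          · rw [m7, Function.update_self]
          · rw [m11]; exact hnew
        · rw [below_insert_of_ne htp]
          refine (t₂.table t ht).congr ?_ fun i c hcn => ?_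
          · rw [m7, Function.update_of_ne (Ne.symm htp)]
          · rw [m11]; exact hold _ _ _ (hnum t ht).1 (hnum t ht).2 hcn
      · intro t ht
        rw [m7, Function.update_apply]
        split_ifs
        · exact .inr ⟨s, .inl rfl, hs, rfl⟩
        · refine (t₂.number t ht).imp id ?_
          rintro ⟨c, hc, h'⟩
          exact ⟨c, .inr hc, h'⟩
      · intro s' hs' hs'P i c hcn
        rw [Set.mem_insert_iff, not_or] at hs'P
        rw [m11, hold _ _ _ (by omega) (by omega) hcn]
        exact t₂.fresh s' hs' hs'P.2 i c hcn
      -- After the root is absorbed, the additional node has a stored table, so the answer can be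
      -- read from memory and not from the virtual table.
      · intro hrP
        rw [m7, Function.update_apply]
        split_ifs with hpar
        · omega
        · refine t₂.root_number (hrP.resolve_left ?_)
          rintro rfl
          exact hpar hroot.symm
    set a₁ := a.setReg 7 (a.mem 2 s) with ha₁
    have f₁ : Frame {7} ∅ a a₁ := (Frame.refl _ _ a).setReg (by decide) _
    have t₁ := ht.frame f₁ (by decide) (by decide)
    have h6₁ : a₁.reg 6 = s := by rw [f₁.reg 6 (by decide), h6]
    refine Runs.seq (Runs.when (by decide) (fun hh => ?_) fun hh => ?_)
    · rw [Tm.holds_eq] at hh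
      simp only [Tm.eval, h6₁, t₁.r4] at hh
      refine Runs.set' (v := m) (by decide) (by omega) t₁.r3 hm ?_
      refine key _ (f₁.setReg (by decide) _) ?_
      rw [setReg_reg_self, hh, hroot]
    · rw [Tm.holds_eq] at hh
      simp only [Tm.eval, h6₁, t₁.r4] at hh
      refine key _ f₁ ?_
      rw [ha₁, setReg_reg_self, ht.par s hs hh]
  · simp only [mergeTime, Polynomial.eval_add, Polynomial.eval_mul, Polynomial.eval_X,
      Polynomial.eval_ofNat, Polynomial.eval_one]
    have h1 : 1 ≤ K := hpos.trans hplace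
    have h2 : place (base 32 fun u => X s u ∨ X (par s) u) n * ((n + 1) * (n + 1)) *
        (pairTime.eval π.N + 8) ≤ K * (π.N * π.N * (pairTime.eval π.N + 8)) := by
      rw [← mul_assoc K]
      gcongr
    -- Every part of the running time is charged with the factor `K ≥ 1`, though only the loop over
    -- joint labels needs it.
    have h3 : ∀ x, x ≤ K * x := fun x => Nat.le_mul_of_pos_left _ h1
    simp only [mul_add K]
    gcongr ?_ + (?_ + (?_ + ?_) + (?_ + (?_ + (?_ + ?_) + ?_)))
    all_goals exact h3 _

theorem runs_stepProg (hr : Ranges Adj X n) (hsym : ∀ u v, Adj u v → Adj v u)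
    (hedge : ∀ u v, Adj u v → ∃ t, X t u ∧ X t v) (hT : IsTree m par) (hroot : par root = m)
    (hpar : ∀ s < m, s ≠ root → par s < m)
    (hsep : ∀ s < m, Separates X (Desc m par s) s (par s))
    (hK : ∀ s < m, place (base 32 fun u => X s u ∨ X (par s) u) n ≤ K) (hK1 : 1 ≤ K)
    (hKM : K * ((n + 1) * (n + 1)) < π.M) (hmM : m + 1 < π.M) {a : State}
    (hi : Inp Adj τ X n m a) (hl : HasLink Adj τ n a) (ht : TreeInp m root par a)
    (htab : Tables Adj τ X n m root par P a) (hq : Queue m par P h a) (hm : h < m)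
    (h5 : a.reg 5 = h) {Q : State → Prop}
    (hQ : ∀ a' P', Frame {6, 7, 8, 9, 10, 11, 12, 13, 15, 16, 17, 18} {5, 6, 7, 8, 9, 10, 11} a a' →
      Tables Adj τ X n m root par P' a' → Queue m par P' (h + 1) a' → Q a') :
    Runs π stepProg a (K * stepTime.eval π.N) Q := by
  obtain ⟨hs, hsP, hc⟩ := hq.next hT hm
  set s := a.mem 6 h with hsdef
  refine Runs.mono (T := (setTime (.load 6 (.reg 5))).eval π.N +
    (K * mergeTime.eval π.N + pushTime.eval π.N)) (Q := Q) ?_ ?_ fun _ _ => id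
  · refine Runs.seq (Runs.set' (v := s) (by decide) (by omega) (by simp only [Tm.eval, h5, hsdef])
      (by omega) ?_)
    have f₁ : Frame {6} ∅ a (a.setReg 6 s) := (Frame.refl _ _ a).setReg (by decide) _
    refine Runs.seq (runs_mergeProg hr hsym hedge hT hroot hsep hK hKM (by omega)
      (hi.frame f₁ (by decide) (by decide)) (hl.frame f₁ (by decide))
      (ht.frame f₁ (by decide) (by decide)) (htab.frame f₁ (by decide)) hs hsP hc
      (setReg_reg_self _ _ _) ?_)
    intro a₂ f₂ h7 t₂
    have f₂' : Frame {6, 7, 8, 9, 10, 11, 12, 13, 15, 16, 17, 18} {5, 6, 7, 8, 9, 10, 11} a a₂ :=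
      (f₁.mono (by decide) (by decide)).trans (f₂.mono (by decide) (by decide))
    refine runs_pushProg hT hroot hpar (s := s) (ht.frame f₂' (by decide) (by decide))
      ((hq.frame f₁ (by decide) (by decide)).frame f₂ (by decide) (by decide)) hm ?_ h7 ?_ hmM ?_
    · rw [f₂.reg 6 (by decide), setReg_reg_self]
    · rw [f₂.mem 6 (by decide), setReg_mem, hsdef]
    · intro a₃ f₃ q₃
      exact hQ a₃ _ (f₂'.trans (f₃.mono (by decide) (by decide))) (t₂.frame f₃ (by decide)) q₃
  · simp only [stepTime, Polynomial.eval_add, mul_add]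
    gcongr
    · exact Nat.le_mul_of_pos_left _ hK1
    · exact Nat.le_mul_of_pos_left _ hK1

/-- The term counts the `i ≤ n` for which no entry is at most `i`; these are exactly the numbers
below the minimum. -/
theorem eval_minEntry {a : State} (hi : Inp Adj τ X n m a) {S : Set ℕ} {c₀ : ℕ}
    (hS : ∀ c ≤ n, a.mem 11 (cellIdx n m (a.mem 7 m) 0 c) ≠ 0 ↔ c ∈ S) (hc₀ : IsLeast S c₀)
    (hle : c₀ ≤ n) : Tm.minEntry.eval a = c₀ := by
  classical
  unfold cellIdx at hS
  have hterm : ∀ i < n + 1, (Tm.not (.ex 21 2 (.and (.le (.reg 21) (.reg 20))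
      (.load 11 (.cell (.load 7 (.reg 3)) (.lit 0) (.reg 21)))))).eval (a.setReg 20 i) =
      if i < c₀ then 1 else 0 := by
    intro i hin
    have hex : (Tm.ex 21 2 (.and (.le (.reg 21) (.reg 20))
        (.load 11 (.cell (.load 7 (.reg 3)) (.lit 0) (.reg 21))))).Holds (a.setReg 20 i) ↔
        ¬ i < c₀ := by
      rw [Tm.holds_ex, setReg_reg_of_ne _ _ (by omega), hi.r2]
      simp only [Tm.holds_and, Tm.holds_le, Tm.holds_load, Tm.cell, Tm.eval, setReg_mem,
        setReg_reg, Nat.reduceEqDiff, reduceIte, hi.r2, hi.r3]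
      constructor
      · rintro ⟨c, hc, hci, hcell⟩
        have := hc₀.2 ((hS c (by omega)).1 hcell)
        omega
      · intro hlt
        exact ⟨c₀, by omega, by omega, (hS c₀ hle).2 hc₀.1⟩
    unfold Tm.Holds at hex
    simp only [Tm.not, Tm.eval] at hex ⊢
    split_ifs with hlt
    · have : ¬ _ := fun hne => (hex.1 hne) hlt
      omega
    · have := hex.2 hlt
      omega
  simp only [Tm.minEntry]
  rw [Tm.eval, hi.r2, Finset.sum_congr rfl fun i hi => hterm i (Finset.mem_range.1 hi),
    Finset.sum_ite, Finset.sum_const_zero, add_zero, Finset.sum_const, smul_eq_mul, mul_one,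
    show (Finset.range (n + 1)).filter (· < c₀) = Finset.range c₀ by ext; simp; omega,
    Finset.card_range]

/-- The meaning of the problem enters only through `hS`, which says that a correct table of the
additional node lists the elements of `S` up to `n`. -/
theorem runs_solveProg (hr : Ranges Adj X n) (hsym : ∀ u v, Adj u v → Adj v u)
    (hedge : ∀ u v, Adj u v → ∃ t, X t u ∧ X t v) (hT : IsTree m par) (hrm : root < m)
    (hroot : par root = m) (hpar : ∀ s < m, s ≠ root → par s < m)
    (hsep : ∀ s < m, Separates X (Desc m par s) s (par s))
    (hK : ∀ s < m, place (base 32 fun u => X s u ∨ X (par s) u) n ≤ K) (hK1 : 1 ≤ K)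
    (hKM : K * ((n + 1) * (n + 1)) < π.M) (hmM : m + 1 < π.M) (hnM : 2 * n * (2 * n) < π.M)
    {a : State} (hi : Inp Adj τ X n m a) (ht : TreeInp m root par a) (h8 : a.reg 8 = 0)
    (hzero : ∀ i ≥ 4, ∀ y, a.mem i y = 0) {S : Set ℕ} {c₀ : ℕ} (hc₀ : IsLeast S c₀) (hle : c₀ ≤ n)
    (hS : ∀ a, TableOk Adj τ X n m a m {t | t < m} → a.mem 7 m ≠ 0 →
      ∀ c ≤ n, a.mem 11 (cellIdx n m (a.mem 7 m) 0 c) ≠ 0 ↔ c ∈ S) :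
    Runs π solveProg a (K * m * solveTime.eval π.N) fun a' => a'.reg 19 = c₀ := by
  have hM := π.le_M
  have hn : n < π.M := by nlinarith
  refine Runs.mono (T := closureTime.eval π.N + ((m * (countTime.eval π.N + 8) + 6) +
    ((m * (leafTime.eval π.N + 8) + 6) + ((m * (K * stepTime.eval π.N + 8) + 6) +
      (setTime .minEntry).eval π.N)))) (Q := fun a' => a'.reg 19 = c₀) ?_ ?_ fun _ _ => id
  · unfold solveProg
    refine Runs.seq (runs_closureProg hr hi (hzero 4 (by omega)) hnM fun a₁ f₁ l₁ => ?_)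
    have t₁ := ht.frame f₁ (by decide) (by decide)
    refine Runs.seq (runs_countProg hroot hpar t₁ (fun y => ?_) (by omega) fun a₂ f₂ c₂ => ?_)
    · rw [f₁.mem 5 (by decide), hzero 5 (by omega)]
    have t₂ := t₁.frame f₂ (by decide) (by decide)
    refine Runs.seq (runs_leafProg t₂.r3 ?_ c₂ (by omega) fun a₃ f₃ q₃ => ?_)
    · rw [f₂.reg 8 (by decide), f₁.reg 8 (by decide), h8]
    have f₃' : Frame {5, 8, 13, 18} {4, 5, 6} a a₃ := ((f₁.mono (by decide) (by decide)).trans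
      (f₂.mono (by decide) (by decide))).trans (f₃.mono (by decide) (by decide))
    have t₃ := ht.frame f₃' (by decide) (by decide)
    have l₃ := (l₁.frame f₂ (by decide)).frame f₃ (by decide)
    have tab₃ : Tables Adj τ X n m root par ∅ a₃ := by
      have e7 : a₃.mem 7 = a.mem 7 := f₃'.mem 7 (by decide)
      have e11 : a₃.mem 11 = a.mem 11 := f₃'.mem 11 (by decide)
      refine ⟨fun t _ => ?_, fun t _ => .inl ?_, fun s _ _ i c _ => ?_, by simp⟩
      · have : Below m par ∅ t = ∅ := by ext; simp [Below]
        rw [this]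
        exact TableOk.empty (by rw [e7, hzero 7 (by omega)])
      · rw [e7, hzero 7 (by omega)]
      · rw [e11, hzero 11 (by omega)]
    refine Runs.seq (Runs.forLoop (by omega) (by decide) (by decide) t₃.r3 (by omega)
      (fun h a' => Inp Adj τ X n m a' ∧ HasLink Adj τ n a' ∧ TreeInp m root par a' ∧
        ∃ P, Tables Adj τ X n m root par P a' ∧ Queue m par P h a') ?_ ?_ ?_)
    · have f₄ : Frame {5} ∅ a₃ (a₃.setReg 5 0) := (Frame.refl _ _ a₃).setReg (by decide) _
      exact ⟨(hi.frame f₃' (by decide) (by decide)).frame f₄ (by decide) (by decide),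
        l₃.frame f₄ (by decide), t₃.frame f₄ (by decide) (by decide), ∅,
        tab₃.frame f₄ (by decide), q₃.frame f₄ (by decide) (by decide)⟩
    · rintro h hh a₄ - h5 h3 ⟨i₄, l₄, t₄, P, tab₄, q₄⟩
      refine runs_stepProg hr hsym hedge hT hroot hpar hsep hK hK1 hKM hmM i₄ l₄ t₄ tab₄ q₄ hh h5 ?_
      intro a₅ P' f₅ tab₅ q₅
      have f₆ : Frame {5} ∅ a₅ (a₅.setReg 5 (h + 1)) := (Frame.refl _ _ a₅).setReg (by decide) _
      refine ⟨by rw [f₅.reg 5 (by decide), h5], by rw [f₅.reg 3 (by decide), h3], ?_, ?_, ?_, P', ?_,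
        ?_⟩
      · exact (i₄.frame f₅ (by decide) (by decide)).frame f₆ (by decide) (by decide)
      · exact (l₄.frame f₅ (by decide)).frame f₆ (by decide)
      · exact (t₄.frame f₅ (by decide) (by decide)).frame f₆ (by decide) (by decide)
      · exact tab₅.frame f₆ (by decide)
      · exact q₅.frame f₆ (by decide) (by decide)
    · rintro a₄ - ⟨i₄, -, -, P, tab₄, q₄⟩
      -- After `m` rounds the queue has delivered `m` distinct nodes, hence all of them.
      have hP : ∀ c < m, c ∈ P := by
        classical
        have himg : (Finset.range m).image (a₄.mem 6) = Finset.range m := by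
          refine Finset.eq_of_subset_of_card_le (fun s hs => ?_) ?_
          · obtain ⟨j, hj, rfl⟩ := Finset.mem_image.1 hs
            exact Finset.mem_range.2 (q₄.lt j ((Finset.mem_range.1 hj).trans_le q₄.le_tail))
          · rw [Finset.card_image_of_injOn]
            intro j hj k hk
            simp only [Finset.coe_range, Set.mem_Iio] at hj hk
            exact q₄.inj j (hj.trans_le q₄.le_tail) k (hk.trans_le q₄.le_tail)
        intro c hc
        have : c ∈ (Finset.range m).image (a₄.mem 6) := by rw [himg]; simpa using hc
        obtain ⟨j, hj, hjc⟩ := Finset.mem_image.1 this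
        exact (q₄.mem_iff c).2 ⟨j, by simpa using hj, hjc⟩
      have htab := tab₄.table m le_rfl
      rw [below_root hT hP] at htab
      refine Runs.set' (v := c₀) (by decide) (by omega) ?_ (by omega) (setReg_reg_self _ _ _)
      exact eval_minEntry i₄ (hS a₄ htab (tab₄.root_number (hP root hrm))) hc₀ hle
  · have hm1 : 1 ≤ m := by omega
    have hKm : 1 ≤ K * m := Nat.mul_pos hK1 hm1
    have h3 : ∀ x, x ≤ K * m * x := fun x => Nat.le_mul_of_pos_left _ hKm
    have h4 : ∀ x, m * x ≤ K * m * x := fun x => Nat.mul_le_mul_right _ (Nat.le_mul_of_pos_left _ hK1)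
    simp only [solveTime, Polynomial.eval_add, Polynomial.eval_ofNat, mul_add]
    gcongr ?_ + ((?_ + ?_ + ?_) + ((?_ + ?_ + ?_) + ((?_ + ?_ + ?_) + ?_)))
    all_goals first | exact h3 _ | exact h4 _ | skip
    rw [← mul_assoc, mul_comm m K]

end

end WordRAM

/-! ### Final assembly: input state, word length, and the time bound. -/

namespace NonMonotone

variable {n m : ℕ}

/-- Thresholds do not exceed degrees, so the full set is stable; this guarantees that the minimum
exists and is at most `n`. -/
theorem isTargetSet_univ {V : Type*} [Fintype V] [DecidableEq V] {G : SimpleGraph V}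
    [DecidableRel G.Adj] {τ : V → ℕ} (h : ∀ u, τ u ≤ G.degree u) :
    IsTargetSet G τ Finset.univ := by
  refine ⟨0, fun t _ => ?_⟩
  induction t with
  | zero => rfl
  | succ t ih => simp [activation, ih, h]

theorem bagWidth_eq (X : Fin m → Finset (Fin n)) : bagWidth X = maxBag X - 1 := rfl

end NonMonotone

namespace WordRAM

open NonMonotone MixedRadix NatTree

variable {n m : ℕ}

theorem matArray_cell {r c : ℕ} (R : Fin r → Fin c → Prop) [∀ i j, Decidable (R i j)] (i : ℕ)
    {j : ℕ} (hj : j < c) : matArray R (i * c + j) ≠ 0 ↔ ∃ hi : i < r, R ⟨i, hi⟩ ⟨j, hj⟩ := by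
  have h1 : (i * c + j) / c = i := by
    rw [mul_comm, Nat.mul_add_div (by omega), Nat.div_eq_of_lt hj, add_zero]
  have h2 : (i * c + j) % c = j := by rw [mul_comm, Nat.mul_add_mod, Nat.mod_eq_of_lt hj]
  simp only [matArray, h1, h2]
  by_cases hi : i < r
  · simp [hi, hj]
  · simp [hi]

theorem matArray_le_one {r c : ℕ} (R : Fin r → Fin c → Prop) [∀ i j, Decidable (R i j)] (i : ℕ) :
    matArray R i ≤ 1 := by
  unfold matArray
  split_ifs <;> omega

theorem code_of_empty {q : ℕ} {B : ℕ → Prop} (hB : ∀ u, ¬ B u) (d : ℕ → ℕ) : code n q B d = 0 := by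
  simp [code, encode, mask, hB]

/-- The preparation of the registers, the computation, and the output. -/
def targetSetProg : Prog :=
  .seq (.assign 3 (.reg 1)) <| .seq (.assign 4 (.reg 2)) <|
  .seq (.assign 1 (.add (.reg 0) (.reg 0))) <| .seq (.assign 2 (.add (.reg 0) (.lit 1))) <|
  .seq solveProg (.assign 0 (.reg 19))

/-- The state after the preparation of the registers. -/
def prepared (a : State) : State :=
  (((a.setReg 3 (a.reg 1)).setReg 4 (a.reg 2)).setReg 1 (a.reg 0 + a.reg 0)).setReg 2 (a.reg 0 + 1)

section

variable {G : SimpleGraph (Fin n)} [DecidableRel G.Adj] {τ : Fin n → ℕ} {T : ParentTree (Fin m)}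
  {X : Fin m → Finset (Fin n)}

theorem exec_targetSetProg {π : Params} (hn : 2 * n < π.M) (hm : m < π.M) {T' c₀ : ℕ}
    (hb : Bdd numReg π.M π.N (prepared (input G τ T X)))
    (h : Runs π solveProg (prepared (input G τ T X)) T' fun a => a.reg 19 = c₀) :
    ∃ t s, Exec π.ℓ targetSetProg (input G τ T X) t s ∧ s.reg 0 = c₀ ∧ t ≤ T' + 14 := by
  have hM := π.le_M
  have hMl : π.M ≤ 2 ^ π.ℓ := (Nat.le_self_pow (by decide) _).trans π.fits
  have hroot := T.root.2
  obtain ⟨t, s, a', h1, h2, h3, h4, h5⟩ := h hb _ (Agree.refl _ _)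
  have h19 : s.reg 19 = c₀ := (h3.2 19 (by decide)).trans h5
  have hlt : s.reg 19 < 2 ^ π.ℓ := by
    rw [h3.2 19 (by decide)]
    exact (h4.reg 19 (by decide)).trans_le hMl
  refine ⟨_, _, .seq (.assign _ _ _ ?_) <| .seq (.assign _ _ _ ?_) <| .seq (.assign _ _ _ ?_) <|
    .seq (.assign _ _ _ ?_) <| .seq h1 (.assign s 0 (.reg 19) hlt), ?_, ?_⟩
  · change m < 2 ^ π.ℓ; omega
  · change (T.root : ℕ) < 2 ^ π.ℓ; omega
  · change n < 2 ^ π.ℓ ∧ n < 2 ^ π.ℓ ∧ n + n < 2 ^ π.ℓ; omega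
  · change n < 2 ^ π.ℓ ∧ 1 < 2 ^ π.ℓ ∧ n + 1 < 2 ^ π.ℓ; omega
  · rw [setReg_reg_self]; exact h19
  -- The five assignments around `solveProg` cost 2 + 2 + 4 + 4 + 2 = 14 steps.
  · simp only [Expr.cost]; omega

theorem inp_prepared : Inp (natAdj G) (vecArray τ) (natBag X) n m (prepared (input G τ T X)) := by
  refine ⟨rfl, ?_, rfl, rfl, fun u hu v hv => ?_, fun u _ => rfl, fun t _ u hu => ?_⟩
  · rw [two_mul]; rfl
  · refine (matArray_cell (fun u v => G.Adj u v) u hv).trans ?_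
    simp [natAdj, hu, hv]
  · refine (matArray_cell (fun t u => u ∈ X t) t hu).trans ?_
    simp [natBag, hu]

theorem treeInp_prepared :
    TreeInp m T.root (natParent T) (prepared (input G τ T X)) := by
  refine ⟨rfl, rfl, fun s hs hne => ?_⟩
  have : (prepared (input G τ T X)).mem 2 s = vecArray (fun t => (T.parent t : ℕ)) s := rfl
  rw [this, vecArray, dif_pos hs, natParent, dif_pos hs, if_neg hne]

theorem bdd_prepared {M N : ℕ} (hτ : ∀ u, τ u ≤ G.degree u) (hn : 2 * n + 1 < M) (hm : m < M)
    (hN : 2 * n + 1 ≤ N) : Bdd numReg M N (prepared (input G τ T X)) := by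
  have hroot := T.root.2
  refine ⟨fun x _ => ?_, fun i y => ?_, fun y hy => ?_⟩
  · simp only [prepared, setReg_reg]
    simp only [input]
    split_ifs
    · omega
    · omega
    · omega
    · omega
    · split <;> omega
  · change (input G τ T X).mem i y < M
    match i with
    | 0 => exact (matArray_le_one (fun u v => G.Adj u v) _).trans_lt (by omega)
    | 1 =>
      simp only [input, vecArray]
      split_ifs
      · exact ((hτ _).trans (G.degree_lt_card_verts _).le).trans_lt (by simp; omega)
      · omega
    | 2 =>
      simp only [input, vecArray]
      split_ifs
      · exact (Fin.is_lt _).trans hm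
      · omega
    | 3 => exact (matArray_le_one (fun t u => u ∈ X t) _).trans_lt (by omega)
    | _ + 4 => simp only [input]; omega
  · interval_cases y
    · change n ≤ N; omega
    · change n + n ≤ N; omega
    · change n + 1 ≤ N; omega

theorem mem_prepared_of_le (i : ℕ) (hi : 4 ≤ i) (y : ℕ) :
    (prepared (input G τ T X)).mem i y = 0 := by
  change (input G τ T X).mem i y = 0
  match i with
  | _ + 4 => rfl

/-- The bag of the additional node is empty, so all labels have code 0 and its table is just a list
of counts. -/
theorem entry_iff (hX : T.IsTreeDecomposition G X)
    (h1 : ∀ u, τ u = 0 ∨ τ u = 1 ∨ τ u = G.degree u) {a : State}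
    (h : TableOk (natAdj G) (vecArray τ) (natBag X) n m a m {t | t < m}) (h7 : a.mem 7 m ≠ 0) {c : ℕ}
    (hc : c ≤ n) : a.mem 11 (cellIdx n m (a.mem 7 m) 0 c) ≠ 0 ↔
      ∃ Y, IsTargetSet G τ Y ∧ Y.card = c := by
  have hcode : ∀ d, code n 8 (natBag X m) d = 0 :=
    code_of_empty fun u hu => lt_irrefl _ hu.1
  have hentry : ∀ d c, Entry (vecArray τ) n m a (a.mem 7 m) (natBag X m) d c ↔
      a.mem 11 (cellIdx n m (a.mem 7 m) 0 c) ≠ 0 := by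
    intro d c
    simp [Entry, h7, hcode]
  constructor
  · intro hne
    exact exists_targetSet_of_partialSol hX h1
      (h.sound (fun _ => 0) c (by simp) hc ((hentry _ _).2 hne))
  · rintro ⟨Y, hY, rfl⟩
    rw [← forgotten_natMem hX Y, ← hentry]
    exact h.complete _ _ (hY.isSol hX h1)

theorem place_le_maxBag (hX : T.IsNice X) {s : ℕ} (hs : s < m) :
    place (base 32 fun u => natBag X s u ∨ natBag X (natParent T s) u) n ≤ 32 ^ maxBag X := by
  classical
  rw [place_base]
  refine Nat.pow_le_pow_right (by omega) ?_
  convert card_union_le_maxBag hX hs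

theorem exec_input {π : Params} (hτ : ∀ u, τ u ≤ G.degree u)
    (h1 : ∀ u, τ u = 0 ∨ τ u = 1 ∨ τ u = G.degree u) (hX : T.IsTreeDecomposition G X)
    (hnice : T.IsNice X) (hN : π.N = 2 * n + 1) (hn : 2 * n + 1 < π.M) (hm : m + 1 < π.M)
    (hnn : 2 * n * (2 * n) < π.M) (hK : 32 ^ maxBag X * ((n + 1) * (n + 1)) < π.M) :
    ∃ t s, Exec π.ℓ targetSetProg (input G τ T X) t s ∧
      IsLeast {c : ℕ | ∃ Y : Finset (Fin n), IsTargetSet G τ Y ∧ Y.card = c} (s.reg 0) ∧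
      t ≤ 32 ^ maxBag X * m * (solveTime.eval (2 * n + 1) + 14) := by
  classical
  set S := {c : ℕ | ∃ Y : Finset (Fin n), IsTargetSet G τ Y ∧ Y.card = c} with hS
  have hex : ∃ c, c ∈ S := ⟨_, Finset.univ, isTargetSet_univ hτ, rfl⟩
  have hleast : IsLeast S (Nat.find hex) := ⟨Nat.find_spec hex, fun c hc => Nat.find_min' hex hc⟩
  have hle : Nat.find hex ≤ n := by
    refine Nat.find_min' hex ⟨Finset.univ, isTargetSet_univ hτ, by simp⟩
  have hroot : natParent T T.root = m := by simp [natParent]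
  have hpar : ∀ s < m, s ≠ T.root → natParent T s < m := fun s hs hne => by
    rw [natParent, dif_pos hs, if_neg hne]; exact Fin.is_lt _
  obtain ⟨t, s, e1, e2, e3⟩ := exec_targetSetProg (c₀ := Nat.find hex) (by omega) (by omega)
    (bdd_prepared hτ hn (by omega) hN.ge)
    (runs_solveProg (root := T.root) (par := natParent T) (K := 32 ^ maxBag X) (S := S)
      ⟨fun u v h => ⟨h.1, h.2.1⟩, fun t u h => h.2.1⟩ (natAdj_symm G) (natBag_edge hX)
      (isTree_natParent T) T.root.2 hroot hpar (fun s hs => separates_desc hX hs)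
      (fun s hs => place_le_maxBag hnice hs) (Nat.one_le_pow _ _ (by omega)) hK hm hnn inp_prepared
      treeInp_prepared rfl mem_prepared_of_le hleast hle fun a ha h7 c hc => entry_iff hX h1 ha h7 hc)
  refine ⟨t, s, e1, e2 ▸ hleast, e3.trans ?_⟩
  rw [hN, mul_add]
  have : 1 ≤ 32 ^ maxBag X * m := Nat.mul_pos (by positivity) (T.root.pos)
  gcongr
  omega

end

/-- With `q = 2 ^ B`, both `n + m < q` and `32 ^ w ≤ q ^ 5` hold, so `M = q ^ 10` exceeds all
required bounds, the largest being `q ^ 7`. Then `M ^ maxWeight` is exactly `2 ^ ℓ`. The size is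
positive since `1 ≤ m`, which compensates for `w - 1`. Sum lengths are bounded by `2 * n + 1`
instead of `2 * n` because a register holds `n + 1`, also for `n = 0`. -/
theorem exists_params {w n m : ℕ} (hm : 1 ≤ m) : ∃ π : Params,
    π.ℓ = 10 * maxWeight * ((w - 1) + Nat.size (n + m)) ∧ π.N = 2 * n + 1 ∧ 2 * n + 1 < π.M ∧
    m + 1 < π.M ∧ 2 * n * (2 * n) < π.M ∧ 32 ^ w * ((n + 1) * (n + 1)) < π.M := by
  set B := (w - 1) + Nat.size (n + m) with hB
  have hsize : 1 ≤ Nat.size (n + m) := Nat.size_pos.2 (by omega)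
  have hlt : n + m < 2 ^ B :=
    (Nat.lt_size_self _).trans_le (Nat.pow_le_pow_right (by omega) (by omega))
  have h2 : 2 ≤ 2 ^ B := Nat.le_self_pow (by omega) 2
  have hw : 32 ^ w ≤ (2 ^ B) ^ 5 := by
    rw [show (32 : ℕ) = 2 ^ 5 from rfl, ← pow_mul, ← pow_mul]
    exact Nat.pow_le_pow_right (by omega) (by omega)
  have hM : 2 ^ (10 * B) = (2 ^ B) ^ 10 := by rw [← pow_mul, mul_comm]
  set q := 2 ^ B with hq
  have hpow : ∀ j ≤ 10, q ^ j ≤ q ^ 10 := fun j hj => Nat.pow_le_pow_right (by omega) hj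
  have h64 : 64 ≤ q ^ 10 := (Nat.pow_le_pow_left h2 6).trans (hpow 6 (by omega))
  refine ⟨⟨10 * maxWeight * B, 2 ^ (10 * B), 2 * n + 1, by omega, ?_⟩, rfl, rfl, ?_, ?_, ?_, ?_⟩
  · rw [← pow_mul]
    exact Nat.pow_le_pow_right (by omega) (by rw [mul_right_comm])
  all_goals simp only [hM]
  · have := hpow 2 (by omega)
    nlinarith
  · have := hpow 2 (by omega)
    nlinarith
  · have h4 : q ^ 4 ≤ q ^ 10 := hpow 4 (by omega)
    have h5 : 2 * n < q ^ 2 := by nlinarith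
    calc 2 * n * (2 * n) < q ^ 2 * q ^ 2 := Nat.mul_self_lt_mul_self h5
      _ = q ^ 4 := by ring
      _ ≤ _ := h4
  · have h5 : n + 1 ≤ q := by omega
    have h6 : q ^ 7 < q ^ 10 := Nat.pow_lt_pow_right (by omega) (by omega)
    calc 32 ^ w * ((n + 1) * (n + 1)) ≤ q ^ 5 * (q * q) := by gcongr
      _ = q ^ 7 := by ring
      _ < _ := h6

end WordRAM

open WordRAM NonMonotone in
theorem theorem3 :
    ∃ (p : WordRAM.Prog) (P : Polynomial ℕ) (k : ℕ),
      ∀ (n m : ℕ) (G : SimpleGraph (Fin n)) [DecidableRel G.Adj] (τ : Fin n → ℕ)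
        (T : ParentTree (Fin m)) (X : Fin m → Finset (Fin n)),
        (∀ u, τ u ≤ G.degree u) →
        (∀ u, τ u = 0 ∨ τ u = 1 ∨ τ u = G.degree u) →
        T.IsTreeDecomposition G X → T.IsNice X →
        ∃ (t : ℕ) (s : WordRAM.State),
          WordRAM.Exec (k * ((bagWidth X).toNat + Nat.size (n + m))) p
            (WordRAM.input G τ T X) t s ∧
          IsLeast {c : ℕ | ∃ Y : Finset (Fin n), NonMonotone.IsTargetSet G τ Y ∧ Y.card = c}
            (s.reg 0) ∧
          (t : ℝ) ≤ (2 : ℝ) ^ (5 * bagWidth X) * (m : ℝ) * ((P.eval n : ℕ) : ℝ) := by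
  -- The factor 32 turns the exponent from the width to the maximum order of a bag; `2 * X + 1` is
  -- the bound for the lengths of sums.
  refine ⟨targetSetProg, 32 * (solveTime.comp (2 * Polynomial.X + 1) + 14), 10 * maxWeight, ?_⟩
  intro n m G _ τ T X hτ h1 hX hnice
  obtain ⟨π, hℓ, hN, hn, hm, hnn, hK⟩ := exists_params (w := maxBag X) (n := n) (m := m) T.root.pos
  obtain ⟨t, s, e1, e2, e3⟩ := exec_input hτ h1 hX hnice hN hn hm hnn hK
  refine ⟨t, s, ?_, e2, ?_⟩
  · rw [hℓ] at e1
    have : (bagWidth X).toNat = maxBag X - 1 := by rw [bagWidth_eq]; omega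
    rwa [this]
  -- The power is an integer power over the reals because the width is `-1` if all bags are empty;
  -- the identity also covers that case.
  · have hpow : (2 : ℝ) ^ (5 * bagWidth X) * 32 = 32 ^ maxBag X := by
      rw [bagWidth_eq, mul_sub, zpow_sub₀ two_ne_zero, zpow_mul]
      norm_num
    have heval : (32 * (solveTime.comp (2 * Polynomial.X + 1) + 14)).eval n =
        32 * (solveTime.eval (2 * n + 1) + 14) := by
      simp [Polynomial.eval_comp]
    rw [heval, Nat.cast_mul, Nat.cast_ofNat]
    calc (t : ℝ) ≤ ((32 ^ maxBag X * m * (solveTime.eval (2 * n + 1) + 14) : ℕ) : ℝ) := by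
          exact_mod_cast e3
      _ = 32 ^ maxBag X * m * ((solveTime.eval (2 * n + 1) + 14 : ℕ) : ℝ) := by push_cast; ring
      _ = _ := by rw [← hpow]; ring
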